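/- Setting. Let $n,p\ge 1$ be integers. $n$ agents communicate over directed graphs $\mathcal G_t=([n],\mathcal E_t)$, $t=1,2,\dots$, with mixing matrices $W_t\in\mathbb R^{n\times n}$. Let $\mathbb X\subseteq\mathbb R^p$ be closed and convex, and let $f_{i,t}:\mathbb X\to\mathbb R$ and $g_{i,t}:\mathbb X\to\mathbb R^{m_i}$ ($i\in[n]$, $t\ge1$) be arbitrary sequences of functions fixed in advance. Put $f_t=\frac1n\sum_{j}f_{j,t}$, $g_t=\mathrm{col}(g_{1,t},\dots,g_{n,t})$, $\mathcal X_T=\{x\in\mathbb X: g_t(x)\le 0\ \forall t\in[T]\}$, and assume $\mathcal X_T\neq\emptyset$ for all $T\ge1$. For decisions $x_{i,t}$ let $$\mathrm{Reg}(T)=\frac1n\sum_{i=1}^n\Big(\sum_{t=1}^T f_t(x_{i,t})-\min_{x\in\mathcal X_T}\sum_{t=1}^T f_t(x)\Big),\qquad \mathrm{CCV}(T)=\frac1n\sum_{i=1}^n\sum_{t=1}^T\big\|[g_t(x_{i,t})]_+\big\|.$$ Assumptions. For constants $r>0$, $R$, $F$, $G_1$, $G_2$, $\mu\ge1$, $w\in(0,1)$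 and an integer $B\ge1$: (1) the closed ball of radius $r$ about $0$ is contained in $\mathbb X$, and $\mathbb X$ in the closed ball of radius $R$ about $0$; (2) $|f_{i,t}|\le F$ on $\mathbb X$; (3) all $f_{i,t}$ and all components of $g_{i,t}$ are convex, and at each point of $\mathbb X$ there are subgradients $\partial f_{i,t}(x)$ and (Jacobian) $\partial g_{i,t}(x)$ with $\|\partial f_{i,t}(x)\|\le G_1$ and $\|\partial g_{i,t}(x)\|\le G_2$ (operator norm); (4) $[W_t]_{ij}\ge w$ if $(j,i)\in\mathcal E_t$ or $i=j$, and $[W_t]_{ij}=0$ otherwise; $W_t$ is doubly stochastic; and for every $t\ge1$ the graph $([n],\bigcup_{l=0}^{B-1}\mathcal E_{t+l})$ is strongly connected; (5) each $f_{i,t}$ is $\mu$-strongly convex on $\mathbb X$: $f_{i,t}(x)\ge f_{i,t}(y)+\langle\partial f_{i,t}(y),x-y\rangle+\frac\mu2\|x-y\|^2$ for $x,y\in\mathbb X$. Algorithm. Let $\gamma_0>0$ with $4(p^2+1)G_2^2\gamma_0\le1$, and $$\alpha_t=\frac1{\mu t},\quad \gamma_t=\frac{\gamma_0}{\alpha_t},\quad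 \xi_t=\alpha_t,\quad \delta_t=r\,\alpha_t .$$ Start from $z_{i,1}\in(1-\xi_1)\mathbb X$. For $t=1,2,\dots$ and each $i$, set $x_{i,t}=\sum_j[W_t]_{ij}z_{j,t}$, draw $u_{i,t}$ uniformly from the unit sphere of $\mathbb R^p$ (independently over $i$ and $t$), and set $$q_{i,t+1}=\gamma_t[g_{i,t}(x_{i,t})]_+,\qquad z_{i,t+1}=\mathcal P_{(1-\xi_{t+1})\mathbb X}(x_{i,t}-\alpha_t\hat\omega_{i,t+1}),$$ $$\hat\omega_{i,t+1}=\frac p{\delta_t}\Big(f_{i,t}(x_{i,t}+\delta_tu_{i,t})-f_{i,t}(x_{i,t})+\big\langle g_{i,t}(x_{i,t}+\delta_tu_{i,t})-g_{i,t}(x_{i,t}),\,q_{i,t+1}\big\rangle\Big)u_{i,t},$$ where $\mathcal P_K$ is the Euclidean projection onto $K$. Theorem 4. There is a constant $C$ depending only on $n,p,r,R,F,G_1,G_2,\mu,\gamma_0,w,B$ such that, under (1)-(5), $\mathrm{Reg}(T)$ and $\mathrm{CCV}(T)$ are integrable and for all $T\ge2$ $$\mathbf E[\mathrm{Reg}(T)]\le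 C\log T,\qquad \mathbf E[\mathrm{CCV}(T)]\le C\sqrt{T\log T}.$$ Moreover, for every $\varsigma>0$ there is a constant $C'$ depending only on the same quantities and $\varsigma$ such that, if in addition Slater's condition holds with constant $\varsigma$ (there is $x_s\in\mathbb X$ with every component of $g_t(x_s)$ at most $-\varsigma$ for all $t\ge1$), then $\mathbf E[\mathrm{CCV}(T)]\le C'\log T$ for all $T\ge2$. -/

import Mathlib

open MeasureTheory ProbabilityTheory
open scoped Pointwise

namespace DistBandit

noncomputable section

/-- `ℝᵖ` with the Euclidean norm. -/
abbrev Vec (p : ℕ) : Type := EuclideanSpace ℝ (Fin p)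

/-- `[v]₊`, the projection of `v` onto the nonnegative orthant (componentwise positive part). -/
def pos {ι : Type} [Fintype ι] (v : EuclideanSpace ℝ ι) : EuclideanSpace ℝ ι :=
  WithLp.toLp 2 fun k => max (v k) 0

/-- Euclidean projection: a point of `K` at minimal squared distance from `x`. It is unique, and
it exists, whenever `K` is nonempty, closed and convex. -/
def proj {p : ℕ} (K : Set (Vec p)) (x : Vec p) : Vec p :=
  Classical.epsilon fun y => y ∈ K ∧ IsMinOn (fun y' => ‖x - y'‖ ^ 2) K y

/-- The uniform probability distribution on the unit sphere of `ℝᵖ`. -/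
def uniformSphere (p : ℕ) : Measure (Metric.sphere (0 : Vec p) 1) :=
  ((volume : Measure (Vec p)).toSphere Set.univ)⁻¹ • (volume : Measure (Vec p)).toSphere

/-- The data of the online problem for `n` agents with decisions in `ℝᵖ`: the set `𝕏`, the numbers
`mᵢ` of local constraints, the local losses `f i t` and the local constraint functions `g i t`.
Time is `t = 1, 2, …`; the values at `t = 0` are never used. The functions are only ever
constrained on `𝕏`. -/
structure Problem (n p : ℕ) where
  X : Set (Vec p)
  m : Fin n → ℕ
  f : Fin n → ℕ → Vec p → ℝ
  g : (i : Fin n) → ℕ → Vec p → Vec (m i)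

/-- The time-varying directed graphs (`(G t).Adj j i` means that `(j, i)` is an edge at time `t`)
and the mixing matrices. -/
structure Network (n : ℕ) where
  G : ℕ → Digraph (Fin n)
  W : ℕ → Matrix (Fin n) (Fin n) ℝ

namespace Problem

variable {n p : ℕ} (D : Problem n p)

/-- The global loss `f_t = (1/n) ∑ⱼ f_{j,t}`. -/
def globalLoss (t : ℕ) (x : Vec p) : ℝ := (1 / (n : ℝ)) * ∑ j, D.f j t x

/-- The global constraint function `g_t = col(g_{1,t}, …, g_{n,t})`. -/
def globalConstr (t : ℕ) (x : Vec p) : EuclideanSpace ℝ ((i : Fin n) × Fin (D.m i)) :=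
  WithLp.toLp 2 fun k => D.g k.1 t x k.2

/-- The feasible set `𝒳_T`. -/
def feasible (T : ℕ) : Set (Vec p) :=
  {x | x ∈ D.X ∧ ∀ t ∈ Finset.Icc 1 T, ∀ k, D.globalConstr t x k ≤ 0}

/-- Network regret of the decisions `x t i` (time `t`, agent `i`). -/
def netReg (T : ℕ) (x : ℕ → Fin n → Vec p) : ℝ :=
  (1 / (n : ℝ)) * ∑ i, (∑ t ∈ Finset.Icc 1 T, D.globalLoss t (x t i)
    - ⨅ y : D.feasible T, ∑ t ∈ Finset.Icc 1 T, D.globalLoss t y)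

/-- Network cumulative constraint violation of the decisions `x t i`. -/
def netCCV (T : ℕ) (x : ℕ → Fin n → Vec p) : ℝ :=
  (1 / (n : ℝ)) * ∑ i, ∑ t ∈ Finset.Icc 1 T, ‖pos (D.globalConstr t (x t i))‖

/-- The decision set is closed and convex, and lies between the balls of radii `r` and `R`. -/
structure SetAssumption (r R : ℝ) : Prop where
  isClosed : IsClosed D.X
  convex : Convex ℝ D.X
  ball_subset : Metric.closedBall 0 r ⊆ D.X
  subset_ball : D.X ⊆ Metric.closedBall 0 R

/-- The local losses are bounded by `F` on `𝕏`. -/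
def LossBounded (F : ℝ) : Prop :=
  ∀ i, ∀ t, 1 ≤ t → ∀ x ∈ D.X, |D.f i t x| ≤ F

/-- Convexity, and existence of subgradients (relative to `𝕏`) bounded by `G₁` and `G₂`. The
subgradient of the vector function `g i t` is a linear map (Jacobian), with the operator norm. -/
structure ConvexAssumption (G₁ G₂ : ℝ) : Prop where
  convex_f : ∀ i, ∀ t, 1 ≤ t → ConvexOn ℝ D.X (D.f i t)
  convex_g : ∀ i, ∀ t, 1 ≤ t → ∀ k, ConvexOn ℝ D.X fun x => D.g i t x k
  subgrad_f : ∀ i, ∀ t, 1 ≤ t → ∀ x ∈ D.X, ∃ v : Vec p, ‖v‖ ≤ G₁ ∧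
    ∀ y ∈ D.X, D.f i t x + inner ℝ v (y - x) ≤ D.f i t y
  subgrad_g : ∀ i, ∀ t, 1 ≤ t → ∀ x ∈ D.X, ∃ J : Vec p →L[ℝ] Vec (D.m i), ‖J‖ ≤ G₂ ∧
    ∀ y ∈ D.X, ∀ k, D.g i t x k + J (y - x) k ≤ D.g i t y k

/-- `μ`-strong convexity of the local losses over `𝕏`, in subgradient form. -/
def StronglyConvexLoss (μ : ℝ) : Prop :=
  ∀ i, ∀ t, 1 ≤ t → ∀ y ∈ D.X, ∃ v : Vec p, ∀ x ∈ D.X,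
    D.f i t y + inner ℝ v (x - y) + μ / 2 * ‖x - y‖ ^ 2 ≤ D.f i t x

/-- Slater's condition with constant `ς`. -/
def Slater (ς : ℝ) : Prop :=
  ∃ xs ∈ D.X, ∀ t, 1 ≤ t → ∀ k, D.globalConstr t xs k ≤ -ς

end Problem

/-- The network assumption: weights at least `w` exactly on edges and on the diagonal, doubly
stochastic mixing matrices, and strong connectivity of the union of any `B` consecutive graphs. -/
structure Network.Mixing {n : ℕ} (N : Network n) (w : ℝ) (B : ℕ) : Prop where
  weight_ge : ∀ t, 1 ≤ t → ∀ i j, (N.G t).Adj j i ∨ i = j → w ≤ N.W t i j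
  weight_zero : ∀ t, 1 ≤ t → ∀ i j, ¬ ((N.G t).Adj j i ∨ i = j) → N.W t i j = 0
  row_sum : ∀ t, 1 ≤ t → ∀ i, ∑ j, N.W t i j = 1
  col_sum : ∀ t, 1 ≤ t → ∀ j, ∑ i, N.W t i j = 1
  connected : ∀ t, 1 ≤ t → ∀ i j,
    Relation.ReflTransGen (fun a b => ∃ l < B, (N.G (t + l)).Adj a b) i j

/-- The parameter sequences of the algorithm. -/
structure Params where
  α : ℕ → ℝ
  γ : ℕ → ℝ
  ξ : ℕ → ℝ
  δ : ℕ → ℝ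

/-- `α_t = 1/(μ t)`, `γ_t = γ₀/α_t`, `ξ_t = α_t`, `δ_t = r α_t`. -/
def stronglyConvexParams (μ γ₀ r : ℝ) : Params where
  α t := 1 / (μ * t)
  γ t := γ₀ / (1 / (μ * t))
  ξ t := 1 / (μ * t)
  δ t := r * (1 / (μ * t))

/-- Two-point estimator of the subgradient of a real function. -/
def gradEst {p : ℕ} (δ : ℝ) (h : Vec p → ℝ) (x u : Vec p) : Vec p :=
  ((p : ℝ) / δ * (h (x + δ • u) - h x)) • u

/-- Two-point estimator of the subgradient of a vector function, a `p × m` matrix. -/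
def jacEst {p m : ℕ} (δ : ℝ) (h : Vec p → Vec m) (x u : Vec p) : Matrix (Fin p) (Fin m) ℝ :=
  ((p : ℝ) / δ) • Matrix.vecMulVec u (h (x + δ • u) - h x)

section Algorithm

variable {n p : ℕ} (D : Problem n p) (N : Network n) (a : Params)

/-- The consensus step `x_{i,t} = ∑ⱼ [W_t]_{ij} z_{j,t}`. -/
def mix (t : ℕ) (z : Fin n → Vec p) (i : Fin n) : Vec p := ∑ j, N.W t i j • z j

/-- The dual variable `q_{i,t+1} = γ_t [g_{i,t}(x_{i,t})]₊`, as a function of `x = x_{i,t}`. -/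
def dual (t : ℕ) (i : Fin n) (x : Vec p) : Vec (D.m i) := a.γ t • pos (D.g i t x)

/-- The direction `ω̂_{i,t+1}`, as a function of `x = x_{i,t}` and `u = u_{i,t}`. -/
def direction (t : ℕ) (i : Fin n) (x u : Vec p) : Vec p :=
  gradEst (a.δ t) (D.f i t) x u
    + WithLp.toLp 2 (Matrix.mulVec (jacEst (a.δ t) (D.g i t) x u) (dual D a t i x))

/-- The update from `(z_{i,t})ᵢ` to `(z_{i,t+1})ᵢ` with sampled directions `u = (u_{i,t})ᵢ`. -/
def step (t : ℕ) (u : Fin n → Vec p) (z : Fin n → Vec p) (i : Fin n) : Vec p :=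
  proj ((1 - a.ξ (t + 1)) • D.X) (mix N t z i - a.α t • direction D a t i (mix N t z i) (u i))

/-- The temporary primal variables `z_{i,t}`, started from `z₁` at time `1` (the value at time `0`
is a placeholder), for a realization `u t i` of the sampled directions. -/
def zSeq (z₁ : Fin n → Vec p) (u : ℕ → Fin n → Vec p) : ℕ → Fin n → Vec p
  | 0 => z₁
  | 1 => z₁
  | t + 2 => step D N a (t + 1) (u (t + 1)) (zSeq z₁ u (t + 1))

/-- The decisions `x_{i,t}` generated by the algorithm. -/
def xSeq (z₁ : Fin n → Vec p) (u : ℕ → Fin n → Vec p) (t : ℕ) : Fin n → Vec p :=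
  mix N t (zSeq D N a z₁ u t)

end Algorithm

/-- The random directions `u t i` (`t ≥ 1`) are independent over all agents and times, and each is
uniformly distributed on the unit sphere. -/
structure UniformDirections {n p : ℕ} {Ω : Type*} [MeasurableSpace Ω] (P : Measure Ω)
    (u : ℕ → Fin n → Ω → Metric.sphere (0 : Vec p) 1) : Prop where
  measurable : ∀ t, 1 ≤ t → ∀ i, Measurable (u t i)
  law : ∀ t, 1 ≤ t → ∀ i, P.map (u t i) = uniformSphere p
  indep : iIndepFun (fun k : ℕ × Fin n => u (k.1 + 1) k.2) P

/-- The random decisions `x_{i,t}` of the algorithm at the outcome `ω`. -/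
def decisions {n p : ℕ} {Ω : Type*} (D : Problem n p) (N : Network n) (a : Params)
    (z₁ : Fin n → Vec p) (u : ℕ → Fin n → Ω → Metric.sphere (0 : Vec p) 1) (ω : Ω) :
    ℕ → Fin n → Vec p :=
  xSeq D N a z₁ fun t i => (u t i ω : Vec p)

/-- All standing assumptions on the problem and the network for strongly convex losses:
the set, boundedness, convexity, strong convexity and network assumptions, and nonemptiness of
every feasible set `𝒳_T`. -/
structure Standing {n p : ℕ} (D : Problem n p) (N : Network n)
    (r R F G₁ G₂ μ w : ℝ) (B : ℕ) : Prop where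
  set : D.SetAssumption r R
  lossBounded : D.LossBounded F
  convex : D.ConvexAssumption G₁ G₂
  strong : D.StronglyConvexLoss μ
  mixing : N.Mixing w B
  feasible : ∀ T, 1 ≤ T → (D.feasible T).Nonempty

end

end DistBandit

open DistBandit

/-! The algorithm is projected stochastic gradient descent on the penalized loss `f + ⟨q, g⟩` with
the multiplier frozen at `q = γ_t [g(x)]₊`, combined with consensus averaging. Four ingredients
carry the proof.

Smoothing (`sphere_smoothing`, `two_point_estimate`). The spherical mean of `(p/δ) h(x + δu) u` is
the gradient of the average of `h` over a ball. Hence, if `h` is `G`-Lipschitz and `κ`-strongly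
convex, its inner product with `x - y` is at least `h x - h y - 2Gδ + (κ/2)‖x - y‖²`. Instead of the
divergence theorem on a ball, Lipschitz integration by parts is used against a radial cutoff whose
shell shrinks to the sphere. Subtracting `h x` does not change the mean, but it makes the estimator
bounded independently of `δ`.

One step (`le_integral_inner_direction`, `lyapunov_succ_le`). Given the past, the direction has this
mean because `x_{i,t}` is independent of `u_{i,t}`. Write `A = ‖[g_{i,t}(x_{i,t})]₊‖`. Since `⟨q,
g(x)⟩ = γ_t A²` and `α_t γ_t = γ₀`, the penalty contributes `-2γ₀A²`. The squared step uses up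
`γ₀A²/2` by the condition on `γ₀`, and the errors of smoothing and shrinking use up another
`γ₀A²/2`, so `-γ₀A²` survives. Strong convexity contracts the squared distance by `1 - μα_t = 1 -
1/t`. The other errors are of order `α_t²` or `α_t - α_{t+1}`.

Consensus (`Network.Mixing.trans_ge`, `sum_disagreement_le`). A product of `nB` mixing matrices has
all entries at least `w^(nB)`, hence contracts disagreement. The accumulated disagreement is
therefore controlled by the accumulated step lengths, which are of order `1/t + A`.

Summation. Multiplying the recursion by `t` makes it telescope: `(2/μ) Σ gap + γ₀ Σ t E[A²] =
O(H_T)`, with `H_T` the harmonic sum (`sum_lossGap_add_le`). Young's inequality bounds `Σ E[A]` by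
`θ Σ t E[A²] + H_T/θ` up to constants. For the regret, a small constant `θ` lets the consensus cost
be absorbed by the second-moment term. For the violation, the gap is bounded below, so `Σ t E[A²] =
O(T)`, and `θ = √(H_T/T)` gives `√(T H_T)`. Under Slater's condition the comparator `x_s` adds
`-2γ₀ςA` to each step, and summation without weights gives `Σ E[A] = O(H_T)` directly
(`sum_violationMoment_le_of_slater`). -/

namespace DistBandit

/-! ### Radial cutoff functions. -/

section Cutoff

variable {E : Type*} [NormedAddCommGroup E]

/-- The radial cutoff that is `1` on the ball of radius `δ - ε`, `0` outside that of radius `δ`. -/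
noncomputable def cutoff (δ ε : ℝ) (y : E) : ℝ := max 0 (min 1 ((δ - ‖y‖) / ε))

theorem cutoff_lipschitz (δ : ℝ) {ε : ℝ} (hε : 0 < ε) :
    LipschitzWith (Real.toNNReal (1 / ε)) (cutoff δ ε : E → ℝ) := by
  have h : LipschitzWith (Real.toNNReal (1 / ε)) fun y : E => (δ - ‖y‖) / ε := by
    refine LipschitzWith.of_dist_le_mul fun x y => ?_
    rw [Real.coe_toNNReal _ (by positivity), Real.dist_eq, dist_eq_norm]
    have : (δ - ‖x‖) / ε - (δ - ‖y‖) / ε = 1 / ε * (‖y‖ - ‖x‖) := by ring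
    rw [this, abs_mul, abs_of_nonneg (by positivity : (0 : ℝ) ≤ 1 / ε), ← norm_sub_rev y x]
    gcongr
    exact abs_norm_sub_norm_le y x
  exact (h.const_min 1).const_max 0

theorem cutoff_nonneg (δ ε : ℝ) (y : E) : 0 ≤ cutoff δ ε y := le_max_left _ _

theorem cutoff_le_one (δ ε : ℝ) (y : E) : cutoff δ ε y ≤ 1 := by simp [cutoff]

theorem cutoff_eq_one {δ ε : ℝ} (hε : 0 < ε) {y : E} (hy : ‖y‖ ≤ δ - ε) : cutoff δ ε y = 1 := by
  have : 1 ≤ (δ - ‖y‖) / ε := by rw [le_div_iff₀ hε]; linarith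
  simp [cutoff, this]

theorem cutoff_eq_zero {δ ε : ℝ} (hε : 0 < ε) {y : E} (hy : δ ≤ ‖y‖) : cutoff δ ε y = 0 := by
  have : (δ - ‖y‖) / ε ≤ 0 := div_nonpos_of_nonpos_of_nonneg (by linarith) hε.le
  simp [cutoff, this]

theorem cutoff_eq_div {δ ε : ℝ} (hε : 0 < ε) {y : E} (hy : δ - ε ≤ ‖y‖) (hy' : ‖y‖ ≤ δ) :
    cutoff δ ε y = (δ - ‖y‖) / ε := by
  have h1 : (δ - ‖y‖) / ε ≤ 1 := by rw [div_le_iff₀ hε]; linarith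
  have h2 : 0 ≤ (δ - ‖y‖) / ε := div_nonneg (by linarith) hε.le
  simp [cutoff, h1, h2]

theorem cutoff_hasCompactSupport [ProperSpace E] (δ : ℝ) {ε : ℝ} (hε : 0 < ε) :
    HasCompactSupport (cutoff δ ε : E → ℝ) := by
  refine HasCompactSupport.intro (isCompact_closedBall (0 : E) δ) fun y hy => ?_
  exact cutoff_eq_zero hε (by simpa using (le_of_lt (not_le.1 (by simpa using hy))))

end Cutoff

/-! ### Polar coordinates and integrals over thin shells. -/

section Smoothing

variable {E : Type*} [NormedAddCommGroup E] [InnerProductSpace ℝ E] [FiniteDimensional ℝ E]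
  [MeasurableSpace E] [BorelSpace E] [Nontrivial E]

/-- Polar coordinates for a product of a radial and an angular function. -/
theorem integral_radial_mul_angular (μ : Measure E) [μ.IsAddHaarMeasure] (φ : ℝ → ℝ)
    (ψ : E → ℝ) :
    ∫ y, φ ‖y‖ * ψ (‖y‖⁻¹ • y) ∂μ
      = (∫ u, ψ u ∂μ.toSphere) * ∫ s in Set.Ioi (0 : ℝ), s ^ (Module.finrank ℝ E - 1) * φ s := by
  calc
    ∫ y, φ ‖y‖ * ψ (‖y‖⁻¹ • y) ∂μ
      = ∫ y : ({(0)}ᶜ : Set E), φ ‖y.1‖ * ψ (‖y.1‖⁻¹ • y.1) ∂(μ.comap (↑)) := by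
      rw [integral_subtype_comap (measurableSet_singleton _).compl
        fun y => φ ‖y‖ * ψ (‖y‖⁻¹ • y), restrict_compl_singleton]
    _ = ∫ q, ψ q.1 * φ q.2 ∂μ.toSphere.prod (.volumeIoiPow (Module.finrank ℝ E - 1)) := by
      simpa [mul_comm] using μ.measurePreserving_homeomorphUnitSphereProd.integral_comp
        (Homeomorph.measurableEmbedding _)
        (fun q : Metric.sphere (0 : E) 1 × Set.Ioi (0 : ℝ) => ψ q.1 * φ q.2)
    _ = (∫ u, ψ u ∂μ.toSphere) *
        ∫ s : Set.Ioi (0 : ℝ), φ s ∂.volumeIoiPow (Module.finrank ℝ E - 1) :=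
      integral_prod_mul (fun u : Metric.sphere (0 : E) 1 => ψ u)
        (fun s : Set.Ioi (0 : ℝ) => φ s)
    _ = _ := by
      congr 1
      simp only [Measure.volumeIoiPow, ENNReal.ofReal]
      rw [integral_withDensity_eq_integral_smul,
        integral_subtype_comap measurableSet_Ioi
          fun a ↦ Real.toNNReal (a ^ (Module.finrank ℝ E - 1)) • φ a,
        setIntegral_congr_fun measurableSet_Ioi fun x hx ↦ ?_]
      · rw [NNReal.smul_def, Real.coe_toNNReal _ (pow_nonneg hx.out.le _), smul_eq_mul]
      · exact (measurable_subtype_coe.pow_const _).real_toNNReal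

/-- With `a = δ - ε` and `b = δ`, both bounds divided by `ε` tend to `δ ^ m`; this is the radial
weight that survives when the shell collapses to the sphere. -/
theorem integral_indicator_Ioo_pow {m : ℕ} {a b : ℝ} (ha : 0 ≤ a) (hab : a ≤ b) :
    a ^ m * (b - a) ≤ ∫ s in Set.Ioi (0 : ℝ), s ^ m * (Set.Ioo a b).indicator 1 s ∧
    ∫ s in Set.Ioi (0 : ℝ), s ^ m * (Set.Ioo a b).indicator 1 s ≤ b ^ m * (b - a) := by
  have h : ∫ s in Set.Ioi (0 : ℝ), s ^ m * (Set.Ioo a b).indicator 1 s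
      = ∫ s in Set.Ioo a b, s ^ m := by
    have : (fun s : ℝ => s ^ m * (Set.Ioo a b).indicator 1 s)
        = (Set.Ioo a b).indicator (fun s => s ^ m) := by
      ext s; by_cases hs : s ∈ Set.Ioo a b <;> simp [hs]
    rw [this, setIntegral_indicator measurableSet_Ioo,
      Set.inter_eq_right.2 (show Set.Ioo a b ⊆ Set.Ioi 0 from
        fun s hs => lt_of_le_of_lt ha hs.1)]
  rw [h]
  have hint : IntegrableOn (fun s : ℝ => s ^ m) (Set.Ioo a b) :=
    ((continuous_pow m).integrableOn_Icc (a := a) (b := b)).mono_set Set.Ioo_subset_Icc_self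
  have hv : volume.real (Set.Ioo a b) = b - a := by simp [hab]
  constructor
  · calc a ^ m * (b - a) = ∫ s in Set.Ioo a b, a ^ m := by
          rw [setIntegral_const, hv, smul_eq_mul, mul_comm]
      _ ≤ _ := setIntegral_mono_on (by simp) hint measurableSet_Ioo
          fun s hs => pow_le_pow_left₀ ha hs.1.le m
  · calc _ ≤ ∫ s in Set.Ioo a b, b ^ m :=
          setIntegral_mono_on hint (by simp) measurableSet_Ioo
            fun s hs => pow_le_pow_left₀ (ha.trans hs.1.le) hs.2.le m
      _ = b ^ m * (b - a) := by rw [setIntegral_const, hv, smul_eq_mul, mul_comm]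

/-- The cutoff lies between the indicators of the balls of radii `δ - ε` and `δ`, so its integral
tends to the volume of the ball of radius `δ`. -/
theorem integral_cutoff_mem (μ : Measure E) [μ.IsAddHaarMeasure] {δ ε : ℝ} (hε : 0 < ε)
    (hεδ : ε < δ) :
    (δ - ε) ^ Module.finrank ℝ E * μ.real (Metric.ball 0 1) ≤ ∫ y, cutoff δ ε y ∂μ ∧
    ∫ y, cutoff δ ε y ∂μ ≤ δ ^ Module.finrank ℝ E * μ.real (Metric.ball 0 1) := by
  have hint : Integrable (cutoff δ ε : E → ℝ) μ :=
    (cutoff_lipschitz δ hε).continuous.integrable_of_hasCompactSupport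
      (cutoff_hasCompactSupport δ hε)
  have hball : ∀ s : ℝ, 0 < s → ∫ y, (Metric.ball (0 : E) s).indicator 1 y ∂μ
      = s ^ Module.finrank ℝ E * μ.real (Metric.ball 0 1) := by
    intro s hs
    rw [integral_indicator_one measurableSet_ball, measureReal_def,
      Measure.addHaar_ball _ _ hs.le, ENNReal.toReal_mul, ENNReal.toReal_ofReal (by positivity),
      measureReal_def]
  have hbi : ∀ s : ℝ, Integrable ((Metric.ball (0 : E) s).indicator (1 : E → ℝ)) μ := fun s =>
    (integrable_indicator_iff measurableSet_ball).2
      (integrableOn_const (by exact measure_ball_lt_top.ne))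
  rw [← hball _ (by linarith), ← hball δ (by linarith)]
  constructor
  · refine integral_mono (hbi _) hint fun y => ?_
    by_cases hy : y ∈ Metric.ball (0 : E) (δ - ε)
    · rw [Set.indicator_of_mem hy, cutoff_eq_one hε (by simpa using le_of_lt (by simpa using hy))]
      simp
    · rw [Set.indicator_of_notMem hy]; exact cutoff_nonneg _ _ _
  · refine integral_mono hint (hbi _) fun y => ?_
    by_cases hy : y ∈ Metric.ball (0 : E) δ
    · rw [Set.indicator_of_mem hy]; exact cutoff_le_one _ _ _
    · rw [Set.indicator_of_notMem hy, cutoff_eq_zero hε (by simpa using hy)]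

/-- The cutoff is locally constant off the closed shell and has radial slope `-1/ε` inside it; the
two bounding spheres are null. The direction is `-d` because integration by parts produces that
sign. -/
theorem lineDeriv_cutoff_ae (μ : Measure E) [μ.IsAddHaarMeasure] {δ ε : ℝ} (hε : 0 < ε)
    (hεδ : ε < δ) (d : E) :
    ∀ᵐ y ∂μ, lineDeriv ℝ (cutoff δ ε) y (-d)
      = 1 / ε * ((Set.Ioo (δ - ε) δ).indicator 1 ‖y‖ * inner ℝ (‖y‖⁻¹ • y) d) := by
  have h1 : ∀ s : ℝ, ∀ᵐ y ∂μ, ‖y‖ ≠ s := fun s => by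
    have := Measure.addHaar_sphere μ (0 : E) s
    rw [ae_iff]
    convert! this using 2
    ext y; simp
  filter_upwards [h1 δ, h1 (δ - ε)] with y hy1 hy2
  have hc : Continuous fun t : ℝ => ‖y + t • -d‖ := by fun_prop
  have hc0 : Filter.Tendsto (fun t : ℝ => ‖y + t • -d‖) (nhds 0) (nhds ‖y‖) := by
    simpa using hc.tendsto 0
  rcases lt_or_gt_of_ne hy1 with hy1 | hy1
  · rcases lt_or_gt_of_ne hy2 with hy2 | hy2
    · have : (fun t : ℝ => cutoff δ ε (y + t • -d)) =ᶠ[nhds 0] fun _ => 1 := by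
        filter_upwards [hc0.eventually (gt_mem_nhds hy2)] with t ht
        exact cutoff_eq_one hε ht.le
      rw [lineDeriv, this.deriv_eq, Set.indicator_of_notMem (by simp [hy2.le])]
      simp
    · have : (fun t : ℝ => cutoff δ ε (y + t • -d)) =ᶠ[nhds 0]
          fun t => (δ - ‖y + t • -d‖) / ε := by
        filter_upwards [hc0.eventually (gt_mem_nhds hy1), hc0.eventually (lt_mem_nhds hy2)]
          with t ht ht'
        exact cutoff_eq_div hε ht'.le ht.le
      have hy0 : y ≠ 0 := by
        rintro rfl; simp at hy2; linarith
      have hline : HasDerivAt (fun t : ℝ => y + t • -d) (-d) 0 := by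
        simpa using ((hasDerivAt_id (0 : ℝ)).smul_const (-d)).const_add y
      have hsq : HasDerivAt (fun t : ℝ => ‖y + t • -d‖ ^ 2) (2 * inner ℝ y (-d)) 0 := by
        simpa using hline.norm_sq
      have hn : HasDerivAt (fun t : ℝ => ‖y + t • -d‖)
          (2 * inner ℝ y (-d) / (2 * ‖y‖)) 0 := by
        have := hsq.sqrt (by simpa using hy0)
        simpa [Real.sqrt_sq (norm_nonneg _)] using this
      have hd : HasDerivAt (fun t : ℝ => (δ - ‖y + t • -d‖) / ε)
          (-(2 * inner ℝ y (-d) / (2 * ‖y‖)) / ε) 0 := (hn.const_sub δ).div_const ε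
      rw [lineDeriv, this.deriv_eq, hd.deriv, Set.indicator_of_mem (Set.mem_Ioo.2 ⟨hy2, hy1⟩),
        inner_smul_left, inner_neg_right]
      have := norm_pos_iff.2 hy0
      simp
      field_simp
  · have : (fun t : ℝ => cutoff δ ε (y + t • -d)) =ᶠ[nhds 0] fun _ => 0 := by
      filter_upwards [hc0.eventually (lt_mem_nhds hy1)] with t ht
      exact cutoff_eq_zero hε ht.le
    rw [lineDeriv, this.deriv_eq, Set.indicator_of_notMem (by simp [hy1.le])]
    simp

end Smoothing

/-! ### The smoothing inequality on the sphere. -/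

section Smoothing

open Filter Topology

/-- A line derivative is bounded below by the backward secant, with the strong convexity gain. -/
theorem le_lineDeriv_of_subgradient {E : Type*} [NormedAddCommGroup E] [InnerProductSpace ℝ E]
    {X : Set E} (hX : Convex ℝ X) {h F : E → ℝ} {κ : ℝ}
    (hsub : ∀ y ∈ X, ∃ v : E, ∀ z ∈ X, h y + inner ℝ v (z - y) + κ / 2 * ‖z - y‖ ^ 2 ≤ h z)
    (hF : Set.EqOn h F X) {y d : E} (hy : y ∈ X) (hyd : y - d ∈ X)
    (hdiff : LineDifferentiableAt ℝ F y d) :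
    h y - h (y - d) + κ / 2 * ‖d‖ ^ 2 ≤ lineDeriv ℝ F y d := by
  -- Only the segment from `y` to `y - d` is known to lie in `X`, so the slope is taken from the
  -- left.
  have hlim := hdiff.hasLineDerivAt.tendsto_slope_zero_left
  have hlow : Tendsto (fun t : ℝ => h y - h (y - d) + κ / 2 * (1 + t) * ‖d‖ ^ 2) (𝓝[<] 0)
      (𝓝 (h y - h (y - d) + κ / 2 * ‖d‖ ^ 2)) := by
    have : Continuous fun t : ℝ => h y - h (y - d) + κ / 2 * (1 + t) * ‖d‖ ^ 2 := by fun_prop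
    simpa using (this.tendsto 0).mono_left nhdsWithin_le_nhds
  refine le_of_tendsto_of_tendsto hlow hlim ?_
  filter_upwards [Ioo_mem_nhdsLT (show (-1 : ℝ) < 0 by norm_num)] with t ht
  obtain ⟨s, rfl⟩ : ∃ s, t = -s := ⟨-t, by simp⟩
  have hs0 : 0 < s := by linarith [ht.2]
  have hs1 : s < 1 := by linarith [ht.1]
  have hm : y + (-s) • d ∈ X := by
    have := hX hy hyd (by linarith : 0 ≤ 1 - s) hs0.le (by ring)
    convert this using 1
    module
  obtain ⟨v, hv⟩ := hsub _ hm
  have h1 := hv y hy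
  have h2 := hv (y - d) hyd
  have e1 : y - (y + (-s) • d) = s • d := by module
  have e2 : y - d - (y + (-s) • d) = (-(1 - s)) • d := by module
  rw [e1, inner_smul_right, norm_smul, mul_pow, Real.norm_eq_abs, sq_abs] at h1
  rw [e2, inner_smul_right, norm_smul, mul_pow, Real.norm_eq_abs, sq_abs] at h2
  rw [smul_eq_mul, ← hF hm, ← hF hy, inv_neg, neg_mul, ← mul_neg, ← div_eq_inv_mul,
    le_div_iff₀ hs0]
  -- The weights `1 - s` and `s` cancel the terms in `v` and leave the strong convexity gain `κ/2 *
  -- s * (1 - s) * ‖d‖ ^ 2`.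
  have := mul_le_mul_of_nonneg_left h1 (by linarith : 0 ≤ 1 - s)
  have := mul_le_mul_of_nonneg_left h2 hs0.le
  nlinarith

variable {E : Type*} [NormedAddCommGroup E] [InnerProductSpace ℝ E] [FiniteDimensional ℝ E]
  [MeasurableSpace E] [BorelSpace E] [Nontrivial E]

/-- On the shell, `F y` differs from `F` at the radial projection of `y` to the sphere of radius `δ`
by at most `G * ε`. After this replacement the integrand is a radial factor times an angular one,
and polar coordinates apply. -/
theorem integral_lineDeriv_cutoff_mul_le (ν : Measure E) [ν.IsAddHaarMeasure] {F : E → ℝ}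
    {G : NNReal} (hF : LipschitzWith G F) (d : E) {δ ε : ℝ} (hε : 0 < ε) (hεδ : ε < δ) :
    ∫ y, lineDeriv ℝ (cutoff δ ε) y (-d) * F y ∂ν
      ≤ 1 / ε * ((∫ u, F (δ • (u : E)) * inner ℝ (u : E) d ∂ν.toSphere)
          + G * ε * ‖d‖ * ν.toSphere.real Set.univ)
        * ∫ s in Set.Ioi (0 : ℝ),
            s ^ (Module.finrank ℝ E - 1) * (Set.Ioo (δ - ε) δ).indicator 1 s := by
  have hcF := hF.continuous
  set ψ : E → ℝ := fun u => F (δ • u) * inner ℝ u d + G * ε * ‖d‖ with hψ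
  have hψc : Continuous ψ := by fun_prop
  have hψint : ∫ u, ψ u ∂ν.toSphere = (∫ u, F (δ • (u : E)) * inner ℝ (u : E) d ∂ν.toSphere)
          + G * ε * ‖d‖ * ν.toSphere.real Set.univ := by
    rw [hψ, integral_add, integral_const, smul_eq_mul, mul_comm (ν.toSphere.real _)]
    · have : Continuous fun u : Metric.sphere (0 : E) 1 =>
        F (δ • (u : E)) * inner ℝ (u : E) d := by fun_prop
      exact this.integrable_of_hasCompactSupport (HasCompactSupport.of_compactSpace _)
    · exact integrable_const _
  rw [← hψint, mul_assoc, ← integral_radial_mul_angular, ← integral_const_mul]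
  have hind : ∀ {φ : E → ℝ} (M : ℝ), Measurable φ → (∀ y, ‖y‖ ≤ δ → |φ y| ≤ M) →
      Integrable (fun y => (Set.Ioo (δ - ε) δ).indicator 1 ‖y‖ * φ y) ν := by
    intro φ M hφ hM
    have hm : MeasurableSet {y : E | ‖y‖ ∈ Set.Ioo (δ - ε) δ} :=
      measurable_norm measurableSet_Ioo
    have : (fun y : E => (Set.Ioo (δ - ε) δ).indicator 1 ‖y‖ * φ y)
        = {y : E | ‖y‖ ∈ Set.Ioo (δ - ε) δ}.indicator φ := by
      ext y
      by_cases hy : ‖y‖ ∈ Set.Ioo (δ - ε) δ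
      · rw [Set.indicator_of_mem hy, Set.indicator_of_mem (show y ∈ _ from hy)]
        simp
      · rw [Set.indicator_of_notMem hy, Set.indicator_of_notMem (show y ∉ _ from hy), zero_mul]
    rw [this, integrable_indicator_iff hm]
    refine Measure.integrableOn_of_bounded (M := M) ?_ hφ.aestronglyMeasurable ?_
    · refine ne_top_of_le_ne_top (measure_closedBall_lt_top (x := (0 : E)) (r := δ)).ne
        (measure_mono fun y hy => ?_)
      simpa using hy.2.le
    · filter_upwards [ae_restrict_mem hm] with y hy
      exact hM y hy.2.le
  have hunit : ∀ y : E, ‖‖y‖⁻¹ • y‖ ≤ 1 := fun y => by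
    by_cases hy : y = 0
    · simp [hy]
    · rw [norm_smul, norm_inv, norm_norm, inv_mul_cancel₀ (norm_ne_zero_iff.2 hy)]
  obtain ⟨M₁, hM₁⟩ := (isCompact_closedBall (0 : E) δ).exists_bound_of_continuousOn hcF.continuousOn
  obtain ⟨M₂, hM₂⟩ := (isCompact_closedBall (0 : E) 1).exists_bound_of_continuousOn hψc.continuousOn
  have hinner : ∀ y : E, |inner ℝ (‖y‖⁻¹ • y) d| ≤ ‖d‖ := fun y =>
    (abs_real_inner_le_norm _ _).trans (mul_le_of_le_one_left (norm_nonneg _) (hunit y))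
  have hmu : Measurable fun y : E => ‖y‖⁻¹ • y := measurable_norm.inv.smul measurable_id
  have hI1 := hind (φ := fun y => inner ℝ (‖y‖⁻¹ • y) d * F y) (‖d‖ * M₁)
    ((hmu.inner_const).mul hcF.measurable) fun y hy => by
      rw [abs_mul]
      exact mul_le_mul (hinner y) (hM₁ y (by simpa using hy)) (abs_nonneg _) (norm_nonneg _)
  have hI2 := hind (φ := fun y => ψ (‖y‖⁻¹ • y)) M₂ (hψc.measurable.comp hmu)
    fun y hy => hM₂ _ (by simpa using hunit y)
  have heq : (fun y => lineDeriv ℝ (cutoff δ ε) y (-d) * F y) =ᵐ[ν] fun y =>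
      1 / ε * ((Set.Ioo (δ - ε) δ).indicator 1 ‖y‖ * (inner ℝ (‖y‖⁻¹ • y) d * F y)) := by
    filter_upwards [lineDeriv_cutoff_ae ν hε hεδ d] with y hy
    rw [hy]; ring
  rw [integral_congr_ae heq]
  refine integral_mono (hI1.const_mul _) (hI2.const_mul _) fun y => ?_
  refine mul_le_mul_of_nonneg_left ?_ (by positivity)
  by_cases hy : ‖y‖ ∈ Set.Ioo (δ - ε) δ
  swap
  · simp [hy]
  simp only [Set.indicator_of_mem hy, Pi.one_apply, one_mul, hψ]
  have hy0 : y ≠ 0 := by rintro rfl; simp at hy; linarith [hy.1]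
  have hdist : |F y - F (δ • ‖y‖⁻¹ • y)| ≤ G * ε := by
    have h1 := hF.norm_sub_le y (δ • ‖y‖⁻¹ • y)
    have h2 : y - δ • ‖y‖⁻¹ • y = (‖y‖ - δ) • ‖y‖⁻¹ • y := by
      rw [sub_smul, smul_smul ‖y‖, mul_inv_cancel₀ (norm_ne_zero_iff.2 hy0), one_smul]
    have h3 : ‖y - δ • ‖y‖⁻¹ • y‖ ≤ ε := by
      rw [h2, norm_smul, Real.norm_eq_abs]
      have := mul_le_of_le_one_right (abs_nonneg (‖y‖ - δ)) (hunit y)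
      refine this.trans ?_
      rw [abs_le]; constructor <;> linarith [hy.1, hy.2]
    exact h1.trans (by gcongr)
  have h4 : inner ℝ (‖y‖⁻¹ • y) d * (F y - F (δ • ‖y‖⁻¹ • y)) ≤ ‖d‖ * (G * ε) := by
    refine (le_abs_self _).trans ?_
    rw [abs_mul]
    exact mul_le_mul (hinner y) hdist (abs_nonneg _) (norm_nonneg _)
  linarith

/-- One-point smoothing on the sphere: the average of `(dim / δ) h (x + δ u) u` is an approximate
subgradient at `x` of a Lipschitz strongly convex function `h`. -/
theorem sphere_smoothing (ν : Measure E) [ν.IsAddHaarMeasure] {X : Set E} (hX : Convex ℝ X)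
    {h : E → ℝ} {G : NNReal} (hLip : LipschitzOnWith G h X) {κ : ℝ}
    (hsub : ∀ y ∈ X, ∃ v : E, ∀ z ∈ X, h y + inner ℝ v (z - y) + κ / 2 * ‖z - y‖ ^ 2 ≤ h z)
    {x d : E} {δ : ℝ} (hδ : 0 < δ) (hx : Metric.closedBall x δ ⊆ X)
    (hxd : Metric.closedBall (x - d) δ ⊆ X) :
    (h x - h (x - d) - 2 * G * δ + κ / 2 * ‖d‖ ^ 2) * ν.toSphere.real Set.univ
      ≤ Module.finrank ℝ E / δ * ∫ u, h (x + δ • (u : E)) * inner ℝ (u : E) d ∂ν.toSphere := by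
  -- Integration by parts needs a globally Lipschitz function. The extension agrees with `h` on both
  -- balls that enter.
  obtain ⟨h', hh', heq⟩ := hLip.extend_real
  set F : E → ℝ := fun y => h' (x + y) with hFdef
  have hF : LipschitzWith G F := by
    refine LipschitzWith.of_dist_le_mul fun y z => ?_
    simpa using hh'.dist_le_mul (x + y) (x + z)
  set K := h x - h (x - d) - 2 * G * δ + κ / 2 * ‖d‖ ^ 2 with hK
  set A := ∫ u, F (δ • (u : E)) * inner ℝ (u : E) d ∂ν.toSphere with hA
  have hAeq : ∫ u, h (x + δ • (u : E)) * inner ℝ (u : E) d ∂ν.toSphere = A := by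
    refine integral_congr_ae (Filter.Eventually.of_forall fun u => ?_)
    have hu : ‖(u : E)‖ = 1 := by simp
    have : h (x + δ • (u : E)) = h' (x + δ • (u : E)) :=
      heq (hx (by simp [norm_smul, abs_of_pos hδ]))
    simp only [hFdef, this]
  rw [hAeq]
  set m := Module.finrank ℝ E with hm
  set I : ℝ → ℝ := fun ε => ∫ s in Set.Ioi (0 : ℝ),
    s ^ (m - 1) * (Set.Ioo (δ - ε) δ).indicator 1 s
  -- Moving the secant from `x + y`, `x + y - d` to `x`, `x - d` costs `G * δ` at each end; this is
  -- the error `2 * G * δ` in `K`.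
  have hder : ∀ y : E, ‖y‖ ≤ δ → LineDifferentiableAt ℝ F y d → K ≤ lineDeriv ℝ F y d := by
    intro y hy hdiff
    have hxy : x + y ∈ X := hx (by simpa using hy)
    have hxyd : x + y - d ∈ X := hxd (by
      rw [mem_closedBall_iff_norm, show x + y - d - (x - d) = y by abel]; exact hy)
    have hdiff' : LineDifferentiableAt ℝ h' (x + y) d := by
      simpa [LineDifferentiableAt, hFdef, add_assoc] using hdiff
    have h1 := le_lineDeriv_of_subgradient hX hsub heq hxy hxyd hdiff'
    have h2 : lineDeriv ℝ h' (x + y) d = lineDeriv ℝ F y d := by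
      simp [lineDeriv, hFdef, add_assoc]
    have h3 := hLip.dist_le_mul x (hx (by simp [hδ.le])) _ hxy
    have h4 := hLip.dist_le_mul (x - d) (hxd (by simp [hδ.le])) _ hxyd
    rw [Real.dist_eq] at h3 h4
    have h5 : dist x (x + y) ≤ δ := by simpa using hy
    have h6 : dist (x - d) (x + y - d) ≤ δ := by simpa using hy
    have h7 := abs_le.1 (h3.trans (mul_le_mul_of_nonneg_left h5 G.2))
    have h8 := abs_le.1 (h4.trans (mul_le_mul_of_nonneg_left h6 G.2))
    have h7' := h7.2
    have h8' := h8.1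
    rw [hK, ← h2]
    linarith
  have hmain : ∀ ε, 0 < ε → ε < δ → K * ∫ y, cutoff δ ε y ∂ν
      ≤ (A + G * ε * ‖d‖ * ν.toSphere.real Set.univ) * (I ε / ε) := by
    intro ε hε hεδ
    have hg := cutoff_lipschitz (E := E) δ hε
    have hgc := cutoff_hasCompactSupport (E := E) δ hε
    have hgi : Integrable (cutoff δ ε : E → ℝ) ν :=
      hg.continuous.integrable_of_hasCompactSupport hgc
    have hprod : Integrable (fun y => lineDeriv ℝ F y d * cutoff δ ε y) ν :=
      hgi.bdd_mul (c := G * ‖d‖) (aestronglyMeasurable_lineDeriv hF.continuous ν)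
        (Eventually.of_forall fun y => norm_lineDeriv_le_of_lipschitz ℝ hF)
    calc K * ∫ y, cutoff δ ε y ∂ν = ∫ y, K * cutoff δ ε y ∂ν := (integral_const_mul _ _).symm
      _ ≤ ∫ y, lineDeriv ℝ F y d * cutoff δ ε y ∂ν := by
        refine integral_mono_ae (hgi.const_mul _) hprod ?_
        filter_upwards [hF.ae_lineDifferentiableAt (μ := ν) d] with y hy
        by_cases hyδ : ‖y‖ ≤ δ
        · exact mul_le_mul_of_nonneg_right (hder y hyδ hy) (cutoff_nonneg _ _ _)
        · simp [cutoff_eq_zero hε (not_le.1 hyδ).le]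
      -- Integration by parts moves the derivative from `F` to the cutoff, where it lives on the
      -- shell.
      _ = ∫ y, lineDeriv ℝ (cutoff δ ε) y (-d) * F y ∂ν :=
        LipschitzWith.integral_lineDeriv_mul_eq hF hg hgc d
      _ ≤ _ := integral_lineDeriv_cutoff_mul_le ν hF d hε hεδ
      _ = _ := by ring
  have hsmall : ∀ᶠ ε in 𝓝[>] (0 : ℝ), 0 < ε ∧ ε < δ := Ioo_mem_nhdsGT hδ
  set V := ν.real (Metric.ball (0 : E) 1)
  have hcont : ∀ (k : ℕ) (c : ℝ), Tendsto (fun ε : ℝ => (δ - ε) ^ k * c) (𝓝[>] 0)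
      (𝓝 (δ ^ k * c)) := fun k c => by
    have : Continuous fun ε : ℝ => (δ - ε) ^ k * c := by fun_prop
    simpa using (this.tendsto 0).mono_left nhdsWithin_le_nhds
  have hl1 : Tendsto (fun ε => ∫ y, cutoff δ ε y ∂ν) (𝓝[>] 0) (𝓝 (δ ^ m * V)) := by
    refine tendsto_of_tendsto_of_tendsto_of_le_of_le' (hcont m V) tendsto_const_nhds ?_ ?_
    · filter_upwards [hsmall] with ε hε using (integral_cutoff_mem ν hε.1 hε.2).1
    · filter_upwards [hsmall] with ε hε using (integral_cutoff_mem ν hε.1 hε.2).2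
  have hl2 : Tendsto (fun ε => I ε / ε) (𝓝[>] 0) (𝓝 (δ ^ (m - 1))) := by
    have hc := hcont (m - 1) 1
    simp only [mul_one] at hc
    refine tendsto_of_tendsto_of_tendsto_of_le_of_le' hc tendsto_const_nhds ?_ ?_
    · filter_upwards [hsmall] with ε hε
      have := (integral_indicator_Ioo_pow (m := m - 1) (a := δ - ε) (b := δ)
        (by linarith [hε.2]) (by linarith [hε.1])).1
      rw [le_div_iff₀ hε.1]; simpa using this
    · filter_upwards [hsmall] with ε hε
      have := (integral_indicator_Ioo_pow (m := m - 1) (a := δ - ε) (b := δ)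
        (by linarith [hε.2]) (by linarith [hε.1])).2
      rw [div_le_iff₀ hε.1]; simpa using this
  have hl3 : Tendsto (fun ε : ℝ => A + G * ε * ‖d‖ * ν.toSphere.real Set.univ) (𝓝[>] 0) (𝓝 A) := by
    have : Continuous fun ε : ℝ => A + G * ε * ‖d‖ * ν.toSphere.real Set.univ := by fun_prop
    simpa using (this.tendsto 0).mono_left nhdsWithin_le_nhds
  -- As `ε → 0` this reads `K * δ ^ m * V ≤ A * δ ^ (m - 1)`. The total mass `m * V` of the sphere
  -- measure then supplies the factor `m` of the claim.
  have hfin := le_of_tendsto_of_tendsto (hl1.const_mul K) (hl3.mul hl2)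
    (by filter_upwards [hsmall] with ε hε using hmain ε hε.1 hε.2)
  have hmpos : 0 < m := Module.finrank_pos
  rw [Measure.toSphere_real_apply_univ, ← hm]
  change K * (m * V) ≤ _
  have hpow : δ ^ m = δ ^ (m - 1) * δ := by rw [← pow_succ, Nat.sub_add_cancel hmpos]
  rw [hpow] at hfin
  have hp : 0 < δ ^ (m - 1) := by positivity
  have h9 : K * δ * V ≤ A := by
    refine le_of_mul_le_mul_right ?_ hp
    linarith
  rw [div_mul_eq_mul_div, le_div_iff₀ hδ]
  have hm0 : (0 : ℝ) ≤ m := Nat.cast_nonneg _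
  nlinarith [mul_le_mul_of_nonneg_left h9 hm0]

end Smoothing

/-! ### Estimators under the uniform distribution on the sphere. -/

section SphereMeasure

variable {p : ℕ}

theorem isProbabilityMeasure_uniformSphere (hp : 0 < p) :
    IsProbabilityMeasure (uniformSphere p) := by
  have : Nonempty (Fin p) := ⟨⟨0, hp⟩⟩
  have h0 : (volume : Measure (Vec p)).toSphere Set.univ ≠ 0 := by
    rw [Ne, Measure.measure_univ_eq_zero]
    exact Measure.toSphere_ne_zero _
  have h1 : (volume : Measure (Vec p)).toSphere Set.univ ≠ ⊤ := measure_ne_top _ _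
  exact ⟨by simp only [uniformSphere, Measure.smul_apply, smul_eq_mul]
            exact ENNReal.inv_mul_cancel h0 h1⟩

theorem integrable_uniformSphere (hp : 0 < p) {φ : Metric.sphere (0 : Vec p) 1 → ℝ}
    (hφ : Continuous φ) : Integrable φ (uniformSphere p) := by
  have := isProbabilityMeasure_uniformSphere hp
  exact hφ.integrable_of_hasCompactSupport (HasCompactSupport.of_compactSpace _)

theorem one_point_estimate (hp : 0 < p) {X : Set (Vec p)} (hX : Convex ℝ X)
    {h : Vec p → ℝ} {G : NNReal} (hLip : LipschitzOnWith G h X) {κ : ℝ}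
    (hsub : ∀ y ∈ X, ∃ v : Vec p, ∀ z ∈ X,
      h y + inner ℝ v (z - y) + κ / 2 * ‖z - y‖ ^ 2 ≤ h z)
    {x d : Vec p} {δ : ℝ} (hδ : 0 < δ) (hx : Metric.closedBall x δ ⊆ X)
    (hxd : Metric.closedBall (x - d) δ ⊆ X) :
    h x - h (x - d) - 2 * G * δ + κ / 2 * ‖d‖ ^ 2
      ≤ p / δ * ∫ u, h (x + δ • (u : Vec p)) * inner ℝ (u : Vec p) d ∂(uniformSphere p) := by
  have : Nonempty (Fin p) := ⟨⟨0, hp⟩⟩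
  have h := sphere_smoothing (volume : Measure (Vec p)) hX hLip hsub hδ hx hxd
  rw [finrank_euclideanSpace, Fintype.card_fin] at h
  have h0 : 0 < (volume : Measure (Vec p)).toSphere.real Set.univ := by
    refine ENNReal.toReal_pos ?_ (measure_ne_top _ _)
    rw [Ne, Measure.measure_univ_eq_zero]
    exact Measure.toSphere_ne_zero _
  rw [uniformSphere, integral_smul_measure, ENNReal.toReal_inv, smul_eq_mul]
  rw [← le_div_iff₀ h0] at h
  refine h.trans (le_of_eq ?_)
  rw [measureReal_def]
  ring

/-- The one-point estimate for a constant function gives one sign, and replacing `d` by `-d` gives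
the other. This is why subtracting `h x` in the two-point estimator leaves its mean unchanged. -/
theorem integral_inner_uniformSphere (hp : 0 < p) (d : Vec p) :
    ∫ u, inner ℝ (u : Vec p) d ∂(uniformSphere p) = 0 := by
  have key : ∀ d : Vec p, 0 ≤ ∫ u, inner ℝ (u : Vec p) d ∂(uniformSphere p) := fun d => by
    have h := one_point_estimate hp (X := Set.univ) convex_univ (h := fun _ => 1) (G := 0)
      (κ := 0) (LipschitzWith.const _).lipschitzOnWith (fun y _ => ⟨0, fun z _ => by simp⟩)
      (x := 0) (d := d) zero_lt_one (Set.subset_univ _) (Set.subset_univ _)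
    have hp' : (0 : ℝ) < p := by exact_mod_cast hp
    have h' : 0 ≤ (p : ℝ) * ∫ u, inner ℝ (u : Vec p) d ∂(uniformSphere p) := by simpa using h
    exact nonneg_of_mul_nonneg_right h' hp'
  refine le_antisymm ?_ (key d)
  have := key (-d)
  simp only [inner_neg_right, integral_neg] at this
  linarith

/-- The mean of the two-point estimator is an approximate strongly convex subgradient. -/
theorem two_point_estimate (hp : 0 < p) {X : Set (Vec p)} (hX : Convex ℝ X)
    {h : Vec p → ℝ} {G : NNReal} (hLip : LipschitzOnWith G h X) {κ : ℝ}
    (hsub : ∀ y ∈ X, ∃ v : Vec p, ∀ z ∈ X,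
      h y + inner ℝ v (z - y) + κ / 2 * ‖z - y‖ ^ 2 ≤ h z)
    {x d : Vec p} {δ : ℝ} (hδ : 0 < δ) (hx : Metric.closedBall x δ ⊆ X)
    (hxd : Metric.closedBall (x - d) δ ⊆ X) :
    h x - h (x - d) - 2 * G * δ + κ / 2 * ‖d‖ ^ 2
      ≤ ∫ u, p / δ * (h (x + δ • (u : Vec p)) - h x) * inner ℝ (u : Vec p) d
          ∂(uniformSphere p) := by
  refine (one_point_estimate hp hX hLip hsub hδ hx hxd).trans (le_of_eq ?_)
  have hc : Continuous fun u : Metric.sphere (0 : Vec p) 1 => inner ℝ (u : Vec p) d := by fun_prop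
  have hc' : Continuous fun u : Metric.sphere (0 : Vec p) 1 => h (x + δ • (u : Vec p)) :=
    hLip.continuousOn.comp_continuous (by fun_prop)
      fun u => hx (by simp [norm_smul, abs_of_pos hδ])
  have e : ∀ u : Metric.sphere (0 : Vec p) 1,
      p / δ * (h (x + δ • (u : Vec p)) - h x) * inner ℝ (u : Vec p) d
        = p / δ * (h (x + δ • (u : Vec p)) * inner ℝ (u : Vec p) d)
          - p / δ * h x * inner ℝ (u : Vec p) d := fun u => by ring
  simp_rw [e]
  rw [integral_sub, integral_const_mul, integral_const_mul, integral_inner_uniformSphere hp,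
    mul_zero, sub_zero]
  · exact integrable_uniformSphere hp ((hc'.mul hc).const_mul _)
  · exact integrable_uniformSphere hp (hc.const_mul _)

end SphereMeasure

/-! ### Positive parts and nonnegative multipliers. -/

section PositivePart

variable {ι : Type} [Fintype ι]

theorem pos_apply (v : EuclideanSpace ℝ ι) (k : ι) : pos v k = max (v k) 0 := rfl

theorem pos_nonneg (v : EuclideanSpace ℝ ι) (k : ι) : 0 ≤ pos v k := le_max_right _ _

theorem continuous_pos : Continuous (pos : EuclideanSpace ℝ ι → EuclideanSpace ℝ ι) := by
  unfold pos
  fun_prop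

theorem inner_pos_self (v : EuclideanSpace ℝ ι) : inner ℝ (pos v) v = ‖pos v‖ ^ 2 := by
  rw [← real_inner_self_eq_norm_sq, PiLp.inner_apply, PiLp.inner_apply]
  refine Finset.sum_congr rfl fun k _ => ?_
  rw [pos_apply]
  rcases le_total (v k) 0 with h | h <;> simp [h]

theorem inner_mono_right {q v w : EuclideanSpace ℝ ι} (hq : ∀ k, 0 ≤ q k)
    (h : ∀ k, v k ≤ w k) : inner ℝ q v ≤ inner ℝ q w := by
  rw [PiLp.inner_apply, PiLp.inner_apply]
  refine Finset.sum_le_sum fun k _ => ?_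
  have := mul_le_mul_of_nonneg_left (h k) (hq k)
  simpa [mul_comm] using this

theorem norm_le_sum_of_nonneg {q : EuclideanSpace ℝ ι} (hq : ∀ k, 0 ≤ q k) :
    ‖q‖ ≤ ∑ k, q k := by
  rw [EuclideanSpace.norm_eq]
  refine Real.sqrt_le_iff.2 ⟨Finset.sum_nonneg fun k _ => hq k, ?_⟩
  simp only [Real.norm_eq_abs, sq_abs]
  exact Finset.sum_sq_le_sq_sum_of_nonneg fun k _ => hq k

/-- A nonnegative vector against a vector whose entries are at most `-s`. -/
theorem inner_le_neg_mul_norm {q v : EuclideanSpace ℝ ι} (hq : ∀ k, 0 ≤ q k) {s : ℝ}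
    (hs : 0 ≤ s) (h : ∀ k, v k ≤ -s) : inner ℝ q v ≤ -(s * ‖q‖) := by
  have h1 : inner ℝ q v ≤ ∑ k, -(s * q k) := by
    rw [PiLp.inner_apply]
    refine Finset.sum_le_sum fun k _ => ?_
    have := mul_le_mul_of_nonneg_left (h k) (hq k)
    simp only [RCLike.inner_apply, conj_trivial]
    linarith
  rw [Finset.sum_neg_distrib, ← Finset.mul_sum] at h1
  have := mul_le_mul_of_nonneg_left (norm_le_sum_of_nonneg hq) hs
  linarith

end PositivePart

/-! ### Lipschitz and convexity properties of losses, constraints and penalized losses. -/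

section Regularity

variable {n p : ℕ} {D : Problem n p} {r R F G₁ G₂ μ : ℝ}

theorem Problem.ConvexAssumption.abs_loss_sub_le (hD : D.ConvexAssumption G₁ G₂) (i : Fin n)
    {t : ℕ} (ht : 1 ≤ t) {x y : Vec p} (hx : x ∈ D.X) (hy : y ∈ D.X) :
    |D.f i t x - D.f i t y| ≤ G₁ * ‖x - y‖ := by
  have key : ∀ {x y : Vec p}, x ∈ D.X → y ∈ D.X →
      D.f i t x - D.f i t y ≤ G₁ * ‖x - y‖ := fun {x y} hx hy => by
    obtain ⟨v, hv, h⟩ := hD.subgrad_f i t ht x hx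
    have h1 := h y hy
    have h2 := neg_le_of_abs_le (abs_real_inner_le_norm v (y - x))
    rw [norm_sub_rev] at h2
    have h3 := mul_le_mul_of_nonneg_right hv (norm_nonneg (x - y))
    linarith
  rw [abs_le]
  have h1 := key hx hy
  have h2 := key hy hx
  rw [norm_sub_rev] at h2
  constructor <;> linarith

/-- A nonnegative `q` preserves the componentwise subgradient inequality, so `⟨q, g⟩` inherits the
Lipschitz constant `‖q‖ * G₂`, with no dependence on the number of constraints. -/
theorem Problem.ConvexAssumption.inner_constr_le (hD : D.ConvexAssumption G₁ G₂) (i : Fin n)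
    {t : ℕ} (ht : 1 ≤ t) {x y : Vec p} (hx : x ∈ D.X) (hy : y ∈ D.X) {q : Vec (D.m i)}
    (hq : ∀ k, 0 ≤ q k) :
    inner ℝ q (D.g i t x) ≤ inner ℝ q (D.g i t y) + ‖q‖ * (G₂ * ‖x - y‖) := by
  obtain ⟨J, hJ, h⟩ := hD.subgrad_g i t ht x hx
  have h1 : inner ℝ q (D.g i t x + J (y - x)) ≤ inner ℝ q (D.g i t y) :=
    inner_mono_right hq fun k => h y hy k
  rw [inner_add_right] at h1
  have h2 := neg_le_of_abs_le (abs_real_inner_le_norm q (J (y - x)))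
  have h3 : ‖J (y - x)‖ ≤ G₂ * ‖x - y‖ := by
    rw [norm_sub_rev x y]
    exact (J.le_opNorm _).trans (mul_le_mul_of_nonneg_right hJ (norm_nonneg _))
  have h4 := mul_le_mul_of_nonneg_left h3 (norm_nonneg q)
  linarith

theorem Problem.ConvexAssumption.abs_inner_constr_sub_le (hD : D.ConvexAssumption G₁ G₂)
    (i : Fin n) {t : ℕ} (ht : 1 ≤ t) {x y : Vec p} (hx : x ∈ D.X) (hy : y ∈ D.X)
    {q : Vec (D.m i)} (hq : ∀ k, 0 ≤ q k) :
    |inner ℝ q (D.g i t x) - inner ℝ q (D.g i t y)| ≤ ‖q‖ * (G₂ * ‖x - y‖) := by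
  have h1 := hD.inner_constr_le i ht hx hy hq
  have h2 := hD.inner_constr_le i ht hy hx hq
  rw [norm_sub_rev] at h2
  rw [abs_le]; constructor <;> linarith

/-- The multiplier `q = pos (g x)` satisfies `⟨q, g x⟩ = ‖q‖ ^ 2`; comparing with `⟨q, g y⟩` and
dividing by `‖q‖` gives the bound. -/
theorem Problem.ConvexAssumption.norm_pos_constr_le (hD : D.ConvexAssumption G₁ G₂) (i : Fin n)
    {t : ℕ} (ht : 1 ≤ t) {x y : Vec p} (hx : x ∈ D.X) (hy : y ∈ D.X) (hG₂ : 0 ≤ G₂) :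
    ‖pos (D.g i t x)‖ ≤ ‖pos (D.g i t y)‖ + G₂ * ‖x - y‖ := by
  by_cases h0 : ‖pos (D.g i t x)‖ = 0
  · rw [h0]; positivity
  have h0' : 0 < ‖pos (D.g i t x)‖ := lt_of_le_of_ne (norm_nonneg _) (Ne.symm h0)
  have h1 := hD.inner_constr_le i ht hx hy (pos_nonneg (D.g i t x))
  rw [inner_pos_self] at h1
  have h2 : inner ℝ (pos (D.g i t x)) (D.g i t y)
      ≤ inner ℝ (pos (D.g i t x)) (pos (D.g i t y)) :=
    inner_mono_right (pos_nonneg _) fun k => le_max_left _ _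
  have h3 := real_inner_le_norm (pos (D.g i t x)) (pos (D.g i t y))
  refine le_of_mul_le_mul_left ?_ h0'
  nlinarith

theorem Problem.ConvexAssumption.continuousOn_loss (hD : D.ConvexAssumption G₁ G₂) (i : Fin n)
    {t : ℕ} (ht : 1 ≤ t) : ContinuousOn (D.f i t) D.X := by
  have : LipschitzOnWith (Real.toNNReal G₁) (D.f i t) D.X :=
    LipschitzOnWith.of_dist_le_mul fun x hx y hy => by
      rw [Real.dist_eq, dist_eq_norm]
      exact (hD.abs_loss_sub_le i ht hx hy).trans
        (mul_le_mul_of_nonneg_right (Real.le_coe_toNNReal _) (norm_nonneg _))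
  exact this.continuousOn

theorem Problem.ConvexAssumption.continuousOn_constr (hD : D.ConvexAssumption G₁ G₂) (i : Fin n)
    {t : ℕ} (ht : 1 ≤ t) : ContinuousOn (D.g i t) D.X := by
  have h : ∀ k, ContinuousOn (fun x => D.g i t x k) D.X := fun k => by
    have : LipschitzOnWith (Real.toNNReal G₂) (fun x => D.g i t x k) D.X :=
      LipschitzOnWith.of_dist_le_mul fun x hx y hy => by
        rw [Real.dist_eq, dist_eq_norm]
        have h1 := hD.abs_inner_constr_sub_le i ht hx hy (q := EuclideanSpace.single k 1)
          fun l => by by_cases hl : l = k <;> simp [hl]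
        simp only [EuclideanSpace.inner_single_left, map_one, one_mul,
          PiLp.norm_single, norm_one] at h1
        exact h1.trans (mul_le_mul_of_nonneg_right (Real.le_coe_toNNReal _) (norm_nonneg _))
    exact this.continuousOn
  have h2 : ContinuousOn (fun x => (D.g i t x).ofLp) D.X := continuousOn_pi.2 h
  exact (PiLp.continuous_toLp 2 _).comp_continuousOn h2

/-- The penalized local loss `f + ⟨q, g⟩`. -/
noncomputable def penalizedLoss (D : Problem n p) (i : Fin n) (t : ℕ) (q : Vec (D.m i)) (x : Vec p) : ℝ :=
  D.f i t x + inner ℝ q (D.g i t x)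

theorem penalizedLoss_abs_sub_le (hD : D.ConvexAssumption G₁ G₂) (i : Fin n)
    {t : ℕ} (ht : 1 ≤ t) {x y : Vec p} (hx : x ∈ D.X) (hy : y ∈ D.X) {q : Vec (D.m i)}
    (hq : ∀ k, 0 ≤ q k) :
    |penalizedLoss D i t q x - penalizedLoss D i t q y| ≤ (G₁ + ‖q‖ * G₂) * ‖x - y‖ := by
  have h1 := hD.abs_loss_sub_le i ht hx hy
  have h2 := hD.abs_inner_constr_sub_le i ht hx hy hq
  have h3 := abs_add_le (D.f i t x - D.f i t y)
    (inner ℝ q (D.g i t x) - inner ℝ q (D.g i t y))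
  unfold penalizedLoss
  rw [show D.f i t x + inner ℝ q (D.g i t x) - (D.f i t y + inner ℝ q (D.g i t y))
    = D.f i t x - D.f i t y + (inner ℝ q (D.g i t x) - inner ℝ q (D.g i t y)) by ring]
  linarith

/-- The constraint part adds `J.adjoint q` to the subgradient because `q` is nonnegative; the
modulus `μ` comes from the loss alone. -/
theorem penalizedLoss_subgradient (hD : D.ConvexAssumption G₁ G₂) (hs : D.StronglyConvexLoss μ)
    (i : Fin n) {t : ℕ} (ht : 1 ≤ t) {q : Vec (D.m i)} (hq : ∀ k, 0 ≤ q k) :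
    ∀ y ∈ D.X, ∃ v : Vec p, ∀ z ∈ D.X,
      penalizedLoss D i t q y + inner ℝ v (z - y) + μ / 2 * ‖z - y‖ ^ 2
        ≤ penalizedLoss D i t q z := by
  intro y hy
  obtain ⟨v, hv⟩ := hs i t ht y hy
  obtain ⟨J, -, hJ⟩ := hD.subgrad_g i t ht y hy
  refine ⟨v + J.adjoint q, fun z hz => ?_⟩
  have h1 := hv z hz
  have h2 : inner ℝ q (D.g i t y + J (z - y)) ≤ inner ℝ q (D.g i t z) :=
    inner_mono_right hq fun k => hJ z hz k
  rw [inner_add_right] at h2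
  rw [inner_add_left, ContinuousLinearMap.adjoint_inner_left]
  unfold penalizedLoss
  linarith

theorem norm_pos_globalConstr_le (t : ℕ) (x : Vec p) :
    ‖pos (D.globalConstr t x)‖ ≤ ∑ j, ‖pos (D.g j t x)‖ := by
  have h : ‖pos (D.globalConstr t x)‖ ^ 2 = ∑ j, ‖pos (D.g j t x)‖ ^ 2 := by
    simp_rw [EuclideanSpace.norm_sq_eq]
    rw [Fintype.sum_sigma]
    rfl
  refine le_of_sq_le_sq ?_ (Finset.sum_nonneg fun j _ => norm_nonneg _)
  rw [h]
  exact Finset.sum_sq_le_sq_sum_of_nonneg fun j _ => norm_nonneg _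

end Regularity

/-! ### Shrunk sets and Euclidean projection. -/

section Geometry

variable {p : ℕ}

theorem smul_subset_smul_of_le {X : Set (Vec p)} (hX : Convex ℝ X) (h0 : (0 : Vec p) ∈ X)
    {c c' : ℝ} (hc : 0 ≤ c) (hcc' : c ≤ c') : c • X ⊆ c' • X := by
  rintro _ ⟨x, hx, rfl⟩
  rcases hc.eq_or_lt with rfl | hc
  · exact ⟨0, h0, by simp⟩
  have hc' : 0 < c' := hc.trans_le hcc'
  refine ⟨(c / c') • x, ?_, ?_⟩
  · exact hX.smul_mem_of_zero_mem h0 hx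
      ⟨by positivity, (div_le_one hc').2 hcc'⟩
  · simp only [smul_smul]
    rw [mul_div_cancel₀ _ hc'.ne']

/-- A point within `r * ξ` of `(1 - ξ) • x'` equals `(1 - ξ) • x' + ξ • v` with `‖v‖ ≤ r`. This
keeps the query points `x + δ • u` inside the decision set, since `δ_t = r ξ_t`. -/
theorem closedBall_subset_of_mem_smul {X : Set (Vec p)} (hX : Convex ℝ X) {r : ℝ}
    (hr : Metric.closedBall 0 r ⊆ X) {ξ : ℝ} (hξ0 : 0 < ξ) (hξ1 : ξ ≤ 1)
    {x : Vec p} (hx : x ∈ (1 - ξ) • X) : Metric.closedBall x (r * ξ) ⊆ X := by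
  obtain ⟨x', hx', rfl⟩ := hx
  intro y hy
  rw [mem_closedBall_iff_norm] at hy
  have hv : ξ⁻¹ • (y - (1 - ξ) • x') ∈ X := hr (by
    rw [mem_closedBall_zero_iff, norm_smul, norm_inv, Real.norm_eq_abs, abs_of_pos hξ0,
      inv_mul_le_iff₀ hξ0, mul_comm]
    exact hy)
  have := hX hx' hv (by linarith : 0 ≤ 1 - ξ) hξ0.le (by ring)
  rw [smul_smul, mul_inv_cancel₀ hξ0.ne', one_smul] at this
  simpa using this

theorem proj_spec {K : Set (Vec p)} (hne : K.Nonempty) (hcl : IsClosed K) (v : Vec p) :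
    proj K v ∈ K ∧ IsMinOn (fun y => ‖v - y‖ ^ 2) K (proj K v) := by
  refine Classical.epsilon_spec (p := fun y => y ∈ K ∧ IsMinOn (fun y' => ‖v - y'‖ ^ 2) K y) ?_
  obtain ⟨y, hy, h⟩ := hcl.exists_infDist_eq_dist hne v
  refine ⟨y, hy, fun z hz => ?_⟩
  have := Metric.infDist_le_dist_of_mem (x := v) hz
  rw [h, dist_eq_norm, dist_eq_norm] at this
  exact pow_le_pow_left₀ (norm_nonneg _) this 2

theorem proj_inner_le {K : Set (Vec p)} (hK : Convex ℝ K) (hne : K.Nonempty) (hcl : IsClosed K)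
    (v : Vec p) {y : Vec p} (hy : y ∈ K) : inner ℝ (v - proj K v) (y - proj K v) ≤ 0 := by
  obtain ⟨hm, hmin⟩ := proj_spec hne hcl v
  refine (norm_eq_iInf_iff_real_inner_le_zero hK hm).1 ?_ y hy
  have : Nonempty K := hne.to_subtype
  refine le_antisymm (le_ciInf fun w => ?_)
    (ciInf_le (f := fun w : K => ‖v - w‖) ⟨0, by rintro _ ⟨w, rfl⟩; exact norm_nonneg _⟩ ⟨_, hm⟩)
  exact le_of_sq_le_sq (hmin w.2) (norm_nonneg _)

theorem norm_proj_sub_proj_le {K : Set (Vec p)} (hK : Convex ℝ K) (hne : K.Nonempty)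
    (hcl : IsClosed K) (v w : Vec p) : ‖proj K v - proj K w‖ ≤ ‖v - w‖ := by
  have h1 := proj_inner_le hK hne hcl v (proj_spec hne hcl w).1
  have h2 := proj_inner_le hK hne hcl w (proj_spec hne hcl v).1
  have h3 : ‖proj K v - proj K w‖ ^ 2 ≤ inner ℝ (v - w) (proj K v - proj K w) := by
    have e : inner ℝ (v - w) (proj K v - proj K w)
        = ‖proj K v - proj K w‖ ^ 2 - inner ℝ (v - proj K v) (proj K w - proj K v)
          - inner ℝ (w - proj K w) (proj K v - proj K w) := by
      rw [← real_inner_self_eq_norm_sq]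
      simp only [inner_sub_left, inner_sub_right]
      ring
    linarith
  have h4 := real_inner_le_norm (v - w) (proj K v - proj K w)
  by_cases h0 : ‖proj K v - proj K w‖ = 0
  · rw [h0]; exact norm_nonneg _
  · have h0' := lt_of_le_of_ne (norm_nonneg _) (Ne.symm h0)
    refine le_of_mul_le_mul_right ?_ h0'
    nlinarith

theorem proj_eq_self {K : Set (Vec p)} (hcl : IsClosed K) {y : Vec p}
    (hy : y ∈ K) : proj K y = y := by
  have h := (proj_spec ⟨y, hy⟩ hcl y).2 hy
  have h' : ‖y - proj K y‖ ^ 2 ≤ 0 := by simpa using h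
  have : ‖y - proj K y‖ = 0 := by nlinarith [norm_nonneg (y - proj K y)]
  exact (sub_eq_zero.1 (norm_eq_zero.1 this)).symm

theorem norm_proj_sub_le {K : Set (Vec p)} (hK : Convex ℝ K) (hcl : IsClosed K)
    (v : Vec p) {y : Vec p} (hy : y ∈ K) : ‖proj K v - y‖ ≤ ‖v - y‖ := by
  have := norm_proj_sub_proj_le hK ⟨y, hy⟩ hcl v y
  rwa [proj_eq_self hcl hy] at this

theorem continuous_proj {K : Set (Vec p)} (hK : Convex ℝ K) (hne : K.Nonempty)
    (hcl : IsClosed K) : Continuous (proj K) := by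
  have : LipschitzWith 1 (proj K) := LipschitzWith.of_dist_le_mul fun v w => by
    simpa [dist_eq_norm] using norm_proj_sub_proj_le hK hne hcl v w
  exact this.continuous

end Geometry

/-! ### Trajectories of the algorithm: membership, step bounds, measurability, independence. -/

section Trajectory

variable {n p : ℕ} {D : Problem n p} {N : Network n} {r R F G₁ G₂ μ γ₀ w : ℝ} {B : ℕ}

theorem Problem.SetAssumption.zero_mem (hD : D.SetAssumption r R) (hr : 0 < r) :
    (0 : Vec p) ∈ D.X := hD.ball_subset (by simp [hr.le])

theorem Problem.SetAssumption.isClosed_smul (hD : D.SetAssumption r R) (c : ℝ) :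
    IsClosed (c • D.X) :=
  ((Metric.isCompact_of_isClosed_isBounded hD.isClosed
    (Metric.isBounded_closedBall.subset hD.subset_ball)).smul c).isClosed

theorem Problem.SetAssumption.norm_le (hD : D.SetAssumption r R) {x : Vec p} (hx : x ∈ D.X) :
    ‖x‖ ≤ R := by simpa using hD.subset_ball hx

theorem stepsize_pos (hμ : 1 ≤ μ) {t : ℕ} (ht : 1 ≤ t) : 0 < 1 / (μ * t) := by
  have : (1 : ℝ) ≤ t := by exact_mod_cast ht
  positivity

theorem stepsize_le_one (hμ : 1 ≤ μ) {t : ℕ} (ht : 1 ≤ t) : 1 / (μ * t) ≤ 1 := by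
  have : (1 : ℝ) ≤ t := by exact_mod_cast ht
  rw [div_le_one (by positivity)]
  nlinarith

theorem stepsize_succ_le (hμ : 1 ≤ μ) {t : ℕ} (ht : 1 ≤ t) :
    1 / (μ * (t + 1 : ℕ)) ≤ 1 / (μ * t) := by
  have : (1 : ℝ) ≤ t := by exact_mod_cast ht
  push_cast
  gcongr
  linarith

theorem shrunk_subset_succ (hD : D.SetAssumption r R) (hr : 0 < r) (hμ : 1 ≤ μ) {t : ℕ}
    (ht : 1 ≤ t) : (1 - 1 / (μ * t)) • D.X ⊆ (1 - 1 / (μ * (t + 1 : ℕ))) • D.X :=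
  smul_subset_smul_of_le hD.convex (hD.zero_mem hr)
    (by linarith [stepsize_le_one hμ ht]) (by linarith [stepsize_succ_le hμ ht])

theorem shrunk_subset (hD : D.SetAssumption r R) (hr : 0 < r) (hμ : 1 ≤ μ) {t : ℕ}
    (ht : 1 ≤ t) : (1 - 1 / (μ * t)) • D.X ⊆ D.X := by
  have := smul_subset_smul_of_le hD.convex (hD.zero_mem hr)
    (c := 1 - 1 / (μ * t)) (c' := 1) (by linarith [stepsize_le_one hμ ht])
    (by linarith [stepsize_pos hμ ht])
  simpa using this

theorem shrunk_nonempty (hD : D.SetAssumption r R) (hr : 0 < r) (c : ℝ) : (c • D.X).Nonempty :=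
  ⟨_, Set.smul_mem_smul_set (hD.zero_mem hr)⟩

theorem Network.Mixing.nonneg (hN : N.Mixing w B) (hw : 0 < w) {t : ℕ} (ht : 1 ≤ t)
    (i j : Fin n) : 0 ≤ N.W t i j := by
  by_cases h : (N.G t).Adj j i ∨ i = j
  · exact hw.le.trans (hN.weight_ge t ht i j h)
  · exact (hN.weight_zero t ht i j h).ge

theorem mix_mem (hN : N.Mixing w B) (hw : 0 < w) {t : ℕ} (ht : 1 ≤ t) {K : Set (Vec p)}
    (hK : Convex ℝ K) {z : Fin n → Vec p} (hz : ∀ i, z i ∈ K) (i : Fin n) : mix N t z i ∈ K :=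
  hK.sum_mem (fun j _ => hN.nonneg hw ht i j) (hN.row_sum t ht i) fun j _ => hz j

theorem zSeq_mem (hD : D.SetAssumption r R) (hr : 0 < r) {z₁ : Fin n → Vec p}
    (hz₁ : ∀ i, z₁ i ∈ (1 - (stronglyConvexParams μ γ₀ r).ξ 1) • D.X)
    (u : ℕ → Fin n → Vec p) {t : ℕ} (ht : 1 ≤ t) (i : Fin n) :
    zSeq D N (stronglyConvexParams μ γ₀ r) z₁ u t i ∈ (1 - 1 / (μ * t)) • D.X := by
  match t, ht with
  | 1, _ => exact hz₁ i
  | t + 2, _ =>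
    exact (proj_spec (shrunk_nonempty hD hr _) (hD.isClosed_smul _) _).1

theorem xSeq_mem (hD : D.SetAssumption r R) (hr : 0 < r) (hN : N.Mixing w B) (hw : 0 < w)
    {z₁ : Fin n → Vec p}
    (hz₁ : ∀ i, z₁ i ∈ (1 - (stronglyConvexParams μ γ₀ r).ξ 1) • D.X)
    (u : ℕ → Fin n → Vec p) {t : ℕ} (ht : 1 ≤ t) (i : Fin n) :
    xSeq D N (stronglyConvexParams μ γ₀ r) z₁ u t i ∈ (1 - 1 / (μ * t)) • D.X :=
  mix_mem hN hw ht (hD.convex.smul _) (zSeq_mem hD hr hz₁ u ht) i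

theorem zSeq_succ (a : Params) (z₁ : Fin n → Vec p) (u : ℕ → Fin n → Vec p) {t : ℕ}
    (ht : 1 ≤ t) (i : Fin n) :
    zSeq D N a z₁ u (t + 1) i = proj ((1 - a.ξ (t + 1)) • D.X)
      (xSeq D N a z₁ u t i - a.α t • direction D a t i (xSeq D N a z₁ u t i) (u t i)) := by
  obtain ⟨s, rfl⟩ : ∃ s, t = s + 1 := ⟨t - 1, by omega⟩
  rfl

/-- The update direction is the two-point estimator of the penalized loss. -/
theorem direction_eq (a : Params) (t : ℕ) (i : Fin n) (x u : Vec p) :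
    direction D a t i x u
      = ((p : ℝ) / a.δ t * (penalizedLoss D i t (dual D a t i x) (x + a.δ t • u)
          - penalizedLoss D i t (dual D a t i x) x)) • u := by
  have h : WithLp.toLp 2 (Matrix.mulVec (jacEst (a.δ t) (D.g i t) x u) (dual D a t i x))
      = ((p : ℝ) / a.δ t * (inner ℝ (dual D a t i x) (D.g i t (x + a.δ t • u))
          - inner ℝ (dual D a t i x) (D.g i t x))) • u := by
    ext k
    rw [← inner_sub_right]
    simp only [jacEst, Matrix.mulVec, dotProduct, Matrix.smul_apply, Matrix.vecMulVec_apply,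
      PiLp.inner_apply, PiLp.smul_apply, smul_eq_mul, RCLike.inner_apply, conj_trivial,
      Finset.mul_sum, Finset.sum_mul]
    exact Finset.sum_congr rfl fun l _ => by ring
  rw [direction, h, gradEst, ← add_smul, ← mul_add, penalizedLoss, penalizedLoss]
  congr 2
  ring

theorem dual_nonneg (hμ : 1 ≤ μ) (hγ₀ : 0 < γ₀) (t : ℕ) (i : Fin n) (x : Vec p)
    (k : Fin (D.m i)) : 0 ≤ dual D (stronglyConvexParams μ γ₀ r) t i x k := by
  simp only [dual, PiLp.smul_apply, smul_eq_mul]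
  refine mul_nonneg ?_ (pos_nonneg _ _)
  simp only [stronglyConvexParams]
  positivity

theorem norm_dual (hμ : 1 ≤ μ) (hγ₀ : 0 < γ₀) (t : ℕ) (i : Fin n) (x : Vec p) :
    ‖dual D (stronglyConvexParams μ γ₀ r) t i x‖ = γ₀ * (μ * t) * ‖pos (D.g i t x)‖ := by
  rw [dual, norm_smul, Real.norm_eq_abs]
  simp only [stronglyConvexParams, div_div_eq_mul_div, div_one]
  rw [abs_of_nonneg (by positivity)]

/-- The difference of two values at distance `δ_t` is at most the Lipschitz constant of the
penalized loss times `δ_t`, which cancels the factor `1/δ_t` of the estimator. -/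
theorem norm_direction_le (hD : D.SetAssumption r R) (hC : D.ConvexAssumption G₁ G₂)
    (hr : 0 < r) (hμ : 1 ≤ μ) (hγ₀ : 0 < γ₀) {t : ℕ} (ht : 1 ≤ t) (i : Fin n) {x : Vec p}
    (hx : x ∈ (1 - 1 / (μ * t)) • D.X) {u : Vec p} (hu : ‖u‖ = 1) :
    ‖direction D (stronglyConvexParams μ γ₀ r) t i x u‖
      ≤ p * (G₁ + γ₀ * (μ * t) * ‖pos (D.g i t x)‖ * G₂) := by
  set a := stronglyConvexParams μ γ₀ r with ha
  have hξ := stepsize_pos hμ ht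
  have hδ : 0 < a.δ t := mul_pos hr hξ
  have hball := closedBall_subset_of_mem_smul hD.convex hD.ball_subset hξ
    (stepsize_le_one hμ ht) hx
  have hxu : x + a.δ t • u ∈ D.X := hball (by
    rw [mem_closedBall_iff_norm, add_sub_cancel_left, norm_smul, hu, Real.norm_eq_abs,
      abs_of_pos hδ, mul_one]
    exact le_rfl)
  have h := penalizedLoss_abs_sub_le hC i ht hxu (shrunk_subset hD hr hμ ht hx)
    (dual_nonneg (r := r) hμ hγ₀ t i x)
  rw [norm_dual hμ hγ₀, add_sub_cancel_left, norm_smul, hu, Real.norm_eq_abs, abs_of_pos hδ,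
    mul_one] at h
  rw [direction_eq, norm_smul, hu, mul_one, Real.norm_eq_abs, abs_mul,
    abs_of_nonneg (by positivity)]
  calc p / a.δ t * _ ≤ p / a.δ t * ((G₁ + γ₀ * (μ * t) * ‖pos (D.g i t x)‖ * G₂) * a.δ t) := by
        gcongr
    _ = _ := by field_simp

theorem measurable_comp_of_continuousOn {Ω E E' : Type*} [MeasurableSpace Ω]
    [TopologicalSpace E] [MeasurableSpace E] [BorelSpace E] [TopologicalSpace E']
    [MeasurableSpace E'] [BorelSpace E'] {X : Set E} {φ : E → E'} (hφ : ContinuousOn φ X)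
    {x : Ω → E} (hx : Measurable x) (hmem : ∀ ω, x ω ∈ X) : Measurable fun ω => φ (x ω) :=
  (continuousOn_iff_continuous_domRestrict.1 hφ).measurable.comp (hx.subtype_mk (h := hmem))

theorem continuousOn_dual (hC : D.ConvexAssumption G₁ G₂) (a : Params) {t : ℕ} (ht : 1 ≤ t)
    (i : Fin n) : ContinuousOn (dual D a t i) D.X :=
  ((continuous_const_smul (a.γ t)).comp continuous_pos).comp_continuousOn
    (hC.continuousOn_constr i ht)

theorem measurable_direction {Ω : Type*} [MeasurableSpace Ω] (hD : D.SetAssumption r R)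
    (hC : D.ConvexAssumption G₁ G₂) (hr : 0 < r) (hμ : 1 ≤ μ) {t : ℕ} (ht : 1 ≤ t)
    (i : Fin n) {x : Ω → Vec p} (hx : Measurable x)
    (hmem : ∀ ω, x ω ∈ (1 - 1 / (μ * t)) • D.X)
    {u : Ω → Metric.sphere (0 : Vec p) 1} (hu : Measurable u) :
    Measurable fun ω => direction D (stronglyConvexParams μ γ₀ r) t i (x ω) (u ω) := by
  set a := stronglyConvexParams μ γ₀ r with ha
  have hξ := stepsize_pos hμ ht
  have hu' : Measurable fun ω => (u ω : Vec p) := measurable_subtype_coe.comp hu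
  have hxX : ∀ ω, x ω ∈ D.X := fun ω => shrunk_subset hD hr hμ ht (hmem ω)
  have hxuX : ∀ ω, x ω + a.δ t • (u ω : Vec p) ∈ D.X := fun ω =>
    closedBall_subset_of_mem_smul hD.convex hD.ball_subset hξ (stepsize_le_one hμ ht)
      (hmem ω) (by
        rw [mem_closedBall_iff_norm, add_sub_cancel_left, norm_smul,
          norm_eq_of_mem_sphere, mul_one]
        exact (abs_of_pos (mul_pos hr hξ)).le)
  have hxu : Measurable fun ω => x ω + a.δ t • (u ω : Vec p) := hx.add (hu'.fun_const_smul _)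
  have hf1 := measurable_comp_of_continuousOn (hC.continuousOn_loss i ht) hx hxX
  have hf2 := measurable_comp_of_continuousOn (hC.continuousOn_loss i ht) hxu hxuX
  have hg1 := measurable_comp_of_continuousOn (hC.continuousOn_constr i ht) hx hxX
  have hg2 := measurable_comp_of_continuousOn (hC.continuousOn_constr i ht) hxu hxuX
  have hq := measurable_comp_of_continuousOn (continuousOn_dual hC a ht i) hx hxX
  simp_rw [direction_eq, penalizedLoss]
  exact (((hf2.add (hq.inner hg2)).sub (hf1.add (hq.inner hg1))).const_mul _).smul hu'

theorem measurable_mix {Ω : Type*} [MeasurableSpace Ω] (N : Network n) (t : ℕ)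
    {z : Ω → Fin n → Vec p} (hz : ∀ j, Measurable fun ω => z ω j) (i : Fin n) :
    Measurable fun ω => mix N t (z ω) i := by
  unfold mix
  exact Finset.measurable_sum _ fun j _ => (hz j).fun_const_smul _

/-- Only directions strictly before `t` are required to be measurable, so the statement also applies
to the smaller σ-algebra which they generate; independence of the current direction rests on this.
-/
theorem measurable_zSeq {Ω : Type*} [MeasurableSpace Ω] (hD : D.SetAssumption r R)
    (hC : D.ConvexAssumption G₁ G₂) (hN : N.Mixing w B) (hr : 0 < r) (hμ : 1 ≤ μ) (hw : 0 < w)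
    {z₁ : Fin n → Vec p}
    (hz₁ : ∀ i, z₁ i ∈ (1 - (stronglyConvexParams μ γ₀ r).ξ 1) • D.X)
    (u : ℕ → Fin n → Ω → Metric.sphere (0 : Vec p) 1) (t : ℕ)
    (hu : ∀ s, 1 ≤ s → s < t → ∀ i, Measurable (u s i)) (i : Fin n) :
    Measurable fun ω => zSeq D N (stronglyConvexParams μ γ₀ r) z₁
      (fun t i => (u t i ω : Vec p)) t i := by
  induction t generalizing i with
  | zero => exact measurable_const
  | succ t ih =>
    rcases Nat.eq_zero_or_pos t with rfl | ht
    · exact measurable_const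
    have ih' := ih fun s hs hst => hu s hs (hst.trans t.lt_succ_self)
    have hx : Measurable fun ω => xSeq D N (stronglyConvexParams μ γ₀ r) z₁
        (fun t i => (u t i ω : Vec p)) t i :=
      measurable_mix N t ih' i
    simp_rw [zSeq_succ _ _ _ ht]
    refine (continuous_proj (hD.convex.smul _) (shrunk_nonempty hD hr _)
      (hD.isClosed_smul _)).measurable.comp (hx.sub (Measurable.fun_const_smul ?_ _))
    exact measurable_direction hD hC hr hμ ht i hx
      (fun ω => xSeq_mem hD hr hN hw hz₁ _ ht i) (hu t ht t.lt_succ_self i)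

theorem measurable_xSeq {Ω : Type*} [MeasurableSpace Ω] (hD : D.SetAssumption r R)
    (hC : D.ConvexAssumption G₁ G₂) (hN : N.Mixing w B) (hr : 0 < r) (hμ : 1 ≤ μ) (hw : 0 < w)
    {z₁ : Fin n → Vec p}
    (hz₁ : ∀ i, z₁ i ∈ (1 - (stronglyConvexParams μ γ₀ r).ξ 1) • D.X)
    (u : ℕ → Fin n → Ω → Metric.sphere (0 : Vec p) 1) (t : ℕ)
    (hu : ∀ s, 1 ≤ s → s < t → ∀ i, Measurable (u s i)) (i : Fin n) :
    Measurable fun ω => xSeq D N (stronglyConvexParams μ γ₀ r) z₁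
      (fun t i => (u t i ω : Vec p)) t i :=
  measurable_mix N t (measurable_zSeq hD hC hN hr hμ hw hz₁ u t hu) i

/-- Decisions at time `t` are independent of the directions sampled at time `t`. -/
theorem indepFun_xSeq {Ω : Type*} [MeasurableSpace Ω] {P : Measure Ω}
    (hD : D.SetAssumption r R)
    (hC : D.ConvexAssumption G₁ G₂) (hN : N.Mixing w B) (hr : 0 < r) (hμ : 1 ≤ μ) (hw : 0 < w)
    {z₁ : Fin n → Vec p}
    (hz₁ : ∀ i, z₁ i ∈ (1 - (stronglyConvexParams μ γ₀ r).ξ 1) • D.X)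
    {u : ℕ → Fin n → Ω → Metric.sphere (0 : Vec p) 1} (hu : UniformDirections P u)
    {t : ℕ} (ht : 1 ≤ t) (i : Fin n) :
    IndepFun (fun ω => xSeq D N (stronglyConvexParams μ γ₀ r) z₁
      (fun t i => (u t i ω : Vec p)) t i) (u t i) P := by
  -- The index `(s, j)` carries the direction of time `s + 1`, so time `t` corresponds to `t - 1`.
  set σ : ℕ × Fin n → MeasurableSpace Ω := fun k =>
    MeasurableSpace.comap (u (k.1 + 1) k.2) inferInstance with hσ
  have hle : ∀ k, σ k ≤ ‹MeasurableSpace Ω› := fun k =>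
    (hu.measurable (k.1 + 1) (by omega) k.2).comap_le
  have hind : iIndep σ P := hu.indep
  have hdisj : Disjoint {k : ℕ × Fin n | k.1 + 1 < t} {k | k = (t - 1, i)} := by
    rw [Set.disjoint_left]
    rintro ⟨s, j⟩ h1 h2
    simp only [Set.mem_ofPred_eq, Prod.mk.injEq] at h1 h2
    omega
  have h := indep_iSup_of_disjoint hle hind hdisj
  rw [IndepFun_iff_Indep]
  refine indep_of_indep_of_le_right (indep_of_indep_of_le_left h ?_) ?_
  · refine Measurable.comap_le ?_
    -- Measurability is applied with the σ-algebra generated by the directions before time `t` in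
    -- place of the ambient one.
    refine @measurable_xSeq n p D N r R G₁ G₂ μ γ₀ w B Ω (⨆ k ∈ {k : ℕ × Fin n | k.1 + 1 < t}, σ k)
      hD hC hN hr hμ hw z₁ hz₁ u t (fun s hs hst j => ?_) i
    refine Measurable.mono (comap_measurable (u s j)) ?_ le_rfl
    have : σ (s - 1, j) ≤ ⨆ k ∈ {k : ℕ × Fin n | k.1 + 1 < t}, σ k :=
      le_iSup₂_of_le (s - 1, j) (by simp; omega) le_rfl
    simpa [hσ, Nat.sub_add_cancel hs] using this
  · have : σ (t - 1, i) ≤ ⨆ k ∈ {k : ℕ × Fin n | k = (t - 1, i)}, σ k :=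
      le_iSup₂_of_le (t - 1, i) rfl le_rfl
    simpa only [hσ, Nat.sub_add_cancel ht] using this

end Trajectory

/-! ### Products of mixing matrices and contraction of disagreement. -/

section Consensus

variable {n : ℕ} {N : Network n} {w : ℝ} {B : ℕ}

/-- The product `W_{s+k} ⋯ W_{s+1}`. -/
def Network.trans (N : Network n) (s : ℕ) : ℕ → Matrix (Fin n) (Fin n) ℝ
  | 0 => 1
  | k + 1 => N.W (s + k + 1) * N.trans s k

theorem Network.Mixing.trans_nonneg (hN : N.Mixing w B) (hw : 0 < w) (s k : ℕ) (i j : Fin n) :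
    0 ≤ N.trans s k i j := by
  induction k generalizing i with
  | zero => simp only [Network.trans, Matrix.one_apply]; split_ifs <;> norm_num
  | succ k ih =>
    simp only [Network.trans, Matrix.mul_apply]
    exact Finset.sum_nonneg fun l _ => mul_nonneg (hN.nonneg hw (by omega) i l) (ih l)

theorem Network.Mixing.trans_row_sum (hN : N.Mixing w B) (s k : ℕ) (i : Fin n) :
    ∑ j, N.trans s k i j = 1 := by
  induction k generalizing i with
  | zero => simp [Network.trans, Matrix.one_apply]
  | succ k ih =>
    simp only [Network.trans, Matrix.mul_apply]
    rw [Finset.sum_comm]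
    simp_rw [← Finset.mul_sum, ih, mul_one]
    exact hN.row_sum _ (by omega) i

theorem Network.Mixing.trans_succ_ge (hN : N.Mixing w B) (hw : 0 < w) (s k : ℕ)
    {a b : Fin n} (hab : (N.G (s + k + 1)).Adj a b ∨ b = a) (j : Fin n) :
    w * N.trans s k a j ≤ N.trans s (k + 1) b j := by
  simp only [Network.trans, Matrix.mul_apply]
  refine le_trans ?_ (Finset.single_le_sum (f := fun l => N.W (s + k + 1) b l * N.trans s k l j)
    (fun l _ => mul_nonneg (hN.nonneg hw (by omega) b l) (hN.trans_nonneg hw s k l j))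
    (Finset.mem_univ a))
  exact mul_le_mul_of_nonneg_right (hN.weight_ge _ (by omega) b a hab)
    (hN.trans_nonneg hw s k a j)

theorem Network.Mixing.trans_add_ge (hN : N.Mixing w B) (hw : 0 < w) (s k m : ℕ)
    (a j : Fin n) : w ^ m * N.trans s k a j ≤ N.trans s (k + m) a j := by
  induction m with
  | zero => simp
  | succ m ih =>
    refine le_trans ?_ (hN.trans_succ_ge hw s (k + m) (Or.inr rfl) j)
    rw [pow_succ', mul_assoc]
    exact mul_le_mul_of_nonneg_left ih hw.le

theorem exists_crossing {α : Type*} {ρ : α → α → Prop} {S : Set α} {a b : α}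
    (h : Relation.ReflTransGen ρ a b) (ha : a ∈ S) (hb : b ∉ S) :
    ∃ c d, c ∈ S ∧ d ∉ S ∧ ρ c d := by
  induction h with
  | refl => exact absurd ha hb
  | @tail c d _ hcd ih =>
    by_cases hc : c ∈ S
    · exact ⟨c, d, hc, hb, hcd⟩
    · exact ih hc

/-- After `n` windows of length `B` every entry of the product is bounded below. -/
theorem Network.Mixing.trans_ge (hN : N.Mixing w B) (hw : 0 < w) (s : ℕ) (i j : Fin n) :
    w ^ (n * B) ≤ N.trans s (n * B) i j := by
  classical
  -- `S k` collects the agents that `j` has reached with weight at least `w ^ (k * B)`. The union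
  -- graph of each window has an edge leaving `S k`, so this set gains an agent per window until it
  -- is everything.
  set S : ℕ → Finset (Fin n) := fun k =>
    Finset.univ.filter fun i => w ^ (k * B) ≤ N.trans s (k * B) i j with hS
  have hmem : ∀ k a, a ∈ S k ↔ w ^ (k * B) ≤ N.trans s (k * B) a j := by simp [hS]
  have hmono : ∀ k, S k ⊆ S (k + 1) := by
    intro k a ha
    rw [hmem] at ha ⊢
    have := hN.trans_add_ge hw s (k * B) B a j
    rw [add_mul, one_mul, pow_add, mul_comm]
    exact (mul_le_mul_of_nonneg_left ha (by positivity)).trans this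
  have hj : ∀ k, j ∈ S k := by
    intro k
    induction k with
    | zero => rw [hmem]; simp [Network.trans]
    | succ k ih => exact hmono k ih
  have hgrow : ∀ k, S k = Finset.univ ∨ k + 1 ≤ (S k).card := by
    intro k
    induction k with
    | zero => exact Or.inr (Finset.card_pos.2 ⟨j, hj 0⟩)
    | succ k ih =>
      rcases ih with ih | ih
      · left; exact Finset.univ_subset_iff.1 (ih ▸ hmono k)
      by_cases hu : S k = Finset.univ
      · left; exact Finset.univ_subset_iff.1 (hu ▸ hmono k)
      right
      obtain ⟨i', hi'⟩ : ∃ i', i' ∉ S k := by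
        by_contra! h
        exact hu (Finset.eq_univ_iff_forall.2 h)
      obtain ⟨a, b, ha, hb, l, hl, hadj⟩ := exists_crossing (S := (S k : Set (Fin n)))
        (hN.connected (s + k * B + 1) (by omega) j i') (hj k) hi'
      have hb' : b ∈ S (k + 1) := by
        rw [Finset.mem_coe, hmem] at ha
        rw [hmem]
        -- Within the window the weight waits at `a` for `l` steps, crosses to `b`, and waits there
        -- for the other `B - 1 - l` steps, losing a factor of at most `w` each time.
        have h1 := hN.trans_add_ge hw s (k * B) l a j
        have h2 := hN.trans_succ_ge hw s (k * B + l) (a := a) (b := b)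
          (Or.inl (by convert hadj using 2; ring)) j
        have h3 := hN.trans_add_ge hw s (k * B + l + 1) (B - 1 - l) b j
        have e : k * B + l + 1 + (B - 1 - l) = (k + 1) * B := by
          have : (k + 1) * B = k * B + B := by ring
          omega
        rw [e] at h3
        calc w ^ ((k + 1) * B) = w ^ (B - 1 - l) * (w * (w ^ l * w ^ (k * B))) := by
              rw [← e]; ring
          _ ≤ w ^ (B - 1 - l) * (w * (w ^ l * N.trans s (k * B) a j)) := by gcongr
          _ ≤ w ^ (B - 1 - l) * (w * N.trans s (k * B + l) a j) := by gcongr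
          _ ≤ w ^ (B - 1 - l) * N.trans s (k * B + l + 1) b j := by gcongr
          _ ≤ _ := h3
      have hss : S k ⊂ S (k + 1) :=
        (Finset.ssubset_iff_of_subset (hmono k)).2 ⟨b, hb', hb⟩
      exact Nat.succ_le_of_lt (lt_of_le_of_lt ih (Finset.card_lt_card hss))
  have huniv : S n = Finset.univ := by
    rcases hgrow n with h | h
    · exact h
    · have := Finset.card_le_univ (S n)
      rw [Fintype.card_fin] at this
      omega
  exact (hmem n i).1 (huniv ▸ Finset.mem_univ i)

variable {E : Type*} [NormedAddCommGroup E]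

/-- The largest distance between two members of a finite family. -/
noncomputable def disagreement (v : Fin n → E) : ℝ := ⨆ q : Fin n × Fin n, ‖v q.1 - v q.2‖

theorem norm_sub_le_disagreement (v : Fin n → E) (i j : Fin n) :
    ‖v i - v j‖ ≤ disagreement v :=
  le_ciSup (f := fun q : Fin n × Fin n => ‖v q.1 - v q.2‖) (Set.finite_range _).bddAbove (i, j)

theorem disagreement_nonneg (v : Fin n → E) : 0 ≤ disagreement v :=
  Real.iSup_nonneg fun _ => norm_nonneg _

theorem disagreement_le {v : Fin n → E} {c : ℝ} (hc : 0 ≤ c) (h : ∀ i j, ‖v i - v j‖ ≤ c) :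
    disagreement v ≤ c :=
  Real.iSup_le (fun q => h q.1 q.2) hc

variable [NormedSpace ℝ E]

/-- A stochastic matrix with entries at least `η` contracts disagreement by `1 - η`. -/
theorem norm_sum_sub_sum_le_of_stochastic {A : Matrix (Fin n) (Fin n) ℝ}
    (h0 : ∀ i j, 0 ≤ A i j) (h1 : ∀ i, ∑ j, A i j = 1) {η : ℝ} (hη : ∀ i j, η ≤ A i j)
    (v : Fin n → E) (i j : Fin n) :
    ‖∑ k, A i k • v k - ∑ k, A j k • v k‖ ≤ (1 - η) * disagreement v := by
  -- Both averages are written with the product weights `A i k * A j l`. The diagonal terms vanish,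
  -- and their total weight is at least `η`.
  have e : ∑ k, A i k • v k - ∑ k, A j k • v k
      = ∑ k, ∑ l, (A i k * A j l) • (v k - v l) := by
    simp_rw [smul_sub, Finset.sum_sub_distrib]
    congr 1
    · refine Finset.sum_congr rfl fun k _ => ?_
      rw [← Finset.sum_smul, ← Finset.mul_sum, h1, mul_one]
    · rw [Finset.sum_comm]
      refine Finset.sum_congr rfl fun k _ => ?_
      rw [← Finset.sum_smul, ← Finset.sum_mul, h1, one_mul]
  rw [e]
  calc ‖∑ k, ∑ l, (A i k * A j l) • (v k - v l)‖
      ≤ ∑ k, ∑ l, (A i k * A j l - if k = l then A i k * A j l else 0) * disagreement v := by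
        refine (norm_sum_le _ _).trans (Finset.sum_le_sum fun k _ => ?_)
        refine (norm_sum_le _ _).trans (Finset.sum_le_sum fun l _ => ?_)
        rw [norm_smul, Real.norm_eq_abs, abs_of_nonneg (mul_nonneg (h0 _ _) (h0 _ _))]
        by_cases hkl : k = l
        · simp [hkl]
        · rw [if_neg hkl, sub_zero]
          exact mul_le_mul_of_nonneg_left (norm_sub_le_disagreement v k l)
            (mul_nonneg (h0 _ _) (h0 _ _))
    _ = (1 - ∑ k, A i k * A j k) * disagreement v := by
        simp_rw [← Finset.sum_mul, Finset.sum_sub_distrib, ← Finset.mul_sum, h1, mul_one, h1]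
        simp
    _ ≤ (1 - η) * disagreement v := by
        refine mul_le_mul_of_nonneg_right ?_ (disagreement_nonneg v)
        have : η ≤ ∑ k, A i k * A j k := by
          calc η = ∑ k, η * A j k := by rw [← Finset.mul_sum, h1, mul_one]
            _ ≤ _ := Finset.sum_le_sum fun k _ => mul_le_mul_of_nonneg_right (hη i k) (h0 j k)
        linarith

/-- Averaging with stochastic weights never amplifies a perturbation, so the perturbations merely
add up. -/
theorem norm_sub_trans_le (hN : N.Mixing w B) (hw : 0 < w) {x : ℕ → Fin n → E} {ε : ℕ → ℝ}
    (hx : ∀ t, 1 ≤ t → ∃ z : Fin n → E, (∀ i, ‖z i - x t i‖ ≤ ε t) ∧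
      ∀ i, x (t + 1) i = ∑ j, N.W (t + 1) i j • z j)
    {s : ℕ} (hs : 1 ≤ s) (k : ℕ) (i : Fin n) :
    ‖x (s + k) i - ∑ j, N.trans s k i j • x s j‖ ≤ ∑ l ∈ Finset.range k, ε (s + l) := by
  induction k generalizing i with
  | zero => simp [Network.trans, Matrix.one_apply]
  | succ k ih =>
    obtain ⟨z, hz, hx'⟩ := hx (s + k) (by omega)
    have e : ∑ j, N.trans s (k + 1) i j • x s j
        = ∑ l, N.W (s + k + 1) i l • ∑ j, N.trans s k l j • x s j := by
      simp only [Network.trans, Matrix.mul_apply, Finset.sum_smul, Finset.smul_sum, mul_smul]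
      rw [Finset.sum_comm]
    rw [← add_assoc, hx', e, ← Finset.sum_sub_distrib]
    simp_rw [← smul_sub]
    calc ‖∑ l, N.W (s + k + 1) i l • (z l - ∑ j, N.trans s k l j • x s j)‖
        ≤ ∑ l, N.W (s + k + 1) i l * ∑ l ∈ Finset.range (k + 1), ε (s + l) := by
          refine (norm_sum_le _ _).trans (Finset.sum_le_sum fun l _ => ?_)
          have h0 := hN.nonneg hw (t := s + k + 1) (by omega) i l
          rw [norm_smul, Real.norm_eq_abs, abs_of_nonneg h0]
          refine mul_le_mul_of_nonneg_left ?_ h0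
          rw [Finset.sum_range_succ, add_comm,
            ← sub_add_sub_cancel (z l) (x (s + k) l) (∑ j, N.trans s k l j • x s j)]
          exact (norm_add_le _ _).trans (add_le_add (hz l) (ih l))
      _ = _ := by rw [← Finset.sum_mul, hN.row_sum _ (by omega), one_mul]

/-- The unperturbed transport over `n * B` steps contracts; comparing it with the true values at
both agents gives the factor `2`. -/
theorem disagreement_contraction (hN : N.Mixing w B) (hw : 0 < w) (hw1 : w ≤ 1)
    {x : ℕ → Fin n → E} {ε : ℕ → ℝ} (hε : ∀ t, 0 ≤ ε t)
    (hx : ∀ t, 1 ≤ t → ∃ z : Fin n → E, (∀ i, ‖z i - x t i‖ ≤ ε t) ∧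
      ∀ i, x (t + 1) i = ∑ j, N.W (t + 1) i j • z j)
    {s : ℕ} (hs : 1 ≤ s) :
    disagreement (x (s + n * B)) ≤ (1 - w ^ (n * B)) * disagreement (x s)
      + 2 * ∑ l ∈ Finset.range (n * B), ε (s + l) := by
  have hp : w ^ (n * B) ≤ 1 := pow_le_one₀ hw.le hw1
  have hsum : 0 ≤ ∑ l ∈ Finset.range (n * B), ε (s + l) := Finset.sum_nonneg fun l _ => hε _
  refine disagreement_le (add_nonneg (mul_nonneg (by linarith) (disagreement_nonneg _))
    (by linarith)) fun i j => ?_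
  have h1 := norm_sub_trans_le hN hw hx hs (n * B) i
  have h2 := norm_sub_trans_le hN hw hx hs (n * B) j
  have h3 := norm_sum_sub_sum_le_of_stochastic (hN.trans_nonneg hw s (n * B))
    (hN.trans_row_sum s (n * B)) (hN.trans_ge hw s) (x s) i j
  have h4 := norm_add₃_le (a := x (s + n * B) i - ∑ j, N.trans s (n * B) i j • x s j)
    (b := ∑ k, N.trans s (n * B) i k • x s k - ∑ k, N.trans s (n * B) j k • x s k)
    (c := ∑ k, N.trans s (n * B) j k • x s k - x (s + n * B) j)
  rw [norm_sub_rev _ (x (s + n * B) j), sub_add_sub_cancel, sub_add_sub_cancel] at h4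
  linarith

/-- In the summed recursion the sum of `a (t + L)` misses only the first `L` terms, which cost `L *
M`, and each `e t` is counted at most `L` times. Moving `(1 - η) Σ a` to the left leaves `η Σ a`. -/
theorem sum_range_le_of_contraction {a e : ℕ → ℝ} {L : ℕ} {η M : ℝ} (hη : 0 < η) (hη1 : η ≤ 1)
    (ha0 : ∀ t, 0 ≤ a t) (haM : ∀ t, a t ≤ M) (he : ∀ t, 0 ≤ e t)
    (h : ∀ t, a (t + L) ≤ (1 - η) * a t + 2 * ∑ l ∈ Finset.range L, e (t + l)) (T : ℕ) :
    ∑ t ∈ Finset.range T, a t ≤ L / η * (M + 2 * ∑ t ∈ Finset.range T, e t) := by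
  have hM : 0 ≤ M := (ha0 0).trans (haM 0)
  have hE : 0 ≤ ∑ t ∈ Finset.range T, e t := Finset.sum_nonneg fun t _ => he t
  have hfirst : ∀ k ≤ L, ∑ t ∈ Finset.range k, a t ≤ L * M := fun k hk => by
    calc ∑ t ∈ Finset.range k, a t ≤ ∑ t ∈ Finset.range k, M := Finset.sum_le_sum fun t _ => haM t
      _ = k * M := by simp
      _ ≤ L * M := by gcongr
  rw [div_mul_eq_mul_div, le_div_iff₀ hη]
  rcases le_total T L with hTL | hTL
  · have h1 := hfirst T hTL
    have h0 : 0 ≤ ∑ t ∈ Finset.range T, a t := Finset.sum_nonneg fun t _ => ha0 t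
    have h2 : 0 ≤ (L : ℝ) * ∑ t ∈ Finset.range T, e t := mul_nonneg (Nat.cast_nonneg _) hE
    nlinarith
  obtain ⟨T', rfl⟩ := Nat.exists_eq_add_of_le hTL
  have h1 : ∑ t ∈ Finset.range (L + T'), a t
      = ∑ t ∈ Finset.range L, a t + ∑ t ∈ Finset.range T', a (t + L) := by
    rw [Finset.sum_range_add]; simp_rw [add_comm L]
  have h2 : ∑ t ∈ Finset.range T', a (t + L)
      ≤ (1 - η) * ∑ t ∈ Finset.range T', a t
        + 2 * ∑ t ∈ Finset.range T', ∑ l ∈ Finset.range L, e (t + l) := by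
    rw [Finset.mul_sum, Finset.mul_sum, ← Finset.sum_add_distrib]
    exact Finset.sum_le_sum fun t _ => h t
  have h3 : ∑ t ∈ Finset.range T', ∑ l ∈ Finset.range L, e (t + l)
      ≤ L * ∑ t ∈ Finset.range (L + T'), e t := by
    rw [Finset.sum_comm]
    calc ∑ l ∈ Finset.range L, ∑ t ∈ Finset.range T', e (t + l)
        ≤ ∑ l ∈ Finset.range L, ∑ t ∈ Finset.range (L + T'), e t := by
          refine Finset.sum_le_sum fun l hl => ?_
          rw [← Finset.sum_image (f := e) (g := fun t => t + l) (by simp)]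
          refine Finset.sum_le_sum_of_subset_of_nonneg ?_ fun t _ _ => he t
          intro t ht
          simp only [Finset.mem_image, Finset.mem_range] at ht hl ⊢
          omega
      _ = _ := by simp
  have h4 : ∑ t ∈ Finset.range T', a t ≤ ∑ t ∈ Finset.range (L + T'), a t :=
    Finset.sum_le_sum_of_subset_of_nonneg (Finset.range_mono (by omega)) fun t _ _ => ha0 t
  have h5 := hfirst L le_rfl
  have h6 := mul_le_mul_of_nonneg_left h4 (by linarith : 0 ≤ 1 - η)
  linarith

end Consensus

/-! ### One-step inequality for a fixed decision. -/

/-- The standing assumptions together with the conditions on the constants and the start. -/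
structure AlgorithmSetting {n p : ℕ} (D : Problem n p) (N : Network n)
    (r R F G₁ G₂ μ γ₀ w : ℝ) (B : ℕ) (z₁ : Fin n → Vec p) : Prop where
  standing : Standing D N r R F G₁ G₂ μ w B
  n_pos : 0 < n
  p_pos : 0 < p
  r_pos : 0 < r
  one_le_μ : 1 ≤ μ
  γ₀_pos : 0 < γ₀
  γ₀_le : γ₀ * (4 * ((p : ℝ) ^ 2 + 1) * G₂ ^ 2) ≤ 1
  w_pos : 0 < w
  w_lt : w < 1
  start : ∀ i, z₁ i ∈ (1 - (stronglyConvexParams μ γ₀ r).ξ 1) • D.X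

/-- The constant of the one-step inequality. -/
noncomputable def stepConst (p : ℕ) (r R G₁ G₂ γ₀ : ℝ) : ℝ :=
  2 * p ^ 2 * G₁ ^ 2 + 2 * G₁ * (R + 2 * r) + 2 * γ₀ * G₂ ^ 2 * (R + 2 * r) ^ 2

/-- The right-hand side of the one-step inequality, before averaging. -/
noncomputable def stepBound {n p : ℕ} (D : Problem n p) (μ γ₀ s : ℝ) (t : ℕ) (i : Fin n)
    (y x : Vec p) : ℝ :=
  (1 - 1 / t) * ‖x - (1 - 1 / (μ * t)) • y‖ ^ 2 - 2 * (1 / (μ * t)) * (D.f i t x - D.f i t y)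
    - γ₀ * ‖pos (D.g i t x)‖ ^ 2 - 2 * γ₀ * s * ‖pos (D.g i t x)‖

section OneStep

variable {n p : ℕ} {D : Problem n p} {N : Network n} {r R F G₁ G₂ μ γ₀ w : ℝ} {B : ℕ}
  {z₁ : Fin n → Vec p}

namespace AlgorithmSetting

theorem R_pos (h : AlgorithmSetting D N r R F G₁ G₂ μ γ₀ w B z₁) : 0 < R := by
  have : Nonempty (Fin p) := ⟨⟨0, h.p_pos⟩⟩
  obtain ⟨x, hx⟩ := NormedSpace.exists_lt_norm ℝ (Vec p) 0
  have h1 : (r / ‖x‖) • x ∈ D.X := h.standing.set.ball_subset (by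
    rw [mem_closedBall_zero_iff, norm_smul, norm_div, norm_norm, div_mul_cancel₀ _ hx.ne']
    exact (abs_of_pos h.r_pos).le)
  have h2 := h.standing.set.norm_le h1
  rw [norm_smul, norm_div, norm_norm, div_mul_cancel₀ _ hx.ne', Real.norm_eq_abs,
    abs_of_pos h.r_pos] at h2
  exact h.r_pos.trans_le h2

theorem G₁_nonneg (h : AlgorithmSetting D N r R F G₁ G₂ μ γ₀ w B z₁) : 0 ≤ G₁ := by
  obtain ⟨v, hv, -⟩ := h.standing.convex.subgrad_f ⟨0, h.n_pos⟩ 1 le_rfl 0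
    (h.standing.set.zero_mem h.r_pos)
  exact (norm_nonneg v).trans hv

theorem G₂_nonneg (h : AlgorithmSetting D N r R F G₁ G₂ μ γ₀ w B z₁) : 0 ≤ G₂ := by
  obtain ⟨v, hv, -⟩ := h.standing.convex.subgrad_g ⟨0, h.n_pos⟩ 1 le_rfl 0
    (h.standing.set.zero_mem h.r_pos)
  exact (norm_nonneg v).trans hv

theorem F_nonneg (h : AlgorithmSetting D N r R F G₁ G₂ μ γ₀ w B z₁) : 0 ≤ F :=
  (abs_nonneg _).trans (h.standing.lossBounded ⟨0, h.n_pos⟩ 1 le_rfl 0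
    (h.standing.set.zero_mem h.r_pos))

theorem stepConst_nonneg (h : AlgorithmSetting D N r R F G₁ G₂ μ γ₀ w B z₁) :
    0 ≤ stepConst p r R G₁ G₂ γ₀ := by
  have := h.R_pos
  have := h.r_pos
  have := h.G₁_nonneg
  have := h.γ₀_pos
  unfold stepConst
  positivity

/-- A feasible point has zero violation, and the violation is `G₂`-Lipschitz on a set of diameter at
most `2 * R`. -/
theorem violation_le (h : AlgorithmSetting D N r R F G₁ G₂ μ γ₀ w B z₁) (i : Fin n) {t : ℕ}
    (ht : 1 ≤ t) {x : Vec p} (hx : x ∈ D.X) : ‖pos (D.g i t x)‖ ≤ G₂ * (2 * R) := by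
  obtain ⟨y, hy, hy'⟩ := h.standing.feasible t ht
  have h1 := h.standing.convex.norm_pos_constr_le i ht hx hy h.G₂_nonneg
  have h2 : pos (D.g i t y) = 0 := by
    ext k
    rw [pos_apply]
    exact max_eq_right (hy' t (Finset.mem_Icc.2 ⟨ht, le_rfl⟩) ⟨i, k⟩)
  rw [h2, norm_zero, zero_add] at h1
  refine h1.trans (mul_le_mul_of_nonneg_left ?_ h.G₂_nonneg)
  have := norm_sub_le x y
  have := h.standing.set.norm_le hx
  have := h.standing.set.norm_le hy
  linarith

/-- Because `α_t γ_t = γ₀`, the scaled direction is at most `p G₁ α_t + p γ₀ G₂ A`. Its square is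
split by `(a + b)² ≤ 2a² + 2b²`, and the condition on `γ₀` gives `2 p² γ₀² G₂² ≤ γ₀ / 2`. -/
theorem scaled_direction_sq_le (h : AlgorithmSetting D N r R F G₁ G₂ μ γ₀ w B z₁) (i : Fin n)
    {t : ℕ} (ht : 1 ≤ t) {x : Vec p} (hx : x ∈ (1 - 1 / (μ * t)) • D.X) {u : Vec p}
    (hu : ‖u‖ = 1) :
    (1 / (μ * t)) ^ 2 * ‖direction D (stronglyConvexParams μ γ₀ r) t i x u‖ ^ 2
      ≤ 2 * p ^ 2 * G₁ ^ 2 * (1 / (μ * t)) ^ 2 + γ₀ / 2 * ‖pos (D.g i t x)‖ ^ 2 := by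
  have h1 := norm_direction_le h.standing.set h.standing.convex h.r_pos h.one_le_μ h.γ₀_pos ht i
    hx hu
  have hα := stepsize_pos h.one_le_μ ht
  have hμ0 : μ ≠ 0 := by linarith [h.one_le_μ]
  have ht0 : (t : ℝ) ≠ 0 := by positivity
  set α := 1 / (μ * t) with hαdef
  set A := ‖pos (D.g i t x)‖
  have h2 : α * ‖direction D (stronglyConvexParams μ γ₀ r) t i x u‖
      ≤ p * (G₁ * α) + p * (γ₀ * A * G₂) := by
    refine (mul_le_mul_of_nonneg_left h1 hα.le).trans (le_of_eq ?_)
    rw [hαdef]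
    field_simp
  have h3 := pow_le_pow_left₀ (mul_nonneg hα.le (norm_nonneg _)) h2 2
  have h4 : γ₀ ^ 2 * (p ^ 2 * G₂ ^ 2) ≤ γ₀ / 4 := by
    have := h.γ₀_le
    have hg := h.γ₀_pos
    have : γ₀ * (p ^ 2 * G₂ ^ 2) ≤ 1 / 4 := by
      have : 0 ≤ γ₀ * G₂ ^ 2 := by positivity
      linarith
    nlinarith
  have h5 := mul_le_mul_of_nonneg_right h4 (sq_nonneg A)
  rw [mul_pow] at h3
  have h6 := sq_nonneg (p * (G₁ * α) - p * (γ₀ * A * G₂))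
  nlinarith

/-- Lower bound for the mean of the update direction against the displacement. -/
theorem le_integral_inner_direction (h : AlgorithmSetting D N r R F G₁ G₂ μ γ₀ w B z₁)
    (i : Fin n) {t : ℕ} (ht : 1 ≤ t) {x y : Vec p} (hx : x ∈ (1 - 1 / (μ * t)) • D.X)
    (hy : y ∈ D.X) {s : ℝ} (hs : 0 ≤ s) (hys : ∀ k, D.g i t y k ≤ -s) :
    2 * p ^ 2 * G₁ ^ 2 * (1 / (μ * t)) ^ 2 + γ₀ / 2 * ‖pos (D.g i t x)‖ ^ 2
        + ‖x - (1 - 1 / (μ * t)) • y‖ ^ 2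
        - 2 * (1 / (μ * t)) * ∫ u, inner ℝ (direction D (stronglyConvexParams μ γ₀ r) t i x u)
            (x - (1 - 1 / (μ * t)) • y) ∂(uniformSphere p)
      ≤ stepBound D μ γ₀ s t i y x + stepConst p r R G₁ G₂ γ₀ * (1 / (μ * t)) ^ 2 := by
  have hC := h.standing.convex
  have hD := h.standing.set
  have hα := stepsize_pos h.one_le_μ ht
  have hα1 := stepsize_le_one h.one_le_μ ht
  have hG₁ := h.G₁_nonneg
  have hG₂ := h.G₂_nonneg
  have hγ := h.γ₀_pos
  have hr := h.r_pos
  have hR := h.R_pos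
  have hxX := shrunk_subset hD h.r_pos h.one_le_μ ht hx
  have hyK : (1 - 1 / (μ * t)) • y ∈ (1 - 1 / (μ * t)) • D.X := Set.smul_mem_smul_set hy
  have hyX := shrunk_subset hD h.r_pos h.one_le_μ ht hyK
  have ht0 : (0 : ℝ) < t := by exact_mod_cast ht
  have hμ0 : 0 < μ := by linarith [h.one_le_μ]
  set a := stronglyConvexParams μ γ₀ r with ha
  set q := dual D a t i x with hq
  have hq0 : ∀ k, 0 ≤ q k := dual_nonneg h.one_le_μ h.γ₀_pos t i x
  set y' := (1 - 1 / (μ * t)) • y with hy'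
  have hyy' : ‖y' - y‖ ≤ R * (1 / (μ * t)) := by
    have : y' - y = (-(1 / (μ * t))) • y := by rw [hy']; module
    rw [this, norm_smul, norm_neg, Real.norm_eq_abs, abs_of_pos hα, mul_comm]
    exact mul_le_mul_of_nonneg_right (hD.norm_le hy) hα.le
  have hδ : a.δ t = r * (1 / (μ * t)) := rfl
  have hδ0 : 0 < a.δ t := mul_pos hr hα
  have hLip : LipschitzOnWith (Real.toNNReal (G₁ + ‖q‖ * G₂)) (penalizedLoss D i t q) D.X :=
    LipschitzOnWith.of_dist_le_mul fun x hx y hy => by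
      rw [Real.dist_eq, dist_eq_norm, Real.coe_toNNReal _ (by positivity)]
      exact penalizedLoss_abs_sub_le hC i ht hx hy hq0
  have hest := two_point_estimate h.p_pos hD.convex hLip
    (penalizedLoss_subgradient hC h.standing.strong i ht hq0) (x := x) (d := x - y') hδ0
    (closedBall_subset_of_mem_smul hD.convex hD.ball_subset hα hα1 hx)
    (by rw [sub_sub_cancel]
        exact closedBall_subset_of_mem_smul hD.convex hD.ball_subset hα hα1 hyK)
  have hint : ∫ u, inner ℝ (direction D a t i x u) (x - y') ∂(uniformSphere p)
      = ∫ u, p / a.δ t * (penalizedLoss D i t q (x + a.δ t • (u : Vec p))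
          - penalizedLoss D i t q x) * inner ℝ (u : Vec p) (x - y') ∂(uniformSphere p) := by
    simp_rw [direction_eq, real_inner_smul_left, ← hq]
  rw [← hint, Real.coe_toNNReal _ (by positivity), sub_sub_cancel] at hest
  set m := ∫ u, inner ℝ (direction D a t i x u) (x - y') ∂(uniformSphere p)
  have hqn : ‖q‖ = γ₀ * (μ * t) * ‖pos (D.g i t x)‖ := norm_dual h.one_le_μ h.γ₀_pos t i x
  have hqg : inner ℝ q (D.g i t x) = γ₀ * (μ * t) * ‖pos (D.g i t x)‖ ^ 2 := by
    rw [hq, dual, real_inner_smul_left, inner_pos_self]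
    have : a.γ t = γ₀ * (μ * t) := by simp only [ha, stronglyConvexParams]; field_simp
    rw [this]
  have hf := (abs_le.1 (hC.abs_loss_sub_le i ht hyX hy)).2
  have hf' := hf.trans (mul_le_mul_of_nonneg_left hyy' hG₁)
  have hg := hC.inner_constr_le i ht hyX hy hq0
  have hg1 : ‖q‖ * (G₂ * ‖y' - y‖) ≤ ‖q‖ * (G₂ * (R * (1 / (μ * t)))) := by gcongr
  have hg2 := inner_le_neg_mul_norm hq0 hs hys
  unfold penalizedLoss at hest
  rw [hqg] at hest
  set A := ‖pos (D.g i t x)‖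
  set b := ‖x - y'‖ ^ 2
  -- The factor `R + 2 * r` collects `R` from shrinking the comparator `y` to `y'` and `2 * r` from
  -- the smoothing error with `δ_t = r α_t`.
  have hm : D.f i t x - D.f i t y + γ₀ * (μ * t) * A ^ 2 + s * ‖q‖
      - (G₁ + ‖q‖ * G₂) * (R + 2 * r) * (1 / (μ * t)) + μ / 2 * b ≤ m := by
    rw [hδ] at hest
    linarith
  have hm2 := mul_le_mul_of_nonneg_left hm (by positivity : 0 ≤ 2 * (1 / (μ * t)))
  have e : 2 * (1 / (μ * t)) * (D.f i t x - D.f i t y + γ₀ * (μ * t) * A ^ 2 + s * ‖q‖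
      - (G₁ + ‖q‖ * G₂) * (R + 2 * r) * (1 / (μ * t)) + μ / 2 * b)
      = 2 * (1 / (μ * t)) * (D.f i t x - D.f i t y) + 2 * γ₀ * A ^ 2 + 2 * γ₀ * s * A
        - 2 * G₁ * (R + 2 * r) * (1 / (μ * t)) ^ 2
        - 2 * γ₀ * A * (G₂ * (R + 2 * r) * (1 / (μ * t))) + 1 / t * b := by
    rw [hqn]
    field_simp
    ring
  rw [e] at hm2
  -- Young's inequality for the cross term in `A`: it uses up `γ₀ / 2 * A ^ 2` and leaves the last
  -- summand of `stepConst`.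
  have hsq := mul_nonneg hγ.le (sq_nonneg (A - 2 * (G₂ * (R + 2 * r) * (1 / (μ * t)))))
  unfold stepBound stepConst
  linarith

end AlgorithmSetting

/-- By independence the joint law is a product, so Fubini allows `U` to be averaged first with `X`
frozen; this replaces conditioning on the past. -/
theorem integral_comp_of_indepFun {Ω κ S : Type*} [MeasurableSpace Ω] [MeasurableSpace κ]
    [MeasurableSpace S] {P : Measure Ω} [IsProbabilityMeasure P] {X : Ω → κ} {U : Ω → S}
    (hX : Measurable X) (hU : Measurable U) (hind : IndepFun X U P) {Ψ : κ → S → ℝ}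
    (hΨ : Measurable fun q : κ × S => Ψ q.1 q.2) {c : ℝ} (hc : ∀ x v, |Ψ x v| ≤ c) :
    Integrable (fun ω => ∫ v, Ψ (X ω) v ∂(P.map U)) P ∧
    ∫ ω, Ψ (X ω) (U ω) ∂P = ∫ ω, ∫ v, Ψ (X ω) v ∂(P.map U) ∂P := by
  have := Measure.isProbabilityMeasure_map (μ := P) hX.aemeasurable
  have := Measure.isProbabilityMeasure_map (μ := P) hU.aemeasurable
  have hint : Integrable (fun q : κ × S => Ψ q.1 q.2) ((P.map X).prod (P.map U)) :=
    Integrable.of_bound hΨ.aestronglyMeasurable c (Filter.Eventually.of_forall fun q => hc _ _)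
  have hleft := hint.integral_prod_left
  constructor
  · exact (integrable_map_measure hleft.aestronglyMeasurable hX.aemeasurable).1 hleft
  · have hmap := (indepFun_iff_map_prod_eq_prod_map_map hX.aemeasurable hU.aemeasurable).1 hind
    calc ∫ ω, Ψ (X ω) (U ω) ∂P = ∫ q, Ψ q.1 q.2 ∂(P.map fun ω => (X ω, U ω)) :=
          (integral_map (hX.prodMk hU).aemeasurable hΨ.aestronglyMeasurable).symm
      _ = ∫ x, ∫ v, Ψ x v ∂(P.map U) ∂(P.map X) := by rw [hmap]; exact integral_prod _ hint
      _ = _ := integral_map hX.aemeasurable hleft.aestronglyMeasurable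

end OneStep

/-! ### Pathwise facts: continuity, mixing, membership. -/

section Deterministic

variable {n p : ℕ} {D : Problem n p} {N : Network n} {r R F G₁ G₂ μ γ₀ w : ℝ} {B : ℕ}
  {z₁ : Fin n → Vec p}

theorem Problem.SetAssumption.isCompact (hD : D.SetAssumption r R) : IsCompact D.X :=
  Metric.isCompact_of_isClosed_isBounded hD.isClosed
    (Metric.isBounded_closedBall.subset hD.subset_ball)

theorem continuousOn_violation (hC : D.ConvexAssumption G₁ G₂) (i : Fin n) {t : ℕ} (ht : 1 ≤ t) :
    ContinuousOn (fun x => ‖pos (D.g i t x)‖) D.X :=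
  (continuous_pos.comp_continuousOn (hC.continuousOn_constr i ht)).norm

theorem continuousOn_stepBound (hC : D.ConvexAssumption G₁ G₂) (s : ℝ) (i : Fin n) {t : ℕ}
    (ht : 1 ≤ t) (y : Vec p) : ContinuousOn (stepBound D μ γ₀ s t i y) D.X := by
  have h1 := hC.continuousOn_loss i ht
  have h2 := continuousOn_violation hC i ht
  unfold stepBound
  fun_prop

/-- Convexity of the squared distance and double stochasticity. -/
theorem sum_norm_mix_sub_sq_le (hN : N.Mixing w B) (hw : 0 < w) {t : ℕ} (ht : 1 ≤ t)
    (z : Fin n → Vec p) (c : Vec p) :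
    ∑ i, ‖mix N t z i - c‖ ^ 2 ≤ ∑ i, ‖z i - c‖ ^ 2 := by
  have hconv : ConvexOn ℝ Set.univ fun v : Vec p => ‖v - c‖ ^ 2 := by
    have h1 : ConvexOn ℝ Set.univ fun v : Vec p => ‖v - c‖ := by
      simpa [dist_eq_norm] using convexOn_univ_dist c
    exact h1.pow (fun v _ => norm_nonneg _) 2
  calc ∑ i, ‖mix N t z i - c‖ ^ 2 ≤ ∑ i, ∑ j, N.W t i j * ‖z j - c‖ ^ 2 := by
        refine Finset.sum_le_sum fun i _ => ?_
        simpa [mix] using hconv.map_sum_le (t := Finset.univ) (w := fun j => N.W t i j) (p := z)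
          (fun j _ => hN.nonneg hw ht i j) (hN.row_sum t ht i) fun j _ => Set.mem_univ _
    _ = _ := by
        rw [Finset.sum_comm]
        simp_rw [← Finset.sum_mul, hN.col_sum t ht, one_mul]

theorem norm_sub_sq_le_add {a b c : Vec p} {ρ : ℝ} (h : ‖a - b‖ + ‖a - c‖ ≤ ρ) :
    ‖a - c‖ ^ 2 ≤ ‖a - b‖ ^ 2 + ρ * ‖b - c‖ := by
  have h1 : ‖a - c‖ - ‖a - b‖ ≤ ‖b - c‖ := by
    have := norm_sub_le_norm_sub_add_norm_sub a b c
    linarith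
  have h2 := norm_nonneg (a - b)
  have h3 := norm_nonneg (a - c)
  have h4 := norm_nonneg (b - c)
  have h5 := mul_le_mul_of_nonneg_right h h4
  nlinarith

namespace AlgorithmSetting

variable {Ω : Type*} {u : ℕ → Fin n → Ω → Metric.sphere (0 : Vec p) 1}

theorem decisions_mem (h : AlgorithmSetting D N r R F G₁ G₂ μ γ₀ w B z₁) (ω : Ω) {t : ℕ}
    (ht : 1 ≤ t) (i : Fin n) :
    decisions D N (stronglyConvexParams μ γ₀ r) z₁ u ω t i ∈ (1 - 1 / (μ * t)) • D.X :=
  xSeq_mem h.standing.set h.r_pos h.standing.mixing h.w_pos h.start _ ht i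

theorem decisions_mem_X (h : AlgorithmSetting D N r R F G₁ G₂ μ γ₀ w B z₁) (ω : Ω) {t : ℕ}
    (ht : 1 ≤ t) (i : Fin n) :
    decisions D N (stronglyConvexParams μ γ₀ r) z₁ u ω t i ∈ D.X :=
  shrunk_subset h.standing.set h.r_pos h.one_le_μ ht (h.decisions_mem ω ht i)

theorem z_mem_X (h : AlgorithmSetting D N r R F G₁ G₂ μ γ₀ w B z₁)
    (v : ℕ → Fin n → Vec p) {t : ℕ} (ht : 1 ≤ t) (i : Fin n) :
    zSeq D N (stronglyConvexParams μ γ₀ r) z₁ v t i ∈ D.X :=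
  shrunk_subset h.standing.set h.r_pos h.one_le_μ ht
    (zSeq_mem h.standing.set h.r_pos h.start v ht i)

end AlgorithmSetting

end Deterministic

/-! ### Expected one-step progress and the Lyapunov recursion. -/

section Expectation

variable {n p : ℕ} {D : Problem n p} {N : Network n} {r R F G₁ G₂ μ γ₀ w : ℝ} {B : ℕ}
  {z₁ : Fin n → Vec p} {Ω : Type*} [MeasurableSpace Ω] {P : Measure Ω}
  {u : ℕ → Fin n → Ω → Metric.sphere (0 : Vec p) 1}

theorem integral_const_mul_sub₄ {f₁ f₂ f₃ f₄ : Ω → ℝ} (h₁ : Integrable f₁ P)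
    (h₂ : Integrable f₂ P) (h₃ : Integrable f₃ P) (h₄ : Integrable f₄ P) (c₁ c₂ c₃ c₄ : ℝ) :
    ∫ ω, (c₁ * f₁ ω - c₂ * f₂ ω - c₃ * f₃ ω - c₄ * f₄ ω) ∂P
      = c₁ * ∫ ω, f₁ ω ∂P - c₂ * ∫ ω, f₂ ω ∂P - c₃ * ∫ ω, f₃ ω ∂P - c₄ * ∫ ω, f₄ ω ∂P := by
  have i₁₂ : Integrable (fun ω => c₁ * f₁ ω - c₂ * f₂ ω) P :=
    (h₁.const_mul _).sub (h₂.const_mul _)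
  have i₁₃ : Integrable (fun ω => c₁ * f₁ ω - c₂ * f₂ ω - c₃ * f₃ ω) P :=
    i₁₂.sub (h₃.const_mul _)
  rw [integral_sub i₁₃ (h₄.const_mul _), integral_sub i₁₂ (h₃.const_mul _),
    integral_sub (h₁.const_mul _) (h₂.const_mul _), integral_const_mul, integral_const_mul,
    integral_const_mul, integral_const_mul]

namespace AlgorithmSetting

theorem measurable_decisions (h : AlgorithmSetting D N r R F G₁ G₂ μ γ₀ w B z₁)
    (hu : UniformDirections P u) (t : ℕ) (i : Fin n) :
    Measurable fun ω => decisions D N (stronglyConvexParams μ γ₀ r) z₁ u ω t i :=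
  measurable_xSeq h.standing.set h.standing.convex h.standing.mixing h.r_pos h.one_le_μ h.w_pos
    h.start u t (fun s hs _ j => hu.measurable s hs j) i

end AlgorithmSetting

variable [IsProbabilityMeasure P]

theorem integrable_comp_of_continuousOn {K : Set (Vec p)} (hK : IsCompact K) {φ : Vec p → ℝ}
    (hφ : ContinuousOn φ K) {x : Ω → Vec p} (hx : Measurable x) (hmem : ∀ ω, x ω ∈ K) :
    Integrable (fun ω => φ (x ω)) P := by
  obtain ⟨c, hc⟩ := hK.exists_bound_of_continuousOn hφ
  exact Integrable.of_bound (measurable_comp_of_continuousOn hφ hx hmem).aestronglyMeasurable c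
    (Filter.Eventually.of_forall fun ω => hc _ (hmem ω))

namespace AlgorithmSetting

theorem integrable_decisions (h : AlgorithmSetting D N r R F G₁ G₂ μ γ₀ w B z₁)
    (hu : UniformDirections P u) {φ : Vec p → ℝ} (hφ : ContinuousOn φ D.X) {t : ℕ} (ht : 1 ≤ t)
    (i : Fin n) :
    Integrable (fun ω => φ (decisions D N (stronglyConvexParams μ γ₀ r) z₁ u ω t i)) P :=
  integrable_comp_of_continuousOn h.standing.set.isCompact hφ (h.measurable_decisions hu t i)
    fun ω => h.decisions_mem_X ω ht i

theorem integrable_z_sub_sq (h : AlgorithmSetting D N r R F G₁ G₂ μ γ₀ w B z₁)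
    (hu : UniformDirections P u) {t : ℕ} (ht : 1 ≤ t) (i : Fin n) (c : Vec p) :
    Integrable (fun ω => ‖zSeq D N (stronglyConvexParams μ γ₀ r) z₁
      (fun t i => (u t i ω : Vec p)) t i - c‖ ^ 2) P :=
  integrable_comp_of_continuousOn (φ := fun v => ‖v - c‖ ^ 2) h.standing.set.isCompact
    (by fun_prop)
    (measurable_zSeq h.standing.set h.standing.convex h.standing.mixing h.r_pos h.one_le_μ
      h.w_pos h.start u t (fun s hs _ j => hu.measurable s hs j) i)
    fun ω => h.z_mem_X _ ht i

/-- The expectation of the update direction against the displacement may be computed by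
averaging over the current direction first. -/
theorem integral_inner_direction_eq (h : AlgorithmSetting D N r R F G₁ G₂ μ γ₀ w B z₁)
    (hu : UniformDirections P u) {t : ℕ} (ht : 1 ≤ t) (i : Fin n) (c : Vec p) :
    let x := fun ω => decisions D N (stronglyConvexParams μ γ₀ r) z₁ u ω t i
    Integrable (fun ω => inner ℝ
      (direction D (stronglyConvexParams μ γ₀ r) t i (x ω) (u t i ω)) (x ω - c)) P ∧
    Integrable (fun ω => ∫ v, inner ℝ
      (direction D (stronglyConvexParams μ γ₀ r) t i (x ω) v) (x ω - c) ∂(uniformSphere p)) P ∧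
    ∫ ω, inner ℝ (direction D (stronglyConvexParams μ γ₀ r) t i (x ω) (u t i ω)) (x ω - c) ∂P
      = ∫ ω, ∫ v, inner ℝ (direction D (stronglyConvexParams μ γ₀ r) t i (x ω) v) (x ω - c)
          ∂(uniformSphere p) ∂P := by
  intro x
  have hD := h.standing.set
  have hC := h.standing.convex
  set a := stronglyConvexParams μ γ₀ r with ha
  set K : Set (Vec p) := (1 - 1 / (μ * t)) • D.X with hK
  have hxm : Measurable x := h.measurable_decisions hu t i
  -- The losses and constraints are arbitrary off the decision set, so joint measurability is
  -- available only on the subtype of the shrunk set.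
  let X : Ω → K := fun ω => ⟨x ω, h.decisions_mem ω ht i⟩
  have hX : Measurable X := hxm.subtype_mk
  have hind : IndepFun X (u t i) P := by
    have h1 : IndepFun x (u t i) P := indepFun_xSeq hD hC h.standing.mixing h.r_pos h.one_le_μ
      h.w_pos h.start hu ht i
    rw [IndepFun_iff_Indep] at h1 ⊢
    have : MeasurableSpace.comap X inferInstance = MeasurableSpace.comap x inferInstance := by
      change MeasurableSpace.comap X (MeasurableSpace.comap Subtype.val _) = _
      rw [MeasurableSpace.comap_comp]
      rfl
    rwa [this]
  let Ψ : K → Metric.sphere (0 : Vec p) 1 → ℝ := fun x v =>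
    inner ℝ (direction D a t i x v) ((x : Vec p) - c)
  have hΨ : Measurable fun q : K × Metric.sphere (0 : Vec p) 1 => Ψ q.1 q.2 := by
    have hval : Measurable fun q : K × Metric.sphere (0 : Vec p) 1 => (q.1 : Vec p) :=
      measurable_subtype_coe.comp measurable_fst
    exact (measurable_direction hD hC h.r_pos h.one_le_μ ht i hval (fun q => q.1.2)
      measurable_snd).inner (hval.sub_const c)
  have hγ := h.γ₀_pos
  have hμ := h.one_le_μ
  have hG₁ := h.G₁_nonneg
  have hG₂ := h.G₂_nonneg
  have hbound : ∀ x v, |Ψ x v|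
      ≤ p * (G₁ + γ₀ * (μ * t) * (G₂ * (2 * R)) * G₂) * (R + ‖c‖) := by
    intro x v
    have hxX := shrunk_subset hD h.r_pos h.one_le_μ ht x.2
    have h1 := norm_direction_le hD hC h.r_pos h.one_le_μ h.γ₀_pos ht i x.2
      (u := v) (norm_eq_of_mem_sphere v)
    have h2 := h.violation_le i ht hxX
    have h3 : ‖(x : Vec p) - c‖ ≤ R + ‖c‖ :=
      (norm_sub_le _ _).trans (by linarith [hD.norm_le hxX])
    refine (abs_real_inner_le_norm _ _).trans (mul_le_mul (h1.trans ?_) h3 (norm_nonneg _) ?_)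
    · gcongr
    · have := h.R_pos
      positivity
  obtain ⟨h1, h2⟩ := integral_comp_of_indepFun hX (hu.measurable t ht i) hind hΨ hbound
  rw [hu.law t ht i] at h1 h2
  refine ⟨?_, h1, h2⟩
  exact Integrable.of_bound (hΨ.comp (hX.prodMk (hu.measurable t ht i))).aestronglyMeasurable _
    (Filter.Eventually.of_forall fun ω => hbound (X ω) (u t i ω))

/-- Expected one-step progress of the projected update. -/
theorem integral_z_succ_sub_sq_le (h : AlgorithmSetting D N r R F G₁ G₂ μ γ₀ w B z₁)
    (hu : UniformDirections P u) {t : ℕ} (ht : 1 ≤ t) (i : Fin n) {y : Vec p} (hy : y ∈ D.X)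
    {s : ℝ} (hs : 0 ≤ s) (hys : ∀ k, D.g i t y k ≤ -s) :
    ∫ ω, ‖zSeq D N (stronglyConvexParams μ γ₀ r) z₁ (fun t i => (u t i ω : Vec p)) (t + 1) i
        - (1 - 1 / (μ * t)) • y‖ ^ 2 ∂P
      ≤ ∫ ω, stepBound D μ γ₀ s t i y
          (decisions D N (stronglyConvexParams μ γ₀ r) z₁ u ω t i) ∂P
        + stepConst p r R G₁ G₂ γ₀ * (1 / (μ * t)) ^ 2 := by
  have hD := h.standing.set
  have hC := h.standing.convex
  set a := stronglyConvexParams μ γ₀ r with ha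
  set c := (1 - 1 / (μ * t)) • y with hc
  -- The shrunk sets increase in time, so the comparator scaled for time `t` lies in the set
  -- projected onto at time `t + 1`.
  have hcK : c ∈ (1 - a.ξ (t + 1)) • D.X :=
    shrunk_subset_succ hD h.r_pos h.one_le_μ ht (Set.smul_mem_smul_set hy)
  set x := fun ω => decisions D N a z₁ u ω t i with hx
  obtain ⟨hi1, hi2, heq⟩ := h.integral_inner_direction_eq hu ht i c
  have hi3 : Integrable (fun ω => 2 * p ^ 2 * G₁ ^ 2 * (1 / (μ * t)) ^ 2
      + γ₀ / 2 * ‖pos (D.g i t (x ω))‖ ^ 2 + ‖x ω - c‖ ^ 2) P := by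
    refine h.integrable_decisions hu (φ := fun v => 2 * p ^ 2 * G₁ ^ 2 * (1 / (μ * t)) ^ 2
      + γ₀ / 2 * ‖pos (D.g i t v)‖ ^ 2 + ‖v - c‖ ^ 2) ?_ ht i
    have := continuousOn_violation hC i ht
    fun_prop
  have hi4 := h.integrable_decisions hu
    (continuousOn_stepBound (μ := μ) (γ₀ := γ₀) hC s i ht y) ht i
  have hpt : ∀ ω, ‖zSeq D N a z₁ (fun t i => (u t i ω : Vec p)) (t + 1) i - c‖ ^ 2
      ≤ 2 * p ^ 2 * G₁ ^ 2 * (1 / (μ * t)) ^ 2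
      + γ₀ / 2 * ‖pos (D.g i t (x ω))‖ ^ 2 + ‖x ω - c‖ ^ 2
      - 2 * (1 / (μ * t)) * inner ℝ (direction D a t i (x ω) (u t i ω)) (x ω - c) := by
    intro ω
    rw [zSeq_succ a z₁ _ ht]
    change ‖proj ((1 - a.ξ (t + 1)) • D.X)
      (x ω - a.α t • direction D a t i (x ω) (u t i ω)) - c‖ ^ 2 ≤ _
    have h1 := norm_proj_sub_le (hD.convex.smul _) (hD.isClosed_smul _)
      (x ω - a.α t • direction D a t i (x ω) (u t i ω)) hcK
    have h2 := pow_le_pow_left₀ (norm_nonneg _) h1 2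
    have h3 : (1 / (μ * t)) ^ 2 * ‖direction D a t i (x ω) (u t i ω)‖ ^ 2
        ≤ 2 * p ^ 2 * G₁ ^ 2 * (1 / (μ * t)) ^ 2 + γ₀ / 2 * ‖pos (D.g i t (x ω))‖ ^ 2 :=
      h.scaled_direction_sq_le i ht (h.decisions_mem (u := u) ω ht i)
      (norm_eq_of_mem_sphere (u t i ω))
    have h4 : ‖x ω - a.α t • direction D a t i (x ω) (u t i ω) - c‖ ^ 2
        = ‖x ω - c‖ ^ 2 - 2 * (1 / (μ * t) * inner ℝ (direction D a t i (x ω) (u t i ω)) (x ω - c))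
          + (1 / (μ * t)) ^ 2 * ‖direction D a t i (x ω) (u t i ω)‖ ^ 2 := by
      rw [sub_right_comm, norm_sub_sq_real, norm_smul, mul_pow, Real.norm_eq_abs, sq_abs,
        real_inner_smul_right, real_inner_comm]
      rfl
    linarith
  calc _ ≤ ∫ ω, (2 * p ^ 2 * G₁ ^ 2 * (1 / (μ * t)) ^ 2
      + γ₀ / 2 * ‖pos (D.g i t (x ω))‖ ^ 2 + ‖x ω - c‖ ^ 2
      - 2 * (1 / (μ * t)) * inner ℝ (direction D a t i (x ω) (u t i ω)) (x ω - c)) ∂P :=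
        integral_mono (h.integrable_z_sub_sq hu (by omega) i c) (hi3.sub (hi1.const_mul _)) hpt
    _ = ∫ ω, (2 * p ^ 2 * G₁ ^ 2 * (1 / (μ * t)) ^ 2
      + γ₀ / 2 * ‖pos (D.g i t (x ω))‖ ^ 2 + ‖x ω - c‖ ^ 2
      - 2 * (1 / (μ * t)) * ∫ v, inner ℝ (direction D a t i (x ω) v) (x ω - c)
        ∂(uniformSphere p)) ∂P := by
        rw [integral_sub hi3 (hi1.const_mul _), integral_sub hi3 (hi2.const_mul _),
          integral_const_mul, integral_const_mul, heq]
    _ ≤ ∫ ω, (stepBound D μ γ₀ s t i y (x ω)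
          + stepConst p r R G₁ G₂ γ₀ * (1 / (μ * t)) ^ 2) ∂P :=
        integral_mono (hi3.sub (hi2.const_mul _)) (hi4.add (integrable_const _)) fun ω =>
          h.le_integral_inner_direction i ht (h.decisions_mem ω ht i) hy hs hys
    _ = _ := by
        rw [integral_add hi4 (integrable_const _), integral_const, probReal_univ, one_smul]

end AlgorithmSetting

/-- Expected squared distance of the decisions to the shrunk comparator. -/
noncomputable def lyapunov (D : Problem n p) (N : Network n) (μ γ₀ r : ℝ) (z₁ : Fin n → Vec p)
    (P : Measure Ω) (u : ℕ → Fin n → Ω → Metric.sphere (0 : Vec p) 1) (y : Vec p) (t : ℕ) : ℝ :=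
  ∑ i, ∫ ω, ‖decisions D N (stronglyConvexParams μ γ₀ r) z₁ u ω t i
    - (1 - 1 / (μ * t)) • y‖ ^ 2 ∂P

/-- Expected total local loss gap to a comparator at one time. -/
noncomputable def lossGap (D : Problem n p) (N : Network n) (μ γ₀ r : ℝ) (z₁ : Fin n → Vec p)
    (P : Measure Ω) (u : ℕ → Fin n → Ω → Metric.sphere (0 : Vec p) 1) (y : Vec p) (t : ℕ) : ℝ :=
  ∑ i, ∫ ω, (D.f i t (decisions D N (stronglyConvexParams μ γ₀ r) z₁ u ω t i) - D.f i t y) ∂P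

/-- Moments of the local constraint violations at one time. -/
noncomputable def violationMoment (D : Problem n p) (N : Network n) (μ γ₀ r : ℝ)
    (z₁ : Fin n → Vec p) (P : Measure Ω) (u : ℕ → Fin n → Ω → Metric.sphere (0 : Vec p) 1)
    (k t : ℕ) : ℝ :=
  ∑ i, ∫ ω, ‖pos (D.g i t (decisions D N (stronglyConvexParams μ γ₀ r) z₁ u ω t i))‖ ^ k ∂P

namespace AlgorithmSetting

/-- Double stochasticity keeps mixing from increasing the total squared distance. Rescaling the
comparator from time `t` to `t + 1` moves it by at most `R (α_t - α_{t+1})`, which changes each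
squared distance by at most `4R` times that. -/
theorem lyapunov_succ_le (h : AlgorithmSetting D N r R F G₁ G₂ μ γ₀ w B z₁)
    (hu : UniformDirections P u) {t : ℕ} (ht : 1 ≤ t) {y : Vec p} (hy : y ∈ D.X)
    {s : ℝ} (hs : 0 ≤ s) (hys : ∀ i k, D.g i t y k ≤ -s) :
    lyapunov D N μ γ₀ r z₁ P u y (t + 1)
      ≤ (1 - 1 / t) * lyapunov D N μ γ₀ r z₁ P u y t
        - 2 * (1 / (μ * t)) * lossGap D N μ γ₀ r z₁ P u y t
        - γ₀ * violationMoment D N μ γ₀ r z₁ P u 2 t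
        - 2 * γ₀ * s * violationMoment D N μ γ₀ r z₁ P u 1 t
        + n * stepConst p r R G₁ G₂ γ₀ * (1 / (μ * t)) ^ 2
        + n * (4 * R ^ 2) * (1 / (μ * t) - 1 / (μ * (t + 1 : ℕ))) := by
  have hD := h.standing.set
  have hC := h.standing.convex
  set a := stronglyConvexParams μ γ₀ r with ha
  set z := fun ω => zSeq D N a z₁ (fun t i => (u t i ω : Vec p)) (t + 1) with hz
  set c := (1 - 1 / (μ * t)) • y with hc
  set c' := (1 - 1 / (μ * (t + 1 : ℕ))) • y with hc'
  have hcX : c ∈ D.X := shrunk_subset hD h.r_pos h.one_le_μ ht (Set.smul_mem_smul_set hy)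
  have hcX' : c' ∈ D.X :=
    shrunk_subset hD h.r_pos h.one_le_μ (by omega) (Set.smul_mem_smul_set hy)
  have hstep := stepsize_succ_le h.one_le_μ ht
  have hcc : ‖c - c'‖ ≤ (1 / (μ * t) - 1 / (μ * (t + 1 : ℕ))) * R := by
    have : c - c' = (-(1 / (μ * t) - 1 / (μ * (t + 1 : ℕ)))) • y := by rw [hc, hc']; module
    rw [this, norm_smul, norm_neg, Real.norm_eq_abs, abs_of_nonneg (by linarith)]
    exact mul_le_mul_of_nonneg_left (hD.norm_le hy) (by linarith)
  have hiz : ∀ i c, Integrable (fun ω => ‖z ω i - c‖ ^ 2) P := fun i c =>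
    h.integrable_z_sub_sq hu (by omega) i c
  have hix : ∀ i, Integrable (fun ω => ‖decisions D N a z₁ u ω (t + 1) i - c'‖ ^ 2) P :=
    fun i => h.integrable_decisions hu (φ := fun v => ‖v - c'‖ ^ 2) (by fun_prop) (by omega) i
  have h1 : lyapunov D N μ γ₀ r z₁ P u y (t + 1) ≤ ∑ i, ∫ ω, ‖z ω i - c'‖ ^ 2 ∂P := by
    unfold lyapunov
    rw [← integral_finsetSum _ fun i _ => hix i, ← integral_finsetSum _ fun i _ => hiz i c']
    exact integral_mono (integrable_finsetSum _ fun i _ => hix i)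
      (integrable_finsetSum _ fun i _ => hiz i c')
      fun ω => sum_norm_mix_sub_sq_le h.standing.mixing h.w_pos (by omega) (z ω) c'
  have h2 : ∀ i, ∫ ω, ‖z ω i - c'‖ ^ 2 ∂P ≤ ∫ ω, ‖z ω i - c‖ ^ 2 ∂P
      + 4 * R ^ 2 * (1 / (μ * t) - 1 / (μ * (t + 1 : ℕ))) := by
    intro i
    calc ∫ ω, ‖z ω i - c'‖ ^ 2 ∂P ≤ ∫ ω, (‖z ω i - c‖ ^ 2
          + 4 * R ^ 2 * (1 / (μ * t) - 1 / (μ * (t + 1 : ℕ)))) ∂P := by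
          refine integral_mono (hiz i c') ((hiz i c).add (integrable_const _)) fun ω => ?_
          have hzn := hD.norm_le (h.z_mem_X (fun t i => (u t i ω : Vec p))
            (show 1 ≤ t + 1 by omega) i)
          have hcn := hD.norm_le hcX
          have hcn' := hD.norm_le hcX'
          have h3 := norm_sub_le (z ω i) c
          have h4 := norm_sub_le (z ω i) c'
          have h5 := norm_sub_sq_le_add (a := z ω i) (b := c) (c := c') (ρ := 4 * R)
            (by linarith)
          have h6 := mul_le_mul_of_nonneg_left hcc (by linarith [h.R_pos] : 0 ≤ 4 * R)
          dsimp only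
          linarith
      _ = _ := by rw [integral_add (hiz i c) (integrable_const _)]; simp
  have h3 : ∀ i, ∫ ω, stepBound D μ γ₀ s t i y (decisions D N a z₁ u ω t i) ∂P
      = (1 - 1 / t) * ∫ ω, ‖decisions D N a z₁ u ω t i - c‖ ^ 2 ∂P
        - 2 * (1 / (μ * t)) * ∫ ω, (D.f i t (decisions D N a z₁ u ω t i) - D.f i t y) ∂P
        - γ₀ * ∫ ω, ‖pos (D.g i t (decisions D N a z₁ u ω t i))‖ ^ 2 ∂P
        - 2 * γ₀ * s * ∫ ω, ‖pos (D.g i t (decisions D N a z₁ u ω t i))‖ ^ 1 ∂P := by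
    intro i
    have hv := continuousOn_violation hC i ht
    have hl := hC.continuousOn_loss i ht
    have i1 := h.integrable_decisions hu (φ := fun v => ‖v - c‖ ^ 2) (by fun_prop) ht i
    have i2 := h.integrable_decisions hu (φ := fun v => D.f i t v - D.f i t y) (by fun_prop) ht i
    have i3 := h.integrable_decisions hu (φ := fun v => ‖pos (D.g i t v)‖ ^ 2) (by fun_prop) ht i
    have i4 := h.integrable_decisions hu (φ := fun v => ‖pos (D.g i t v)‖) (by fun_prop) ht i
    simp_rw [pow_one]
    exact integral_const_mul_sub₄ i1 i2 i3 i4 _ _ _ _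
  have h4 : ∑ i, ∫ ω, ‖z ω i - c'‖ ^ 2 ∂P ≤ ∑ i,
      ((1 - 1 / t) * ∫ ω, ‖decisions D N a z₁ u ω t i - c‖ ^ 2 ∂P
        - 2 * (1 / (μ * t)) * ∫ ω, (D.f i t (decisions D N a z₁ u ω t i) - D.f i t y) ∂P
        - γ₀ * ∫ ω, ‖pos (D.g i t (decisions D N a z₁ u ω t i))‖ ^ 2 ∂P
        - 2 * γ₀ * s * ∫ ω, ‖pos (D.g i t (decisions D N a z₁ u ω t i))‖ ^ 1 ∂P
        + stepConst p r R G₁ G₂ γ₀ * (1 / (μ * t)) ^ 2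
        + 4 * R ^ 2 * (1 / (μ * t) - 1 / (μ * (t + 1 : ℕ)))) := by
    refine Finset.sum_le_sum fun i _ => ?_
    rw [← h3 i]
    have := h.integral_z_succ_sub_sq_le hu ht i hy hs (hys i)
    linarith [h2 i]
  refine (h1.trans h4).trans (le_of_eq ?_)
  simp only [Finset.sum_add_distrib, Finset.sum_sub_distrib, ← Finset.mul_sum, Finset.sum_const,
    Finset.card_univ, Fintype.card_fin, nsmul_eq_mul]
  unfold lyapunov lossGap violationMoment
  ring

end AlgorithmSetting

end Expectation

/-! ### Harmonic sums. -/

/-- The harmonic sum `∑_{t=1}^T 1/t`. -/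
noncomputable def harmonicSum (T : ℕ) : ℝ := ∑ t ∈ Finset.Icc 1 T, 1 / (t : ℝ)

theorem sum_Icc_one_eq_sum_range (φ : ℕ → ℝ) (T : ℕ) :
    ∑ t ∈ Finset.Icc 1 T, φ t = ∑ t ∈ Finset.range T, φ (t + 1) := by
  induction T with
  | zero => simp
  | succ T ih => rw [Finset.sum_Icc_succ_top (by omega), Finset.sum_range_succ, ih]

theorem one_le_harmonicSum {T : ℕ} (hT : 1 ≤ T) : 1 ≤ harmonicSum T := by
  have := Finset.single_le_sum (f := fun t : ℕ => 1 / (t : ℝ)) (s := Finset.Icc 1 T)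
    (fun t _ => by positivity) (Finset.mem_Icc.2 ⟨le_rfl, hT⟩)
  simpa [harmonicSum] using this

theorem harmonicSum_le (T : ℕ) : harmonicSum T ≤ T := by
  calc harmonicSum T ≤ ∑ t ∈ Finset.Icc 1 T, (1 : ℝ) := by
        refine Finset.sum_le_sum fun t ht => ?_
        have : (1 : ℝ) ≤ t := by exact_mod_cast (Finset.mem_Icc.1 ht).1
        exact (div_le_one (by linarith)).2 this
    _ = T := by simp

/-- The sum is at most `1 + log T`, and `1 ≤ 2 log T` because `log 2 > 1/2`. -/
theorem harmonicSum_le_three_mul_log {T : ℕ} (hT : 2 ≤ T) :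
    harmonicSum T ≤ 3 * Real.log T := by
  have h1 : harmonicSum T = (harmonic T : ℝ) := by
    rw [harmonicSum, sum_Icc_one_eq_sum_range]
    simp [harmonic]
  have h2 := harmonic_le_one_add_log T
  have h3 : Real.log 2 ≤ Real.log T := Real.log_le_log (by norm_num) (by exact_mod_cast hT)
  have h4 := Real.log_two_gt_d9
  rw [h1]
  linarith

/-! ### From disagreement to network regret and network violation. -/

section Sums

variable {n p : ℕ} {D : Problem n p} {N : Network n} {r R F G₁ G₂ μ γ₀ w : ℝ} {B : ℕ}
  {z₁ : Fin n → Vec p} {Ω : Type*}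
  {u : ℕ → Fin n → Ω → Metric.sphere (0 : Vec p) 1}

/-- The constant bounding the accumulated disagreement. -/
noncomputable def consensusConst (n p : ℕ) (R G₁ G₂ γ₀ w : ℝ) (B : ℕ) : ℝ :=
  (n * B : ℕ) / w ^ (n * B) * (2 * R + 2 * (p * G₁) + 2 * (p * γ₀ * G₂))

namespace AlgorithmSetting

theorem consensusConst_nonneg (h : AlgorithmSetting D N r R F G₁ G₂ μ γ₀ w B z₁) :
    0 ≤ consensusConst n p R G₁ G₂ γ₀ w B := by
  have := h.R_pos
  have := h.G₁_nonneg
  have := h.G₂_nonneg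
  have := h.γ₀_pos
  have := h.w_pos
  unfold consensusConst
  positivity

/-- The decision already lies in the next shrunk set, so projecting moves the iterate no further
from it than the raw step does. -/
theorem norm_z_succ_sub_le (h : AlgorithmSetting D N r R F G₁ G₂ μ γ₀ w B z₁) (ω : Ω) {t : ℕ}
    (ht : 1 ≤ t) (i : Fin n) :
    ‖zSeq D N (stronglyConvexParams μ γ₀ r) z₁ (fun t i => (u t i ω : Vec p)) (t + 1) i
        - decisions D N (stronglyConvexParams μ γ₀ r) z₁ u ω t i‖
      ≤ p * G₁ * (1 / t) + p * γ₀ * G₂ *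
        ‖pos (D.g i t (decisions D N (stronglyConvexParams μ γ₀ r) z₁ u ω t i))‖ := by
  have hD := h.standing.set
  have hμ := h.one_le_μ
  have ht0 : (0 : ℝ) < t := by exact_mod_cast ht
  have hα := stepsize_pos hμ ht
  set a := stronglyConvexParams μ γ₀ r with ha
  set x := decisions D N a z₁ u ω t i with hx
  have hxK : x ∈ (1 - 1 / (μ * t)) • D.X := h.decisions_mem ω ht i
  have h1 : ‖zSeq D N a z₁ (fun t i => (u t i ω : Vec p)) (t + 1) i - x‖
      ≤ ‖x - a.α t • direction D a t i x (u t i ω) - x‖ := by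
    rw [zSeq_succ a z₁ _ ht]
    exact norm_proj_sub_le (hD.convex.smul _) (hD.isClosed_smul _) _
      (shrunk_subset_succ hD h.r_pos hμ ht hxK)
  have h2 : ‖x - a.α t • direction D a t i x (u t i ω) - x‖
      = 1 / (μ * t) * ‖direction D a t i x (u t i ω)‖ := by
    rw [sub_sub_cancel_left, norm_neg, norm_smul, Real.norm_eq_abs]
    exact congrArg (· * _) (abs_of_pos hα)
  have h3 := mul_le_mul_of_nonneg_left (norm_direction_le hD h.standing.convex h.r_pos hμ
    h.γ₀_pos ht i hxK (norm_eq_of_mem_sphere (u t i ω))) hα.le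
  have hG₁ := h.G₁_nonneg
  have h4 : 1 / (μ * t) ≤ 1 / (t : ℝ) := by
    refine one_div_le_one_div_of_le ht0 ?_
    nlinarith
  have h5 : p * G₁ * (1 / (μ * t)) ≤ p * G₁ * (1 / (t : ℝ)) := by gcongr
  have h6 : 1 / (μ * t) * (p * (G₁ + γ₀ * (μ * t) * ‖pos (D.g i t x)‖ * G₂))
      = p * G₁ * (1 / (μ * t)) + p * γ₀ * G₂ * ‖pos (D.g i t x)‖ := by
    have : μ ≠ 0 := by linarith
    field_simp
  rw [h2] at h1
  linarith

/-- Accumulated disagreement of the decisions, along a fixed realization. -/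
theorem sum_disagreement_le (h : AlgorithmSetting D N r R F G₁ G₂ μ γ₀ w B z₁) (ω : Ω) {T : ℕ}
    (hT : 1 ≤ T) :
    ∑ t ∈ Finset.Icc 1 T, disagreement (decisions D N (stronglyConvexParams μ γ₀ r) z₁ u ω t)
      ≤ consensusConst n p R G₁ G₂ γ₀ w B * (harmonicSum T + ∑ t ∈ Finset.Icc 1 T, ∑ i,
        ‖pos (D.g i t (decisions D N (stronglyConvexParams μ γ₀ r) z₁ u ω t i))‖) := by
  have hR := h.R_pos
  have hG₁ := h.G₁_nonneg
  have hG₂ := h.G₂_nonneg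
  have hγ := h.γ₀_pos
  have hw := h.w_pos
  set a := stronglyConvexParams μ γ₀ r with ha
  set x := decisions D N a z₁ u ω with hx
  set A : ℕ → ℝ := fun t => ∑ i, ‖pos (D.g i t (x t i))‖ with hA
  have hA0 : ∀ t, 0 ≤ A t := fun t => Finset.sum_nonneg fun i _ => norm_nonneg _
  set ε : ℕ → ℝ := fun t => p * G₁ * (1 / t) + p * γ₀ * G₂ * A t with hε
  have hε0 : ∀ t, 0 ≤ ε t := fun t => by
    have := hA0 t
    simp only [hε]; positivity
  have hrec : ∀ t, 1 ≤ t → ∃ z : Fin n → Vec p, (∀ i, ‖z i - x t i‖ ≤ ε t) ∧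
      ∀ i, x (t + 1) i = ∑ j, N.W (t + 1) i j • z j := fun t ht => by
    refine ⟨zSeq D N a z₁ (fun t i => (u t i ω : Vec p)) (t + 1), fun i => ?_, fun i => rfl⟩
    have h1 : ‖pos (D.g i t (x t i))‖ ≤ A t :=
      Finset.single_le_sum (f := fun i => ‖pos (D.g i t (x t i))‖)
        (fun i _ => norm_nonneg _) (Finset.mem_univ i)
    refine (h.norm_z_succ_sub_le ω ht i).trans ?_
    simp only [hε]
    gcongr
  have hM : ∀ t, disagreement (x (t + 1)) ≤ 2 * R := fun t =>
    disagreement_le (by linarith) fun i j => by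
      have h1 := h.standing.set.norm_le (h.decisions_mem_X (u := u) ω
        (show 1 ≤ t + 1 by omega) i)
      have h2 := h.standing.set.norm_le (h.decisions_mem_X (u := u) ω
        (show 1 ≤ t + 1 by omega) j)
      exact (norm_sub_le _ _).trans (by linarith)
  -- The sequences are shifted by one because the recursion starts at time `1`.
  have hsum := sum_range_le_of_contraction (a := fun t => disagreement (x (t + 1)))
    (e := fun t => ε (t + 1)) (L := n * B) (η := w ^ (n * B)) (M := 2 * R) (by positivity)
    (pow_le_one₀ hw.le h.w_lt.le) (fun t => disagreement_nonneg _) hM (fun t => hε0 _)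
    (fun t => by
      have := disagreement_contraction h.standing.mixing hw h.w_lt.le hε0 hrec
        (show 1 ≤ t + 1 by omega)
      simpa only [add_right_comm] using this) T
  rw [← sum_Icc_one_eq_sum_range (fun t => disagreement (x t)),
    ← sum_Icc_one_eq_sum_range ε] at hsum
  have hεsum : ∑ t ∈ Finset.Icc 1 T, ε t
      = p * G₁ * harmonicSum T + p * γ₀ * G₂ * ∑ t ∈ Finset.Icc 1 T, A t := by
    simp only [hε, Finset.sum_add_distrib, ← Finset.mul_sum, harmonicSum]
  rw [hεsum] at hsum
  refine hsum.trans ?_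
  unfold consensusConst
  rw [mul_assoc (((n * B : ℕ) : ℝ) / w ^ (n * B))]
  refine mul_le_mul_of_nonneg_left ?_ (by positivity)
  have hH := one_le_harmonicSum hT
  have hS : 0 ≤ ∑ t ∈ Finset.Icc 1 T, A t := Finset.sum_nonneg fun t _ => hA0 t
  -- The initial disagreement `2 * R` is absorbed through `1 ≤ harmonicSum T`.
  have e1 : 0 ≤ 2 * R * (harmonicSum T - 1) := mul_nonneg (by linarith) (by linarith)
  have e2 : 0 ≤ (2 * R + 2 * (p * G₁)) * ∑ t ∈ Finset.Icc 1 T, A t := by positivity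
  have e3 : 0 ≤ 2 * (p * γ₀ * G₂) * harmonicSum T := by positivity
  linarith

/-- Agent `i` is judged by every agent's constraint, whereas agent `j` controls only its own at its
own decision; the exchange costs `G₂` times the disagreement for each `j`. -/
theorem netCCV_le (h : AlgorithmSetting D N r R F G₁ G₂ μ γ₀ w B z₁) (ω : Ω) {T : ℕ}
    (hT : 1 ≤ T) :
    D.netCCV T (decisions D N (stronglyConvexParams μ γ₀ r) z₁ u ω)
      ≤ (1 + n * G₂ * consensusConst n p R G₁ G₂ γ₀ w B)
        * (harmonicSum T + ∑ t ∈ Finset.Icc 1 T, ∑ i,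
        ‖pos (D.g i t (decisions D N (stronglyConvexParams μ γ₀ r) z₁ u ω t i))‖) := by
  have hsum := h.sum_disagreement_le (u := u) ω hT
  have hG₂ := h.G₂_nonneg
  set x := decisions D N (stronglyConvexParams μ γ₀ r) z₁ u ω with hx
  have hn : (0 : ℝ) < n := by exact_mod_cast h.n_pos
  have hpt : ∀ i, ∀ t ∈ Finset.Icc 1 T, ‖pos (D.globalConstr t (x t i))‖
      ≤ ∑ j, ‖pos (D.g j t (x t j))‖ + n * G₂ * disagreement (x t) := by
    intro i t ht
    have ht1 := (Finset.mem_Icc.1 ht).1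
    calc ‖pos (D.globalConstr t (x t i))‖ ≤ ∑ j, ‖pos (D.g j t (x t i))‖ :=
          norm_pos_globalConstr_le t _
      _ ≤ ∑ j, (‖pos (D.g j t (x t j))‖ + G₂ * disagreement (x t)) := by
          refine Finset.sum_le_sum fun j _ => ?_
          refine (h.standing.convex.norm_pos_constr_le j ht1 (h.decisions_mem_X (u := u) ω ht1 i)
            (h.decisions_mem_X (u := u) ω ht1 j) hG₂).trans ?_
          gcongr
          exact norm_sub_le_disagreement (x t) i j
      _ = _ := by rw [Finset.sum_add_distrib]; simp [mul_assoc]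
  have h1 : D.netCCV T x ≤ (1 / (n : ℝ)) * ∑ i : Fin n, ∑ t ∈ Finset.Icc 1 T,
      (∑ j, ‖pos (D.g j t (x t j))‖ + n * G₂ * disagreement (x t)) := by
    unfold Problem.netCCV
    gcongr with i _ t ht
    exact hpt i t ht
  rw [Finset.sum_const, Finset.card_univ, Fintype.card_fin, nsmul_eq_mul, ← mul_assoc,
    one_div_mul_cancel hn.ne', one_mul, Finset.sum_add_distrib, ← Finset.mul_sum] at h1
  have h2 := mul_le_mul_of_nonneg_left hsum (by positivity : 0 ≤ n * G₂)
  have h3 : 0 ≤ harmonicSum T := by linarith [one_le_harmonicSum hT]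
  linarith

/-- The recursion sees each local loss at its own agent's decision; evaluating it at another agent's
decision costs `G₁` times the disagreement. -/
theorem sum_globalLoss_sub_le (h : AlgorithmSetting D N r R F G₁ G₂ μ γ₀ w B z₁) (ω : Ω)
    {T : ℕ} (hT : 1 ≤ T) (y : Vec p) :
    (1 / (n : ℝ)) * ∑ i, ∑ t ∈ Finset.Icc 1 T,
        D.globalLoss t (decisions D N (stronglyConvexParams μ γ₀ r) z₁ u ω t i)
      - ∑ t ∈ Finset.Icc 1 T, D.globalLoss t y
      ≤ (1 / (n : ℝ)) * ∑ t ∈ Finset.Icc 1 T, ∑ i,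
          (D.f i t (decisions D N (stronglyConvexParams μ γ₀ r) z₁ u ω t i) - D.f i t y)
        + G₁ * (consensusConst n p R G₁ G₂ γ₀ w B
          * (harmonicSum T + ∑ t ∈ Finset.Icc 1 T, ∑ i,
          ‖pos (D.g i t (decisions D N (stronglyConvexParams μ γ₀ r) z₁ u ω t i))‖)) := by
  have hsum := h.sum_disagreement_le (u := u) ω hT
  have hG₁ := h.G₁_nonneg
  set x := decisions D N (stronglyConvexParams μ γ₀ r) z₁ u ω with hx
  have hn : (0 : ℝ) < n := by exact_mod_cast h.n_pos
  have hpt : ∀ i, ∀ t ∈ Finset.Icc 1 T, D.globalLoss t (x t i)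
      ≤ (1 / (n : ℝ)) * ∑ j, D.f j t (x t j) + G₁ * disagreement (x t) := by
    intro i t ht
    have ht1 := (Finset.mem_Icc.1 ht).1
    have : ∑ j, D.f j t (x t i) ≤ ∑ j, (D.f j t (x t j) + G₁ * disagreement (x t)) := by
      refine Finset.sum_le_sum fun j _ => ?_
      have h1 := (abs_le.1 (h.standing.convex.abs_loss_sub_le j ht1
        (h.decisions_mem_X (u := u) ω ht1 i) (h.decisions_mem_X (u := u) ω ht1 j))).2
      have h2 := mul_le_mul_of_nonneg_left (norm_sub_le_disagreement (x t) i j) hG₁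
      linarith
    rw [Finset.sum_add_distrib, Finset.sum_const, Finset.card_univ, Fintype.card_fin,
      nsmul_eq_mul] at this
    have h3 := mul_le_mul_of_nonneg_left this (by positivity : 0 ≤ 1 / (n : ℝ))
    rw [mul_add, ← mul_assoc (1 / (n : ℝ)) (n : ℝ), one_div_mul_cancel hn.ne', one_mul] at h3
    exact h3
  have h1 : (1 / (n : ℝ)) * ∑ i, ∑ t ∈ Finset.Icc 1 T, D.globalLoss t (x t i)
      ≤ (1 / (n : ℝ)) * ∑ i : Fin n, ∑ t ∈ Finset.Icc 1 T,
      ((1 / (n : ℝ)) * ∑ j, D.f j t (x t j) + G₁ * disagreement (x t)) := by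
    gcongr with i _ t ht
    exact hpt i t ht
  rw [Finset.sum_const, Finset.card_univ, Fintype.card_fin, nsmul_eq_mul, ← mul_assoc,
    one_div_mul_cancel hn.ne', one_mul, Finset.sum_add_distrib, ← Finset.mul_sum,
    ← Finset.mul_sum] at h1
  have h2 := mul_le_mul_of_nonneg_left hsum hG₁
  have h3 : ∑ t ∈ Finset.Icc 1 T, D.globalLoss t y
      = (1 / (n : ℝ)) * ∑ t ∈ Finset.Icc 1 T, ∑ i, D.f i t y := by
    simp only [Problem.globalLoss, ← Finset.mul_sum]
  simp only [Finset.sum_sub_distrib]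
  rw [h3]
  linarith

variable [MeasurableSpace Ω] {P : Measure Ω} [IsProbabilityMeasure P]

theorem integral_sum_decisions (h : AlgorithmSetting D N r R F G₁ G₂ μ γ₀ w B z₁)
    (hu : UniformDirections P u) {T : ℕ} {ψ : Fin n → ℕ → Vec p → ℝ}
    (hψ : ∀ i, ∀ t, 1 ≤ t → ContinuousOn (ψ i t) D.X) :
    Integrable (fun ω => ∑ t ∈ Finset.Icc 1 T, ∑ i,
      ψ i t (decisions D N (stronglyConvexParams μ γ₀ r) z₁ u ω t i)) P ∧
    ∫ ω, ∑ t ∈ Finset.Icc 1 T, ∑ i,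
      ψ i t (decisions D N (stronglyConvexParams μ γ₀ r) z₁ u ω t i) ∂P
      = ∑ t ∈ Finset.Icc 1 T, ∑ i,
        ∫ ω, ψ i t (decisions D N (stronglyConvexParams μ γ₀ r) z₁ u ω t i) ∂P := by
  have hi : ∀ t ∈ Finset.Icc 1 T, ∀ i, Integrable (fun ω =>
      ψ i t (decisions D N (stronglyConvexParams μ γ₀ r) z₁ u ω t i)) P := fun t ht i =>
    h.integrable_decisions hu (hψ i t (Finset.mem_Icc.1 ht).1) (Finset.mem_Icc.1 ht).1 i
  have hi' : ∀ t ∈ Finset.Icc 1 T, Integrable (fun ω => ∑ i,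
      ψ i t (decisions D N (stronglyConvexParams μ γ₀ r) z₁ u ω t i)) P := fun t ht =>
    integrable_finsetSum _ fun i _ => hi t ht i
  refine ⟨integrable_finsetSum _ hi', ?_⟩
  rw [integral_finsetSum _ hi']
  exact Finset.sum_congr rfl fun t ht => integral_finsetSum _ fun i _ => hi t ht i

theorem continuousOn_globalLoss (h : AlgorithmSetting D N r R F G₁ G₂ μ γ₀ w B z₁) {t : ℕ}
    (ht : 1 ≤ t) : ContinuousOn (D.globalLoss t) D.X := by
  have := fun j => h.standing.convex.continuousOn_loss j ht
  unfold Problem.globalLoss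
  fun_prop

theorem continuousOn_globalViolation (h : AlgorithmSetting D N r R F G₁ G₂ μ γ₀ w B z₁) {t : ℕ}
    (ht : 1 ≤ t) : ContinuousOn (fun x => ‖pos (D.globalConstr t x)‖) D.X := by
  have h1 : ContinuousOn (fun x => (D.globalConstr t x).ofLp) D.X :=
    continuousOn_pi.2 fun k => by
      have := h.standing.convex.continuousOn_constr k.1 ht
      exact (PiLp.continuous_apply 2 _ k.2).comp_continuousOn this
  exact (continuous_pos.comp_continuousOn
    ((PiLp.continuous_toLp 2 _).comp_continuousOn h1)).norm

theorem integrable_sum_globalLoss (h : AlgorithmSetting D N r R F G₁ G₂ μ γ₀ w B z₁)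
    (hu : UniformDirections P u) (T : ℕ) :
    Integrable (fun ω => (1 / (n : ℝ)) * ∑ i, ∑ t ∈ Finset.Icc 1 T,
      D.globalLoss t (decisions D N (stronglyConvexParams μ γ₀ r) z₁ u ω t i)) P := by
  refine Integrable.const_mul ?_ _
  simp_rw [Finset.sum_comm (s := Finset.univ)]
  exact (h.integral_sum_decisions hu (ψ := fun _ t => D.globalLoss t)
    fun _ t ht => h.continuousOn_globalLoss ht).1

theorem netReg_eq (h : AlgorithmSetting D N r R F G₁ G₂ μ γ₀ w B z₁) (T : ℕ)
    (x : ℕ → Fin n → Vec p) :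
    D.netReg T x = (1 / (n : ℝ)) * ∑ i, ∑ t ∈ Finset.Icc 1 T, D.globalLoss t (x t i)
      - ⨅ y : D.feasible T, ∑ t ∈ Finset.Icc 1 T, D.globalLoss t y := by
  have hn : (n : ℝ) ≠ 0 := by exact_mod_cast h.n_pos.ne'
  rw [Problem.netReg, Finset.sum_sub_distrib, Finset.sum_const, Finset.card_univ,
    Fintype.card_fin, nsmul_eq_mul, mul_sub, ← mul_assoc (1 / (n : ℝ)) (n : ℝ),
    one_div_mul_cancel hn, one_mul]

theorem integrable_netReg (h : AlgorithmSetting D N r R F G₁ G₂ μ γ₀ w B z₁)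
    (hu : UniformDirections P u) (T : ℕ) :
    Integrable (fun ω => D.netReg T (decisions D N (stronglyConvexParams μ γ₀ r) z₁ u ω)) P := by
  simp_rw [h.netReg_eq]
  exact (h.integrable_sum_globalLoss hu T).sub (integrable_const _)

theorem integrable_netCCV (h : AlgorithmSetting D N r R F G₁ G₂ μ γ₀ w B z₁)
    (hu : UniformDirections P u) (T : ℕ) :
    Integrable (fun ω => D.netCCV T (decisions D N (stronglyConvexParams μ γ₀ r) z₁ u ω)) P := by
  unfold Problem.netCCV
  refine Integrable.const_mul ?_ _
  simp_rw [Finset.sum_comm (s := Finset.univ)]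
  exact (h.integral_sum_decisions hu (ψ := fun _ t v => ‖pos (D.globalConstr t v)‖)
    fun _ t ht => h.continuousOn_globalViolation ht).1

theorem integral_sum_violation (h : AlgorithmSetting D N r R F G₁ G₂ μ γ₀ w B z₁)
    (hu : UniformDirections P u) (T : ℕ) :
    Integrable (fun ω => ∑ t ∈ Finset.Icc 1 T, ∑ i,
      ‖pos (D.g i t (decisions D N (stronglyConvexParams μ γ₀ r) z₁ u ω t i))‖) P ∧
    ∫ ω, ∑ t ∈ Finset.Icc 1 T, ∑ i,
      ‖pos (D.g i t (decisions D N (stronglyConvexParams μ γ₀ r) z₁ u ω t i))‖ ∂P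
      = ∑ t ∈ Finset.Icc 1 T, violationMoment D N μ γ₀ r z₁ P u 1 t := by
  unfold violationMoment
  simp_rw [pow_one]
  exact h.integral_sum_decisions hu (ψ := fun i t v => ‖pos (D.g i t v)‖)
    fun i t ht => continuousOn_violation h.standing.convex i ht

theorem integral_netCCV_le (h : AlgorithmSetting D N r R F G₁ G₂ μ γ₀ w B z₁)
    (hu : UniformDirections P u) {T : ℕ} (hT : 1 ≤ T) :
    ∫ ω, D.netCCV T (decisions D N (stronglyConvexParams μ γ₀ r) z₁ u ω) ∂P
      ≤ (1 + n * G₂ * consensusConst n p R G₁ G₂ γ₀ w B)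
        * (harmonicSum T + ∑ t ∈ Finset.Icc 1 T, violationMoment D N μ γ₀ r z₁ P u 1 t) := by
  obtain ⟨hi, he⟩ := h.integral_sum_violation hu T
  calc _ ≤ ∫ ω, (1 + n * G₂ * consensusConst n p R G₁ G₂ γ₀ w B)
        * (harmonicSum T + ∑ t ∈ Finset.Icc 1 T, ∑ i,
        ‖pos (D.g i t (decisions D N (stronglyConvexParams μ γ₀ r) z₁ u ω t i))‖) ∂P :=
        integral_mono (h.integrable_netCCV hu T) (((integrable_const _).add hi).const_mul _)
          fun ω => h.netCCV_le ω hT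
    _ = _ := by
        rw [integral_const_mul, integral_add (integrable_const _) hi, he, integral_const,
          probReal_univ, one_smul]

/-- The benchmark is a deterministic infimum, so a bound against every single feasible comparator
suffices. -/
theorem integral_netReg_le (h : AlgorithmSetting D N r R F G₁ G₂ μ γ₀ w B z₁)
    (hu : UniformDirections P u) {T : ℕ} (hT : 1 ≤ T) {c : ℝ}
    (hc : ∀ y ∈ D.feasible T,
      (1 / (n : ℝ)) * ∑ t ∈ Finset.Icc 1 T, lossGap D N μ γ₀ r z₁ P u y t
        + G₁ * (consensusConst n p R G₁ G₂ γ₀ w B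
          * (harmonicSum T + ∑ t ∈ Finset.Icc 1 T, violationMoment D N μ γ₀ r z₁ P u 1 t)) ≤ c) :
    ∫ ω, D.netReg T (decisions D N (stronglyConvexParams μ γ₀ r) z₁ u ω) ∂P ≤ c := by
  have hS := h.integrable_sum_globalLoss hu T
  simp_rw [h.netReg_eq]
  rw [integral_sub hS (integrable_const _), integral_const, probReal_univ, one_smul]
  have : Nonempty (D.feasible T) := (h.standing.feasible T hT).to_subtype
  rw [sub_le_comm]
  refine le_ciInf fun y => ?_
  rw [sub_le_comm]
  refine le_trans ?_ (hc y y.2)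
  obtain ⟨hi, he⟩ := h.integral_sum_violation hu T
  obtain ⟨hi', he'⟩ := h.integral_sum_decisions hu (T := T)
    (ψ := fun i t v => D.f i t v - D.f i t y)
    fun i t ht => (h.standing.convex.continuousOn_loss i ht).sub continuousOn_const
  have hS' := hS.sub (integrable_const (∑ t ∈ Finset.Icc 1 T, D.globalLoss t y))
  have hmono := integral_mono hS'
    ((hi'.const_mul (1 / (n : ℝ))).add ((((integrable_const (harmonicSum T)).add hi).const_mul
      (consensusConst n p R G₁ G₂ γ₀ w B)).const_mul G₁))
    fun ω => h.sum_globalLoss_sub_le (u := u) ω hT y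
  rw [integral_add' (hi'.const_mul (1 / (n : ℝ)))
    ((((integrable_const (harmonicSum T)).add hi).const_mul
      (consensusConst n p R G₁ G₂ γ₀ w B)).const_mul G₁), integral_const_mul, integral_const_mul,
    integral_const_mul, integral_add' (integrable_const _) hi, he, he', integral_const,
    probReal_univ, one_smul, integral_sub' hS (integrable_const _), integral_const,
    probReal_univ, one_smul] at hmono
  exact hmono

end AlgorithmSetting

end Sums

/-! ### Summation of the recursion and the final constants. -/

section Bounds

variable {n p : ℕ} {D : Problem n p} {N : Network n} {r R F G₁ G₂ μ γ₀ w : ℝ} {B : ℕ}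
  {z₁ : Fin n → Vec p} {Ω : Type*} [MeasurableSpace Ω] {P : Measure Ω}
  {u : ℕ → Fin n → Ω → Metric.sphere (0 : Vec p) 1}

theorem lyapunov_nonneg (y : Vec p) (t : ℕ) : 0 ≤ lyapunov D N μ γ₀ r z₁ P u y t :=
  Finset.sum_nonneg fun i _ => integral_nonneg fun ω => by positivity

theorem violationMoment_nonneg (k t : ℕ) : 0 ≤ violationMoment D N μ γ₀ r z₁ P u k t :=
  Finset.sum_nonneg fun i _ => integral_nonneg fun ω => by positivity

variable [IsProbabilityMeasure P]

namespace AlgorithmSetting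

theorem lyapunov_one_le (h : AlgorithmSetting D N r R F G₁ G₂ μ γ₀ w B z₁)
    (hu : UniformDirections P u) {y : Vec p} (hy : y ∈ D.X) :
    lyapunov D N μ γ₀ r z₁ P u y 1 ≤ n * (4 * R ^ 2) := by
  have hD := h.standing.set
  have hyX : (1 - 1 / (μ * (1 : ℕ))) • y ∈ D.X :=
    shrunk_subset hD h.r_pos h.one_le_μ le_rfl (Set.smul_mem_smul_set hy)
  calc lyapunov D N μ γ₀ r z₁ P u y 1 ≤ ∑ i : Fin n, 4 * R ^ 2 := by
        refine Finset.sum_le_sum fun i _ => ?_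
        have hi := h.integrable_decisions hu
          (φ := fun v => ‖v - (1 - 1 / (μ * (1 : ℕ))) • y‖ ^ 2) (by fun_prop) le_rfl i
        refine (integral_mono hi (integrable_const (4 * R ^ 2)) fun ω => ?_).trans (by simp)
        have h1 := norm_sub_le (decisions D N (stronglyConvexParams μ γ₀ r) z₁ u ω 1 i)
          ((1 - 1 / (μ * (1 : ℕ))) • y)
        have h2 := hD.norm_le hyX
        have h3 := hD.norm_le (h.decisions_mem_X (u := u) ω le_rfl i)
        have h4 := pow_le_pow_left₀ (norm_nonneg _)
          (show _ ≤ 2 * R from h1.trans (by linarith)) 2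
        dsimp only
        linarith
    _ = _ := by simp

theorem lossGap_ge (h : AlgorithmSetting D N r R F G₁ G₂ μ γ₀ w B z₁)
    (hu : UniformDirections P u) {t : ℕ} (ht : 1 ≤ t) {y : Vec p} (hy : y ∈ D.X) :
    -(n * (2 * F)) ≤ lossGap D N μ γ₀ r z₁ P u y t := by
  calc -(n * (2 * F)) = ∑ i : Fin n, -(2 * F) := by simp
    _ ≤ lossGap D N μ γ₀ r z₁ P u y t := by
        refine Finset.sum_le_sum fun i _ => ?_
        have hi := h.integrable_decisions hu (φ := fun v => D.f i t v - D.f i t y)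
          ((h.standing.convex.continuousOn_loss i ht).sub continuousOn_const) ht i
        refine le_trans (by simp) (integral_mono (integrable_const (-(2 * F))) hi fun ω => ?_)
        have h1 := (abs_le.1 (h.standing.lossBounded i t ht _
          (h.decisions_mem_X (u := u) ω ht i))).1
        have h2 := (abs_le.1 (h.standing.lossBounded i t ht y hy)).2
        dsimp only
        linarith

/-- Weighted summation of the recursion, for a comparator that is feasible up to time `T`. -/
theorem sum_lossGap_add_le (h : AlgorithmSetting D N r R F G₁ G₂ μ γ₀ w B z₁)
    (hu : UniformDirections P u) {T : ℕ} {y : Vec p} (hy : y ∈ D.feasible T) :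
    2 / μ * ∑ t ∈ Finset.Icc 1 T, lossGap D N μ γ₀ r z₁ P u y t
        + γ₀ * ∑ t ∈ Finset.Icc 1 T, t * violationMoment D N μ γ₀ r z₁ P u 2 t
      ≤ n * (stepConst p r R G₁ G₂ γ₀ + 4 * R ^ 2) * harmonicSum T := by
  have hμ := h.one_le_μ
  have hμ0 : 0 < μ := by linarith
  have key : ∀ S ≤ T, S * lyapunov D N μ γ₀ r z₁ P u y (S + 1)
      + (2 / μ * ∑ t ∈ Finset.Icc 1 S, lossGap D N μ γ₀ r z₁ P u y t
        + γ₀ * ∑ t ∈ Finset.Icc 1 S, t * violationMoment D N μ γ₀ r z₁ P u 2 t)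
      ≤ n * (stepConst p r R G₁ G₂ γ₀ + 4 * R ^ 2) * harmonicSum S := by
    intro S
    induction S with
    | zero => simp [harmonicSum]
    | succ S ih =>
      intro hS
      have ih' := ih (by omega)
      have hstep := h.lyapunov_succ_le hu (t := S + 1) (by omega) hy.1 le_rfl (fun i k => by
        have := hy.2 (S + 1) (Finset.mem_Icc.2 ⟨by omega, hS⟩) ⟨i, k⟩
        simpa [Problem.globalConstr] using this)
      rw [harmonicSum, Finset.sum_Icc_succ_top (by omega), Finset.sum_Icc_succ_top (by omega),
        Finset.sum_Icc_succ_top (by omega), ← harmonicSum]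
      have hs0 : (0 : ℝ) < ((S + 1 : ℕ) : ℝ) := by positivity
      -- Multiplying by the time `τ` turns the contraction `1 - 1/τ` into `τ - 1`, so the Lyapunov
      -- terms telescope, and the loss gap gets the constant weight `2/μ`.
      have hm := mul_le_mul_of_nonneg_left hstep hs0.le
      set V := lyapunov D N μ γ₀ r z₁ P u y (S + 1)
      set V' := lyapunov D N μ γ₀ r z₁ P u y (S + 1 + 1)
      set l := lossGap D N μ γ₀ r z₁ P u y (S + 1)
      set m := violationMoment D N μ γ₀ r z₁ P u 2 (S + 1)
      set K := stepConst p r R G₁ G₂ γ₀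
      have hK : 0 ≤ K := h.stepConst_nonneg
      set τ : ℝ := ((S + 1 : ℕ) : ℝ) with hτ
      have hτS : τ = S + 1 := by rw [hτ]; push_cast; ring
      have e : τ * ((1 - 1 / τ) * V - 2 * (1 / (μ * τ)) * l - γ₀ * m
          - 2 * γ₀ * 0 * violationMoment D N μ γ₀ r z₁ P u 1 (S + 1)
          + n * K * (1 / (μ * τ)) ^ 2
          + n * (4 * R ^ 2) * (1 / (μ * τ) - 1 / (μ * ((S + 1 + 1 : ℕ) : ℝ))))
          = (τ - 1) * V - 2 / μ * l - γ₀ * (τ * m) + n * K * (1 / (μ ^ 2 * τ))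
          + n * (4 * R ^ 2) * (1 / μ * (1 / (τ + 1))) := by
        have : ((S + 1 + 1 : ℕ) : ℝ) = τ + 1 := by rw [hτ]; push_cast; ring
        rw [this]
        field_simp
        ring
      rw [e] at hm
      have b1 : 1 / (μ ^ 2 * τ) ≤ 1 / τ := by
        refine one_div_le_one_div_of_le hs0 ?_
        have : 1 ≤ μ ^ 2 := one_le_pow₀ hμ
        nlinarith
      have b2 : 1 / μ * (1 / (τ + 1)) ≤ 1 / τ := by
        have h1 : 1 / μ ≤ 1 := (div_le_one hμ0).2 hμ
        have h2 : 1 / (τ + 1) ≤ 1 / τ := one_div_le_one_div_of_le hs0 (by linarith)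
        have h3 : 0 ≤ 1 / (τ + 1) := by positivity
        nlinarith
      have b3 := mul_le_mul_of_nonneg_left b1 (by positivity : 0 ≤ n * K)
      have b4 := mul_le_mul_of_nonneg_left b2 (by positivity : 0 ≤ n * (4 * R ^ 2))
      have e2 : (τ - 1) * V = S * V := by rw [hτS]; ring
      rw [e2] at hm
      linarith
  have hfin := key T le_rfl
  have := mul_nonneg (Nat.cast_nonneg (α := ℝ) T)
    (lyapunov_nonneg (D := D) (N := N) (r := r) (μ := μ) (γ₀ := γ₀) (z₁ := z₁) (P := P)
      (u := u) y (T + 1))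
  linarith

/-- Summation of the recursion for a Slater point. -/
theorem sum_violationMoment_le_of_slater (h : AlgorithmSetting D N r R F G₁ G₂ μ γ₀ w B z₁)
    (hu : UniformDirections P u) {s : ℝ} (hs : 0 < s) (hS : D.Slater s) {T : ℕ} (hT : 1 ≤ T) :
    2 * γ₀ * s * ∑ t ∈ Finset.Icc 1 T, violationMoment D N μ γ₀ r z₁ P u 1 t
      ≤ n * (4 * F + stepConst p r R G₁ G₂ γ₀ + 8 * R ^ 2) * harmonicSum T := by
  obtain ⟨y, hy, hys⟩ := hS
  have hμ := h.one_le_μ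
  have hμ0 : 0 < μ := by linarith
  have hF := h.F_nonneg
  -- No time weight is used here: the contraction is dropped, and the loss gap, bounded below by
  -- `-2nF`, enters with the step size and so costs only a harmonic sum.
  have key : ∀ S, lyapunov D N μ γ₀ r z₁ P u y (S + 1)
      + 2 * γ₀ * s * ∑ t ∈ Finset.Icc 1 S, violationMoment D N μ γ₀ r z₁ P u 1 t
      ≤ n * (4 * R ^ 2)
        + n * (4 * F + stepConst p r R G₁ G₂ γ₀ + 4 * R ^ 2) * harmonicSum S := by
    intro S
    induction S with
    | zero => simpa [harmonicSum] using h.lyapunov_one_le hu hy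
    | succ S ih =>
      have hstep := h.lyapunov_succ_le hu (t := S + 1) (by omega) hy hs.le
        (fun i k => hys (S + 1) (by omega) ⟨i, k⟩)
      have hl := h.lossGap_ge hu (t := S + 1) (by omega) hy
      have hV := lyapunov_nonneg (D := D) (N := N) (r := r) (μ := μ) (γ₀ := γ₀) (z₁ := z₁)
        (P := P) (u := u) y (S + 1)
      have hm := violationMoment_nonneg (D := D) (N := N) (r := r) (μ := μ) (γ₀ := γ₀)
        (z₁ := z₁) (P := P) (u := u) 2 (S + 1)
      rw [harmonicSum, Finset.sum_Icc_succ_top (by omega), Finset.sum_Icc_succ_top (by omega),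
        ← harmonicSum]
      have hs0 : (0 : ℝ) < ((S + 1 : ℕ) : ℝ) := by positivity
      have hα := stepsize_pos hμ (show 1 ≤ S + 1 by omega)
      have hα1 := stepsize_le_one hμ (show 1 ≤ S + 1 by omega)
      have hα2 := stepsize_pos hμ (show 1 ≤ S + 1 + 1 by omega)
      set V := lyapunov D N μ γ₀ r z₁ P u y (S + 1)
      set l := lossGap D N μ γ₀ r z₁ P u y (S + 1)
      set m := violationMoment D N μ γ₀ r z₁ P u 2 (S + 1)
      set K := stepConst p r R G₁ G₂ γ₀
      have hK : 0 ≤ K := h.stepConst_nonneg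
      set τ : ℝ := ((S + 1 : ℕ) : ℝ) with hτ
      set α := 1 / (μ * τ)
      have hατ : α ≤ 1 / τ := one_div_le_one_div_of_le hs0 (by nlinarith)
      have c1 : (1 - 1 / τ) * V ≤ V := by
        have : 0 ≤ 1 / τ * V := by positivity
        linarith
      have c2 : -(2 * α * l) ≤ n * (4 * F) * (1 / τ) := by
        have h1 := mul_le_mul_of_nonneg_left hl (by positivity : 0 ≤ 2 * α)
        have h2 := mul_le_mul_of_nonneg_left hατ (by positivity : 0 ≤ n * (4 * F))
        linarith
      have c3 : 0 ≤ γ₀ * m := mul_nonneg h.γ₀_pos.le hm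
      have c4 : n * K * α ^ 2 ≤ n * K * (1 / τ) := by
        have : α ^ 2 ≤ 1 / τ := by nlinarith
        gcongr
      have c5 : n * (4 * R ^ 2) * (α - 1 / (μ * ((S + 1 + 1 : ℕ) : ℝ)))
          ≤ n * (4 * R ^ 2) * (1 / τ) := by
        refine mul_le_mul_of_nonneg_left ?_ (by positivity)
        linarith
      linarith
  have hfin := key T
  have hV := lyapunov_nonneg (D := D) (N := N) (r := r) (μ := μ) (γ₀ := γ₀) (z₁ := z₁)
    (P := P) (u := u) y (T + 1)
  have hH := one_le_harmonicSum hT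
  have : n * (4 * R ^ 2) * 1 ≤ n * (4 * R ^ 2) * harmonicSum T := by gcongr
  linarith

/-- Young's inequality between the accumulated first and second moments of the violations. -/
theorem sum_violationMoment_one_le (h : AlgorithmSetting D N r R F G₁ G₂ μ γ₀ w B z₁)
    (hu : UniformDirections P u) (T : ℕ) {θ : ℝ} (hθ : 0 < θ) :
    ∑ t ∈ Finset.Icc 1 T, violationMoment D N μ γ₀ r z₁ P u 1 t
      ≤ θ / 2 * ∑ t ∈ Finset.Icc 1 T, t * violationMoment D N μ γ₀ r z₁ P u 2 t
        + n / (2 * θ) * harmonicSum T := by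
  rw [harmonicSum, Finset.mul_sum, Finset.mul_sum, ← Finset.sum_add_distrib]
  refine Finset.sum_le_sum fun t ht => ?_
  have ht1 := (Finset.mem_Icc.1 ht).1
  have ht0 : (0 : ℝ) < t := by exact_mod_cast ht1
  have hv : ∀ i, ContinuousOn (fun x => ‖pos (D.g i t x)‖) D.X := fun i =>
    continuousOn_violation h.standing.convex i ht1
  calc violationMoment D N μ γ₀ r z₁ P u 1 t
      ≤ ∑ i, (θ * t / 2 * ∫ ω, ‖pos (D.g i t
          (decisions D N (stronglyConvexParams μ γ₀ r) z₁ u ω t i))‖ ^ 2 ∂P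
          + 1 / (2 * θ * t)) := by
        refine Finset.sum_le_sum fun i _ => ?_
        have i1 := h.integrable_decisions hu (φ := fun v => ‖pos (D.g i t v)‖ ^ 1)
          ((hv i).pow 1) ht1 i
        have i2 := h.integrable_decisions hu (φ := fun v => ‖pos (D.g i t v)‖ ^ 2)
          ((hv i).pow 2) ht1 i
        have hmono := integral_mono i1 ((i2.const_mul (θ * t / 2)).add
          (integrable_const (1 / (2 * θ * t)))) fun ω => by
            set A := ‖pos (D.g i t (decisions D N (stronglyConvexParams μ γ₀ r) z₁ u ω t i))‖
            -- Completing the square with weight `θ * t`, which matches the weight `t` on the second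
            -- moments.
            have e : θ * t / 2 * A ^ 2 + 1 / (2 * θ * t) - A
                = θ * t / 2 * (A - 1 / (θ * t)) ^ 2 := by
              field_simp
              ring
            have : 0 ≤ θ * t / 2 * (A - 1 / (θ * t)) ^ 2 := by positivity
            change A ^ 1 ≤ θ * t / 2 * A ^ 2 + 1 / (2 * θ * t)
            rw [pow_one]
            linarith
        rw [integral_add' (i2.const_mul (θ * t / 2)) (integrable_const _), integral_const_mul,
          integral_const, probReal_univ, one_smul] at hmono
        exact hmono
    _ = _ := by
        rw [Finset.sum_add_distrib, ← Finset.mul_sum, Finset.sum_const, Finset.card_univ,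
          Fintype.card_fin, nsmul_eq_mul, violationMoment]
        field_simp

end AlgorithmSetting

/-- Constant of the regret bound. -/
noncomputable def regretConst (n p : ℕ) (r R G₁ G₂ μ γ₀ w : ℝ) (B : ℕ) : ℝ :=
  μ / 2 * (stepConst p r R G₁ G₂ γ₀ + 4 * R ^ 2) + G₁ * consensusConst n p R G₁ G₂ γ₀ w B
    + G₁ * consensusConst n p R G₁ G₂ γ₀ w B
      * (n / (2 * (μ * γ₀ / (n * (G₁ * consensusConst n p R G₁ G₂ γ₀ w B + 1)))))

/-- Constant of the violation bound. -/
noncomputable def violationConst (n p : ℕ) (r R F G₁ G₂ γ₀ w : ℝ) (B : ℕ) : ℝ :=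
  (1 + n * G₂ * consensusConst n p R G₁ G₂ γ₀ w B)
    * (1 + n / 2 * ((stepConst p r R G₁ G₂ γ₀ + 4 * R ^ 2 + 4 * F) / γ₀ + 1))

/-- Constant of the violation bound under Slater's condition. -/
noncomputable def slaterConst (n p : ℕ) (r R F G₁ G₂ γ₀ w : ℝ) (B : ℕ) (s : ℝ) : ℝ :=
  (1 + n * G₂ * consensusConst n p R G₁ G₂ γ₀ w B)
    * (1 + n * (4 * F + stepConst p r R G₁ G₂ γ₀ + 8 * R ^ 2) / (2 * γ₀ * s))

namespace AlgorithmSetting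

theorem integral_netReg_le_harmonicSum (h : AlgorithmSetting D N r R F G₁ G₂ μ γ₀ w B z₁)
    (hu : UniformDirections P u) {T : ℕ} (hT : 1 ≤ T) :
    ∫ ω, D.netReg T (decisions D N (stronglyConvexParams μ γ₀ r) z₁ u ω) ∂P
      ≤ regretConst n p r R G₁ G₂ μ γ₀ w B * harmonicSum T := by
  have hn : (0 : ℝ) < n := by exact_mod_cast h.n_pos
  have hμ0 : 0 < μ := by linarith [h.one_le_μ]
  have hγ := h.γ₀_pos
  refine h.integral_netReg_le hu hT fun y hy => ?_
  have h1 := h.sum_lossGap_add_le hu hy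
  have hGK := mul_nonneg h.G₁_nonneg h.consensusConst_nonneg
  unfold regretConst
  rw [← mul_assoc G₁]
  set Q := G₁ * consensusConst n p R G₁ G₂ γ₀ w B with hQ
  -- Chosen so that the consensus cost `Q * (θ / 2)` stays below the coefficient `μ * γ₀ / (2 * n)`
  -- with which the second moments enter; `Q + 1` avoids dividing by zero.
  set θ := μ * γ₀ / (n * (Q + 1)) with hθ
  have hθ0 : 0 < θ := by positivity
  have h2 := mul_le_mul_of_nonneg_left
    (h.sum_violationMoment_one_le (P := P) (u := u) hu T hθ0) hGK
  have hb : 0 ≤ ∑ t ∈ Finset.Icc 1 T, t * violationMoment D N μ γ₀ r z₁ P u 2 t :=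
    Finset.sum_nonneg fun t _ => mul_nonneg (Nat.cast_nonneg _) (violationMoment_nonneg _ _)
  set b := ∑ t ∈ Finset.Icc 1 T, t * violationMoment D N μ γ₀ r z₁ P u 2 t
  set L := ∑ t ∈ Finset.Icc 1 T, lossGap D N μ γ₀ r z₁ P u y t
  set K := stepConst p r R G₁ G₂ γ₀
  have h3 : Q * (θ / 2) ≤ μ * γ₀ / (2 * n) := by
    rw [hθ, div_div, mul_div_assoc', div_le_div_iff₀ (by positivity) (by positivity)]
    have : 0 ≤ μ * γ₀ * n := by positivity
    nlinarith
  have h4 := mul_le_mul_of_nonneg_right h3 hb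
  have h5 := mul_le_mul_of_nonneg_left h1 (by positivity : 0 ≤ μ / (2 * n))
  have e1 : μ / (2 * n) * (2 / μ * L + γ₀ * b) = 1 / n * L + μ * γ₀ / (2 * n) * b := by
    field_simp
  have e2 : μ / (2 * n) * (n * (K + 4 * R ^ 2) * harmonicSum T)
      = μ / 2 * (K + 4 * R ^ 2) * harmonicSum T := by
    field_simp
  rw [e1, e2] at h5
  linarith

theorem integral_netCCV_le_sqrt (h : AlgorithmSetting D N r R F G₁ G₂ μ γ₀ w B z₁)
    (hu : UniformDirections P u) {T : ℕ} (hT : 1 ≤ T) :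
    ∫ ω, D.netCCV T (decisions D N (stronglyConvexParams μ γ₀ r) z₁ u ω) ∂P
      ≤ violationConst n p r R F G₁ G₂ γ₀ w B * Real.sqrt (T * harmonicSum T) := by
  have hn : (0 : ℝ) < n := by exact_mod_cast h.n_pos
  have hμ := h.one_le_μ
  have hγ := h.γ₀_pos
  have hF := h.F_nonneg
  have hK := h.stepConst_nonneg
  have hG₂ := h.G₂_nonneg
  have hc := h.consensusConst_nonneg
  have hH1 := one_le_harmonicSum hT
  have hHT := harmonicSum_le T
  have hT0 : (0 : ℝ) < T := by exact_mod_cast hT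
  refine (h.integral_netCCV_le hu hT).trans ?_
  unfold violationConst
  rw [mul_assoc (1 + n * G₂ * consensusConst n p R G₁ G₂ γ₀ w B)]
  refine mul_le_mul_of_nonneg_left ?_ (by positivity)
  obtain ⟨y, hy⟩ := h.standing.feasible T hT
  have h1 := h.sum_lossGap_add_le (P := P) (u := u) hu hy
  have hL : -(T * (n * (2 * F))) ≤ ∑ t ∈ Finset.Icc 1 T, lossGap D N μ γ₀ r z₁ P u y t := by
    calc -(T * (n * (2 * F))) = ∑ t ∈ Finset.Icc 1 T, -(n * (2 * F)) := by simp
      _ ≤ _ := Finset.sum_le_sum fun t ht => h.lossGap_ge hu (Finset.mem_Icc.1 ht).1 hy.1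
  set Q := Real.sqrt (T * harmonicSum T) with hQ
  have hQ2 : Q ^ 2 = T * harmonicSum T := Real.sq_sqrt (by positivity)
  have hQ0 : 0 < Q := Real.sqrt_pos.2 (by positivity)
  -- The value `θ = Q / T = √(H / T)` balances the two terms: the weighted second moments are of
  -- order `T`, so both become multiples of `Q`.
  have h2 := h.sum_violationMoment_one_le (P := P) (u := u) hu T (θ := Q / T) (by positivity)
  set b := ∑ t ∈ Finset.Icc 1 T, t * violationMoment D N μ γ₀ r z₁ P u 2 t
  set L := ∑ t ∈ Finset.Icc 1 T, lossGap D N μ γ₀ r z₁ P u y t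
  set K := stepConst p r R G₁ G₂ γ₀
  set H := harmonicSum T
  have h3 : -(2 / μ * L) ≤ 4 * F * n * T := by
    have h4 := mul_le_mul_of_nonneg_left hL (by positivity : 0 ≤ 2 / μ)
    have h5 : 2 / μ ≤ 2 := div_le_self (by norm_num) hμ
    have h6 := mul_le_mul_of_nonneg_right h5 (by positivity : 0 ≤ T * (n * (2 * F)))
    linarith
  have h7 : γ₀ * b ≤ n * (K + 4 * R ^ 2 + 4 * F) * T := by
    have := mul_le_mul_of_nonneg_left hHT (by positivity : 0 ≤ n * (K + 4 * R ^ 2))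
    linarith
  have h8 : b ≤ n * (K + 4 * R ^ 2 + 4 * F) * T / γ₀ := by
    rw [le_div_iff₀ hγ]; linarith
  have h9 := mul_le_mul_of_nonneg_left h8 (by positivity : 0 ≤ Q / T / 2)
  have e1 : Q / T / 2 * (n * (K + 4 * R ^ 2 + 4 * F) * T / γ₀)
      = n / 2 * ((K + 4 * R ^ 2 + 4 * F) / γ₀) * Q := by
    field_simp
  have e2 : n / (2 * (Q / T)) * H = n / 2 * Q := by
    have : n / (2 * (Q / T)) * H = n / 2 * (T * H / Q) := by field_simp
    rw [this, ← hQ2]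
    field_simp
  have h10 : H ≤ Q := by
    refine le_of_sq_le_sq ?_ hQ0.le
    rw [hQ2]; nlinarith
  rw [e1] at h9
  rw [e2] at h2
  linarith

theorem integral_netCCV_le_of_slater (h : AlgorithmSetting D N r R F G₁ G₂ μ γ₀ w B z₁)
    (hu : UniformDirections P u) {s : ℝ} (hs : 0 < s) (hS : D.Slater s) {T : ℕ} (hT : 1 ≤ T) :
    ∫ ω, D.netCCV T (decisions D N (stronglyConvexParams μ γ₀ r) z₁ u ω) ∂P
      ≤ slaterConst n p r R F G₁ G₂ γ₀ w B s * harmonicSum T := by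
  have hγ := h.γ₀_pos
  have hG₂ := h.G₂_nonneg
  have hc := h.consensusConst_nonneg
  refine (h.integral_netCCV_le hu hT).trans ?_
  unfold slaterConst
  rw [mul_assoc (1 + n * G₂ * consensusConst n p R G₁ G₂ γ₀ w B)]
  refine mul_le_mul_of_nonneg_left ?_ (by positivity)
  have h1 := h.sum_violationMoment_le_of_slater (P := P) (u := u) hu hs hS hT
  rw [mul_comm, ← le_div_iff₀ (by positivity)] at h1
  rw [add_mul, one_mul, div_mul_eq_mul_div]
  linarith

theorem regretConst_nonneg (h : AlgorithmSetting D N r R F G₁ G₂ μ γ₀ w B z₁) :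
    0 ≤ regretConst n p r R G₁ G₂ μ γ₀ w B := by
  have := h.one_le_μ
  have := h.γ₀_pos
  have := h.stepConst_nonneg
  have := h.G₁_nonneg
  have := h.consensusConst_nonneg
  unfold regretConst
  positivity

theorem violationConst_nonneg (h : AlgorithmSetting D N r R F G₁ G₂ μ γ₀ w B z₁) :
    0 ≤ violationConst n p r R F G₁ G₂ γ₀ w B := by
  have := h.γ₀_pos
  have := h.stepConst_nonneg
  have := h.G₂_nonneg
  have := h.F_nonneg
  have := h.consensusConst_nonneg
  unfold violationConst
  positivity

theorem slaterConst_nonneg (h : AlgorithmSetting D N r R F G₁ G₂ μ γ₀ w B z₁) {s : ℝ}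
    (hs : 0 < s) : 0 ≤ slaterConst n p r R F G₁ G₂ γ₀ w B s := by
  have := h.γ₀_pos
  have := h.stepConst_nonneg
  have := h.G₂_nonneg
  have := h.F_nonneg
  have := h.consensusConst_nonneg
  unfold slaterConst
  positivity

end AlgorithmSetting

theorem sqrt_mul_harmonicSum_le {T : ℕ} (hT : 2 ≤ T) :
    Real.sqrt (T * harmonicSum T) ≤ 3 * Real.sqrt (T * Real.log T) := by
  have h1 := harmonicSum_le_three_mul_log hT
  have h2 : 0 ≤ Real.log T := Real.log_natCast_nonneg T
  have h3 : (3 : ℝ) * Real.sqrt (T * Real.log T) = Real.sqrt (9 * (T * Real.log T)) := by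
    rw [Real.sqrt_mul (by norm_num : (0 : ℝ) ≤ 9), show (9 : ℝ) = 3 ^ 2 by norm_num,
      Real.sqrt_sq (by norm_num : (0 : ℝ) ≤ 3)]
  rw [h3]
  refine Real.sqrt_le_sqrt ?_
  have h4 := mul_le_mul_of_nonneg_left h1 (Nat.cast_nonneg (α := ℝ) T)
  have h5 : 0 ≤ (T : ℝ) * Real.log T := by positivity
  linarith

end Bounds

end DistBandit

/-! ### The main theorem. -/

theorem theorem4 (n p : ℕ) (hn : 0 < n) (hp : 0 < p)
    (r R F G₁ G₂ μ γ₀ w : ℝ) (B : ℕ)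
    (hr : 0 < r) (hμ : 1 ≤ μ)
    (hγ₀ : 0 < γ₀) (hγ₀_le : γ₀ * (4 * ((p : ℝ) ^ 2 + 1) * G₂ ^ 2) ≤ 1)
    (hw : 0 < w) (hw_lt : w < 1) (hB : 0 < B) :
    (∃ C : ℝ, ∀ (D : Problem n p) (N : Network n), Standing D N r R F G₁ G₂ μ w B →
      ∀ z₁ : Fin n → Vec p,
        (∀ i, z₁ i ∈ (1 - (stronglyConvexParams μ γ₀ r).ξ 1) • D.X) →
      ∀ (Ω : Type*) [MeasurableSpace Ω] (P : Measure Ω) [IsProbabilityMeasure P]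
        (u : ℕ → Fin n → Ω → Metric.sphere (0 : Vec p) 1), UniformDirections P u →
      (∀ T : ℕ,
        Integrable (fun ω => D.netReg T
          (decisions D N (stronglyConvexParams μ γ₀ r) z₁ u ω)) P ∧
        Integrable (fun ω => D.netCCV T
          (decisions D N (stronglyConvexParams μ γ₀ r) z₁ u ω)) P) ∧
      ∀ T : ℕ, 2 ≤ T →
        ∫ ω, D.netReg T (decisions D N (stronglyConvexParams μ γ₀ r) z₁ u ω) ∂P
          ≤ C * Real.log T ∧
        ∫ ω, D.netCCV T (decisions D N (stronglyConvexParams μ γ₀ r) z₁ u ω) ∂P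
          ≤ C * Real.sqrt (T * Real.log T)) ∧
    (∀ ς : ℝ, 0 < ς →
      ∃ C : ℝ, ∀ (D : Problem n p) (N : Network n), Standing D N r R F G₁ G₂ μ w B →
      D.Slater ς →
      ∀ z₁ : Fin n → Vec p,
        (∀ i, z₁ i ∈ (1 - (stronglyConvexParams μ γ₀ r).ξ 1) • D.X) →
      ∀ (Ω : Type*) [MeasurableSpace Ω] (P : Measure Ω) [IsProbabilityMeasure P]
        (u : ℕ → Fin n → Ω → Metric.sphere (0 : Vec p) 1), UniformDirections P u →
      ∀ T : ℕ, 2 ≤ T →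
        ∫ ω, D.netCCV T (decisions D N (stronglyConvexParams μ γ₀ r) z₁ u ω) ∂P
          ≤ C * Real.log T) := by
  refine ⟨⟨3 * max (regretConst n p r R G₁ G₂ μ γ₀ w B) (violationConst n p r R F G₁ G₂ γ₀ w B),
    fun D N hD z₁ hz₁ Ω _ P _ u hu => ?_⟩, fun ς hς =>
    ⟨3 * slaterConst n p r R F G₁ G₂ γ₀ w B ς, fun D N hD hS z₁ hz₁ Ω _ P _ u hu T hT => ?_⟩⟩
  · have h : AlgorithmSetting D N r R F G₁ G₂ μ γ₀ w B z₁ :=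
      ⟨hD, hn, hp, hr, hμ, hγ₀, hγ₀_le, hw, hw_lt, hz₁⟩
    refine ⟨fun T => ⟨h.integrable_netReg hu T, h.integrable_netCCV hu T⟩, fun T hT => ⟨?_, ?_⟩⟩
    · refine (h.integral_netReg_le_harmonicSum hu (by omega)).trans ?_
      have h1 := mul_le_mul_of_nonneg_left (harmonicSum_le_three_mul_log hT) h.regretConst_nonneg
      have h2 := mul_le_mul_of_nonneg_right (le_max_left (regretConst n p r R G₁ G₂ μ γ₀ w B)
        (violationConst n p r R F G₁ G₂ γ₀ w B)) (Real.log_natCast_nonneg T)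
      linarith
    · refine (h.integral_netCCV_le_sqrt hu (by omega)).trans ?_
      have h1 := mul_le_mul_of_nonneg_left (sqrt_mul_harmonicSum_le hT) h.violationConst_nonneg
      have h2 := mul_le_mul_of_nonneg_right (le_max_right (regretConst n p r R G₁ G₂ μ γ₀ w B)
        (violationConst n p r R F G₁ G₂ γ₀ w B)) (Real.sqrt_nonneg (T * Real.log T))
      linarith
  · have h : AlgorithmSetting D N r R F G₁ G₂ μ γ₀ w B z₁ :=
      ⟨hD, hn, hp, hr, hμ, hγ₀, hγ₀_le, hw, hw_lt, hz₁⟩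
    refine (h.integral_netCCV_le_of_slater hu hς hS (by omega)).trans ?_
    have h1 := mul_le_mul_of_nonneg_left (harmonicSum_le_three_mul_log hT)
      (h.slaterConst_nonneg hς)
    linarith
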